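/- **Setting.** Let $\mathbb{R}^6_2$ be $\mathbb{R}^6$ with $\langle x,x\rangle=x_1^2+x_2^2+x_3^2+x_4^2-x_5^2-x_6^2$ (extended complex bilinearly to $\mathbb{C}^6$), and let $Q^4_1\subset\mathbb{R}P^5$ be its projectivized light cone. Let $M$ be a Riemann surface. A smooth map $y:M\to Q^4_1$ is a *conformal spacelike surface* if $\langle Y_z,Y_z\rangle=0$ and $\langle Y_z,Y_{\bar z}\rangle>0$ for all smooth local lifts $Y$ of $y$ to the light cone minus the origin and all complex coordinates $z$. For a given coordinate $z$ there are, locally, *canonical lifts* $Y$, i.e. lifts with $|dY|^2=|dz|^2$. Let $V=\mathrm{Span}\{Y,dY,Y_{z\bar z}\}$, let $N\in V$ be the vector with $\langle N,Y_z\rangle=\langle N,Y_{\bar z}\rangle=\langle N,N\rangle=0$, $\langle N,Y\rangle=-1$, let $D$ be the normal connection on $V^\perp$ (differentiation followed by orthogonal projection), and let the conformal Hopf differential $\kappa$ be the $V^\perp_{\mathbb{C}}$-part of $Y_{zz}$. A point is *umbilic* if $\kappa=0$ there. The surface is *Willmore* if it is critical, under all compactly supported smooth variations of the map $y$ into $Q^4_1$,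 for the Willmore functional $W=\frac{i}{2}\int\langle\kappa,\bar\kappa\rangle\,dz\wedge d\bar z$ (for a variation $y_t$, $z$ is a conformal coordinate of $y_t$). It is *S-Willmore* if it is Willmore and, wherever $\kappa\ne0$, $D_{\bar z}\kappa=-\frac{\bar\mu}{2}\kappa$ for some function $\mu$; then, where $\kappa\neq 0$, its *dual Willmore surface* is $\big[\tfrac{|\mu|^2}{2}Y+\bar\mu Y_z+\mu Y_{\bar z}+N\big]$. A holomorphic $k$-form is an expression $\theta(dz)^k$ with $\theta$ holomorphic in every coordinate and $\theta_z=\theta_w(dw/dz)^k$. **Statement.** Let $y:M\to Q^4_1$ be a spacelike Willmore surface. (i) The expression $$\Theta(dz)^6=\big[\langle D_{\bar z}\kappa,\kappa\rangle^2-\langle\kappa,\kappa\rangle\langle D_{\bar z}\kappa,D_{\bar z}\kappa\rangle\big](dz)^6,$$ computed from canonical lifts, is a globally defined holomorphic $6$-form on $M$. (ii) Suppose $M=S^2$ (a Riemann surface biholomorphic to the Riemann sphere $\mathbb{C}\cup\{\infty\}$). Then $\Theta\equiv0$ and $y$ is S-Willmore. On the open set $M_0\subset M$ of non-umbilic points let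 $Y$ be a canonical lift of $y$ and $\hat Y$ the local lift of the dual Willmore surface with $\langle Y,\hat Y\rangle=-1$ (it exists and is smooth). Then $$\Omega(dz)^8=\langle Y_{zz},Y_{zz}\rangle\langle\hat Y_{zz},\hat Y_{zz}\rangle(dz)^8$$ extends from $M_0$ to a holomorphic $8$-form on $S^2$, and this form vanishes identically; in particular $\Omega\equiv0$ on $M_0$. Moreover, on $M_0$, $\Omega=4(\rho\lambda_1\lambda_2)^2$ whenever $\kappa=\lambda_1L+\lambda_2R$ with $L,R$ a real frame of $V^\perp$ satisfying $\langle L,L\rangle=\langle R,R\rangle=0$, $\langle L,R\rangle=-1$, where $\rho=\bar\mu_z-2\langle\kappa,\bar\kappa\rangle=\bar\mu_z+2\lambda_1\bar\lambda_2+2\lambda_2\bar\lambda_1$. -/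

import Mathlib

open scoped Manifold ContDiff LinearAlgebra.Projectivization ComplexConjugate

noncomputable section

namespace Willmore

/-! ### The Riemann sphere -/

/-- The inversion `z ↦ 1/z` of `ℂ ∪ {∞}`. -/
def sphereInv : OnePoint ℂ → OnePoint ℂ
  | OnePoint.infty => ((0 : ℂ) : OnePoint ℂ)
  | OnePoint.some z => if z = 0 then OnePoint.infty else ((z⁻¹ : ℂ) : OnePoint ℂ)

theorem sphereInv_infty : sphereInv OnePoint.infty = ((0 : ℂ) : OnePoint ℂ) := rfl

theorem sphereInv_zero : sphereInv ((0 : ℂ) : OnePoint ℂ) = OnePoint.infty := if_pos rfl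

theorem sphereInv_coe {z : ℂ} (hz : z ≠ 0) :
    sphereInv (z : OnePoint ℂ) = ((z⁻¹ : ℂ) : OnePoint ℂ) := if_neg hz

theorem sphereInv_sphereInv (p : OnePoint ℂ) : sphereInv (sphereInv p) = p := by
  induction p using OnePoint.rec with
  | infty => rw [sphereInv_infty, sphereInv_zero]
  | coe z =>
    by_cases hz : z = 0
    · rw [hz, sphereInv_zero, sphereInv_infty]
    · rw [sphereInv_coe hz, sphereInv_coe (inv_ne_zero hz), inv_inv]

theorem continuous_sphereInv : Continuous sphereInv := by
  rw [continuous_iff_continuousAt]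
  intro p
  induction p using OnePoint.rec with
  | infty =>
    rw [OnePoint.continuousAt_infty', sphereInv_infty, Filter.coclosedCompact_eq_cocompact]
    have h1 : Filter.Tendsto (fun z : ℂ => ((z⁻¹ : ℂ) : OnePoint ℂ)) (Filter.cocompact ℂ)
        (nhds ((0 : ℂ) : OnePoint ℂ)) :=
      (OnePoint.continuous_coe.tendsto (0 : ℂ)).comp (by
        rw [← Metric.cobounded_eq_cocompact]
        exact Filter.tendsto_inv₀_cobounded)
    refine h1.congr' ?_
    have h2 : ({0}ᶜ : Set ℂ) ∈ Filter.cocompact ℂ := (isCompact_singleton).compl_mem_cocompact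
    filter_upwards [h2] with z hz
    exact (sphereInv_coe hz).symm
  | coe z =>
    rw [OnePoint.continuousAt_coe]
    by_cases hz : z = 0
    · subst hz
      rw [continuousAt_iff_punctured_nhds]
      have h1 : Filter.Tendsto (fun z : ℂ => ((z⁻¹ : ℂ) : OnePoint ℂ)) (nhdsWithin 0 {0}ᶜ)
          (nhds OnePoint.infty) := by
        refine OnePoint.tendsto_coe_infty.comp ?_
        rw [Filter.coclosedCompact_eq_cocompact, ← Metric.cobounded_eq_cocompact]
        exact Filter.tendsto_inv₀_nhdsNE_zero
      have h3 : (sphereInv ∘ ((↑) : ℂ → OnePoint ℂ)) 0 = OnePoint.infty := sphereInv_zero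
      rw [h3]
      refine h1.congr' ?_
      filter_upwards [self_mem_nhdsWithin] with w hw
      exact (sphereInv_coe hw).symm
    · have h1 : ContinuousAt (fun z : ℂ => ((z⁻¹ : ℂ) : OnePoint ℂ)) z :=
        OnePoint.continuous_coe.continuousAt.comp (continuousAt_inv₀ hz)
      refine h1.congr ?_
      filter_upwards [isOpen_ne.mem_nhds hz] with w hw
      exact (sphereInv_coe hw).symm

/-- The inversion as a homeomorphism of `ℂ ∪ {∞}`. -/
def sphereInvHomeo : OnePoint ℂ ≃ₜ OnePoint ℂ where
  toFun := sphereInv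
  invFun := sphereInv
  left_inv := sphereInv_sphereInv
  right_inv := sphereInv_sphereInv
  continuous_toFun := continuous_sphereInv
  continuous_invFun := continuous_sphereInv

/-- The affine coordinate `z` on `(ℂ ∪ {∞}) \ {∞}`. -/
def sphereChart : OpenPartialHomeomorph (OnePoint ℂ) ℂ :=
  (OnePoint.isOpenEmbedding_coe.toOpenPartialHomeomorph ((↑) : ℂ → OnePoint ℂ)).symm

/-- The affine coordinate `1/z` on `(ℂ ∪ {∞}) \ {0}`. -/
def sphereChartInv : OpenPartialHomeomorph (OnePoint ℂ) ℂ :=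
  sphereInvHomeo.toOpenPartialHomeomorph.trans sphereChart

theorem sphereChart_source : sphereChart.source = {OnePoint.infty}ᶜ := by
  simp [sphereChart, OnePoint.compl_infty]

theorem sphereChart_coe (z : ℂ) : sphereChart (z : OnePoint ℂ) = z :=
  OnePoint.isOpenEmbedding_coe.toOpenPartialHomeomorph_left_inv _

theorem sphereChart_symm (z : ℂ) : sphereChart.symm z = (z : OnePoint ℂ) := rfl

theorem sphereChartInv_source : sphereChartInv.source = {((0 : ℂ) : OnePoint ℂ)}ᶜ := by
  ext p
  have h : p ∈ sphereChartInv.source ↔ sphereInv p ∈ sphereChart.source := by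
    simp [sphereChartInv, sphereInvHomeo]
  rw [h, sphereChart_source]
  simp only [Set.mem_compl_iff, Set.mem_singleton_iff, not_iff_not]
  constructor
  · intro h
    rw [← sphereInv_sphereInv p, h, sphereInv_infty]
  · intro h
    rw [h, sphereInv_zero]

/-- The standard complex structure on `S² = ℂ ∪ {∞}`. -/
instance : ChartedSpace ℂ (OnePoint ℂ) where
  atlas := {sphereChart, sphereChartInv}
  chartAt p := open Classical in if p = OnePoint.infty then sphereChartInv else sphereChart
  mem_chart_source p := by
    by_cases hp : p = OnePoint.infty
    · simp [hp, sphereChartInv_source]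
    · simp [hp, sphereChart_source]
  chart_mem_atlas p := by
    by_cases hp : p = OnePoint.infty <;> simp [hp]

theorem sphere_transition :
    sphereChart.symm.trans sphereChartInv ∈ contDiffGroupoid ω 𝓘(ℂ) ∧
      sphereChartInv.symm.trans sphereChart ∈ contDiffGroupoid ω 𝓘(ℂ) := by
  have hs1 : (sphereChart.symm.trans sphereChartInv).source = {0}ᶜ := by
    ext z
    simp [sphereChartInv_source, sphereChart]
  have he1 : Set.EqOn (sphereChart.symm.trans sphereChartInv) (fun z => z⁻¹) {0}ᶜ := by
    intro z hz
    change sphereChart (sphereInv (z : OnePoint ℂ)) = z⁻¹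
    rw [sphereInv_coe hz, sphereChart_coe]
  have hs2 : (sphereChart.symm.trans sphereChartInv).target = {0}ᶜ := by
    ext z
    have : z ∈ (sphereChart.symm.trans sphereChartInv).target ↔
        sphereInv (z : OnePoint ℂ) ∈ sphereChart.source := by
      simp [sphereChartInv, sphereChart, sphereInvHomeo]
    rw [this, sphereChart_source]
    by_cases hz : z = 0
    · simp [hz, sphereInv_zero]
    · simp [sphereInv_coe hz, hz]
  have he2 : Set.EqOn (sphereChart.symm.trans sphereChartInv).symm (fun z => z⁻¹) {0}ᶜ := by
    intro z hz
    change sphereChart (sphereInv (z : OnePoint ℂ)) = z⁻¹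
    rw [sphereInv_coe hz, sphereChart_coe]
  have hinv : ContDiffOn ℂ ω (fun z : ℂ => z⁻¹) {0}ᶜ := contDiffOn_inv ℂ
  have key : sphereChart.symm.trans sphereChartInv ∈ contDiffGroupoid ω 𝓘(ℂ) := by
    rw [contDiffGroupoid, mem_groupoid_of_pregroupoid]
    constructor
    · have h := hinv.congr he1
      rw [← hs1] at h
      simpa [contDiffPregroupoid] using h
    · have h := hinv.congr he2
      rw [← hs2] at h
      simpa [contDiffPregroupoid] using h
  exact ⟨key, (contDiffGroupoid ω 𝓘(ℂ)).symm key⟩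

instance : IsManifold 𝓘(ℂ) ω (OnePoint ℂ) where
  compatible := by
    intro e f he hf
    have hself : ∀ g : OpenPartialHomeomorph (OnePoint ℂ) ℂ,
        g.symm.trans g ∈ contDiffGroupoid ω 𝓘(ℂ) := fun g => symm_trans_mem_contDiffGroupoid g
    rcases he with rfl | rfl <;> rcases hf with rfl | rfl
    · exact hself _
    · exact sphere_transition.1
    · exact sphere_transition.2
    · exact hself _

/-! ### The conformal space -/

/-- The inner product `⟨x, y⟩ = x₁y₁ + x₂y₂ + x₃y₃ + x₄y₄ - x₅y₅ - x₆y₆` of `ℝ⁶₂`, and its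
complex bilinear extension to `ℂ⁶`. -/
def lor {𝕜 : Type*} [CommRing 𝕜] (x y : Fin 6 → 𝕜) : 𝕜 :=
  x 0 * y 0 + x 1 * y 1 + x 2 * y 2 + x 3 * y 3 - x 4 * y 4 - x 5 * y 5

/-- The projectivized light cone `Q⁴₁` of `ℝ⁶₂`. -/
def Q41 : Type := {p : ℙ ℝ (Fin 6 → ℝ) // ∀ v ∈ p.submodule, lor v v = 0}

/-- The inclusion `ℝ⁶ ⊂ ℂ⁶`. -/
def cplx (v : Fin 6 → ℝ) : Fin 6 → ℂ := fun i => (v i : ℂ)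

/-- The Wirtinger derivative `∂F/∂z = (F_u - i F_v) / 2`, `z = u + i v`. -/
def dz {E : Type*} [NormedAddCommGroup E] [NormedSpace ℂ E] (F : ℂ → E) (z : ℂ) : E :=
  (1 / 2 : ℂ) • (fderiv ℝ F z 1 - Complex.I • fderiv ℝ F z Complex.I)

/-- The Wirtinger derivative `∂F/∂z̄ = (F_u + i F_v) / 2`. -/
def dzbar {E : Type*} [NormedAddCommGroup E] [NormedSpace ℂ E] (F : ℂ → E) (z : ℂ) : E :=
  (1 / 2 : ℂ) • (fderiv ℝ F z 1 + Complex.I • fderiv ℝ F z Complex.I)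

section Surface

variable {M : Type*} [TopologicalSpace M] [ChartedSpace ℂ M]

/-- `Y` is a smooth local lift of `y : M → Q⁴₁` over the open set `U`, written in the complex
coordinate `e` (so `U` lies in the coordinate image `e.target ⊆ ℂ`). -/
structure IsLift (y : M → Q41) (e : OpenPartialHomeomorph M ℂ) (U : Set ℂ)
    (Y : ℂ → Fin 6 → ℝ) : Prop where
  isOpen : IsOpen U
  subset : U ⊆ e.target
  smooth : ContDiffOn ℝ ∞ Y U
  lifts : ∀ z ∈ U, ∃ h : Y z ≠ 0, Projectivization.mk ℝ (Y z) h = (y (e.symm z)).1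

/-- `Y_z`, with values in `ℂ⁶`. -/
def Yz (Y : ℂ → Fin 6 → ℝ) : ℂ → Fin 6 → ℂ := dz fun w => cplx (Y w)

/-- `Y_z̄`, with values in `ℂ⁶`. -/
def Yzbar (Y : ℂ → Fin 6 → ℝ) : ℂ → Fin 6 → ℂ := dzbar fun w => cplx (Y w)

/-- `Y_zz`. -/
def Yzz (Y : ℂ → Fin 6 → ℝ) : ℂ → Fin 6 → ℂ := dz (Yz Y)

/-- `Y_zz̄`. -/
def Yzzbar (Y : ℂ → Fin 6 → ℝ) : ℂ → Fin 6 → ℂ := dzbar (Yz Y)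

/-- `y : M → Q⁴₁` is a (smooth, immersed) conformal spacelike surface: it has smooth local lifts
at every point, and `⟨Y_z, Y_z⟩ = 0`, `⟨Y_z, Y_z̄⟩ > 0` for every local lift `Y` and every complex
coordinate. (`⟨Y_z, Y_z̄⟩` is always real.) -/
structure IsConformalSpacelike (y : M → Q41) : Prop where
  exists_lift : ∀ e ∈ IsManifold.maximalAtlas 𝓘(ℂ) ω M, ∀ z ∈ e.target,
    ∃ (U : Set ℂ) (Y : ℂ → Fin 6 → ℝ), z ∈ U ∧ IsLift y e U Y
  conformal : ∀ e ∈ IsManifold.maximalAtlas 𝓘(ℂ) ω M, ∀ (U : Set ℂ) (Y : ℂ → Fin 6 → ℝ),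
    IsLift y e U Y → ∀ z ∈ U, lor (Yz Y z) (Yz Y z) = 0 ∧ 0 < (lor (Yz Y z) (Yzbar Y z)).re

/-- A canonical lift with respect to the coordinate `e`: a local lift with `|dY|² = |dz|²`. -/
structure IsCanonicalLift (y : M → Q41) (e : OpenPartialHomeomorph M ℂ) (U : Set ℂ)
    (Y : ℂ → Fin 6 → ℝ) : Prop extends IsLift y e U Y where
  metric : ∀ z ∈ U, ∀ v : ℂ, lor (fderiv ℝ Y z v) (fderiv ℝ Y z v) = ‖v‖ ^ 2

/-! ### The Willmore functional -/

/-- The coordinate partial derivatives `Y_u` (`i = 0`) and `Y_v` (`i = 1`). -/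
def pd (i : Fin 2) (Y : ℂ → Fin 6 → ℝ) (z : ℂ) : Fin 6 → ℝ := fderiv ℝ Y z (![1, Complex.I] i)

/-- The induced metric `g_ij = ⟨Y_i, Y_j⟩` of a lift. -/
def metric (Y : ℂ → Fin 6 → ℝ) (z : ℂ) : Matrix (Fin 2) (Fin 2) ℝ :=
  Matrix.of fun i j => lor (pd i Y z) (pd j Y z)

/-- `T_ij = Y_ij - ½ g_ij (g^{kl} Y_kl)`, the trace-free part of the matrix of second
derivatives. It is orthogonal to `Y`. -/
def tracefreeHess (Y : ℂ → Fin 6 → ℝ) (z : ℂ) (i j : Fin 2) : Fin 6 → ℝ :=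
  pd i (pd j Y) z -
    (metric Y z i j / 2) • ∑ k, ∑ l, (metric Y z)⁻¹ k l • pd k (pd l Y) z

/-- `T_ij` minus its tangential part. Modulo multiples of `Y`, which is null and orthogonal to it,
this is the projection of `Y_ij` to the orthogonal complement of
`V = Span {Y, Y_u, Y_v, Δ_g Y}`, i.e. the trace-free second fundamental form. -/
def tracefreeSFF (Y : ℂ → Fin 6 → ℝ) (z : ℂ) (i j : Fin 2) : Fin 6 → ℝ :=
  tracefreeHess Y z i j -
    ∑ m, ∑ n, ((metric Y z)⁻¹ m n * lor (tracefreeHess Y z i j) (pd m Y z)) • pd n Y z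

/-- The density with respect to `du dv` of the Willmore functional of the spacelike, not
necessarily conformal, immersion `[Y]`: with `h` the trace-free second fundamental form it is
`⅛ |h|²_g dA_g`. It does not depend on the lift, it is a density on the surface, i.e. independent
of the real coordinates, and in a conformal coordinate `z` of `[Y]` it is
`⟨κ, κ̄⟩ (i/2) dz ∧ dz̄`, with `κ` the conformal Hopf differential. -/
def willmoreDensity (Y : ℂ → Fin 6 → ℝ) (z : ℂ) : ℝ :=
  (1 / 8) * (∑ i, ∑ j, ∑ k, ∑ l, (metric Y z)⁻¹ i k * (metric Y z)⁻¹ j l *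
    lor (tracefreeSFF Y z i j) (tracefreeSFF Y z k l)) * √(metric Y z).det

/-- A smooth variation `y_t = [F t]`, `|t| < ε`, of the surface `y` in the domain `U` of a lift,
supported in the compact set `K ⊆ U`. -/
structure IsVariation (y : M → Q41) (e : OpenPartialHomeomorph M ℂ) (U K : Set ℂ) (ε : ℝ)
    (F : ℝ → ℂ → Fin 6 → ℝ) : Prop where
  pos : 0 < ε
  isCompact : IsCompact K
  subset : K ⊆ U
  lift : IsLift y e U (F 0)
  smooth : ContDiffOn ℝ ∞ (fun p : ℝ × ℂ => F p.1 p.2) (Set.Ioo (-ε) ε ×ˢ U)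
  cone : ∀ t ∈ Set.Ioo (-ε) ε, ∀ z ∈ U, F t z ≠ 0 ∧ lor (F t z) (F t z) = 0
  support : ∀ t ∈ Set.Ioo (-ε) ε, ∀ z ∈ U \ K, F t z = F 0 z

/-- A spacelike Willmore surface: a conformal spacelike surface that is critical for the Willmore
functional with respect to all variations with compact support (in coordinate domains). -/
structure IsWillmore (y : M → Q41) : Prop where
  conformalSpacelike : IsConformalSpacelike y
  critical : ∀ e ∈ IsManifold.maximalAtlas 𝓘(ℂ) ω M, ∀ (U K : Set ℂ) (ε : ℝ)
    (F : ℝ → ℂ → Fin 6 → ℝ), IsVariation y e U K ε F →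
      HasDerivAt (fun t => ∫ z in K, willmoreDensity (F t) z) 0 0

/-! ### Invariants of a canonical lift -/

/-- The frame vector `N ∈ V = Span {Y, Y_z, Y_z̄, Y_zz̄}` of a canonical lift, i.e. the one with
`⟨N, Y_z⟩ = ⟨N, Y_z̄⟩ = ⟨N, N⟩ = 0` and `⟨N, Y⟩ = -1`. -/
def frameN (Y : ℂ → Fin 6 → ℝ) (z : ℂ) : Fin 6 → ℂ :=
  (2 : ℂ) • Yzzbar Y z + (2 * lor (Yzzbar Y z) (Yzzbar Y z)) • cplx (Y z)

/-- The orthogonal projection `ℂ⁶ → V^⊥_ℂ` at `z`, expressed in the frame `Y, N, Y_z, Y_z̄` of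
`V_ℂ`, in which `⟨Y, N⟩ = -1`, `⟨Y_z, Y_z̄⟩ = 1/2` and all other products vanish. -/
def normalPart (Y : ℂ → Fin 6 → ℝ) (z : ℂ) (X : Fin 6 → ℂ) : Fin 6 → ℂ :=
  X + lor X (frameN Y z) • cplx (Y z) + lor X (cplx (Y z)) • frameN Y z
    - (2 * lor X (Yzbar Y z)) • Yz Y z - (2 * lor X (Yz Y z)) • Yzbar Y z

/-- The conformal Hopf differential `κ`, the `V^⊥_ℂ`-part of `Y_zz`. -/
def kappa (Y : ℂ → Fin 6 → ℝ) (z : ℂ) : Fin 6 → ℂ := normalPart Y z (Yzz Y z)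

/-- The normal connection `D_z̄` on sections of `V^⊥_ℂ`. -/
def normalDzbar (Y : ℂ → Fin 6 → ℝ) (ξ : ℂ → Fin 6 → ℂ) (z : ℂ) : Fin 6 → ℂ :=
  normalPart Y z (dzbar ξ z)

/-- `D_z̄ κ`. -/
def DzbarKappa (Y : ℂ → Fin 6 → ℝ) : ℂ → Fin 6 → ℂ := normalDzbar Y (kappa Y)

/-- `Θ = ⟨D_z̄ κ, κ⟩² - ⟨κ, κ⟩ ⟨D_z̄ κ, D_z̄ κ⟩`. -/
def Theta (Y : ℂ → Fin 6 → ℝ) (z : ℂ) : ℂ :=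
  lor (DzbarKappa Y z) (kappa Y z) ^ 2 -
    lor (kappa Y z) (kappa Y z) * lor (DzbarKappa Y z) (DzbarKappa Y z)

/-- `β = -⟨κ, κ̄⟩`. -/
def beta (Y : ℂ → Fin 6 → ℝ) (z : ℂ) : ℂ := -lor (kappa Y z) (fun i => conj (kappa Y z i))

/-- An S-Willmore surface: a Willmore surface with `D_z̄ κ = -(μ̄/2) κ` for some `μ` wherever
`κ ≠ 0`. -/
structure IsSWillmore (y : M → Q41) : Prop extends IsWillmore y where
  parallel : ∀ e ∈ IsManifold.maximalAtlas 𝓘(ℂ) ω M, ∀ (U : Set ℂ) (Y : ℂ → Fin 6 → ℝ),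
    IsCanonicalLift y e U Y → ∀ z ∈ U, kappa Y z ≠ 0 →
      ∃ μ : ℂ, DzbarKappa Y z = (-(conj μ / 2)) • kappa Y z

/-- `D_z̄ κ = -(μ̄/2) κ` on `U`. -/
def IsMu (Y : ℂ → Fin 6 → ℝ) (U : Set ℂ) (μ : ℂ → ℂ) : Prop :=
  ∀ z ∈ U, DzbarKappa Y z = (-(conj (μ z) / 2)) • kappa Y z

/-- The vector `(|μ|²/2) Y + μ̄ Y_z + μ Y_z̄ + N`, which represents the dual Willmore surface. -/
def dualVector (Y : ℂ → Fin 6 → ℝ) (μ : ℂ → ℂ) (z : ℂ) : Fin 6 → ℂ :=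
  ((‖μ z‖ ^ 2 / 2 : ℝ) : ℂ) • cplx (Y z) + conj (μ z) • Yz Y z + μ z • Yzbar Y z + frameN Y z

/-- `Yh` is a lift over `U` of the dual Willmore surface, normalized by `⟨Y, Yh⟩ = -1`. -/
structure IsDualLift (Y : ℂ → Fin 6 → ℝ) (U : Set ℂ) (μ : ℂ → ℂ) (Yh : ℂ → Fin 6 → ℝ) :
    Prop where
  lifts : ∀ z ∈ U, ∃ c : ℝ, c ≠ 0 ∧ cplx (Yh z) = (c : ℂ) • dualVector Y μ z
  normalized : ∀ z ∈ U, lor (Y z) (Yh z) = -1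

/-- `ρ = (μ̄)_z + 2 β`. -/
def rho (Y : ℂ → Fin 6 → ℝ) (μ : ℂ → ℂ) (z : ℂ) : ℂ := dz (fun w => conj (μ w)) z + 2 * beta Y z

/-- `Ω = ⟨Y_zz, Y_zz⟩ ⟨Ŷ_zz, Ŷ_zz⟩`. -/
def Omega (Y Yh : ℂ → Fin 6 → ℝ) (z : ℂ) : ℂ :=
  lor (Yzz Y z) (Yzz Y z) * lor (Yzz Yh z) (Yzz Yh z)

/-- `L, R` is a real null frame of the normal plane `V^⊥` at `z`, with `⟨L, R⟩ = -1`. -/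
structure IsNullFrame (Y : ℂ → Fin 6 → ℝ) (z : ℂ) (L R : Fin 6 → ℝ) : Prop where
  normal_L : normalPart Y z (cplx L) = cplx L
  normal_R : normalPart Y z (cplx R) = cplx R
  null_L : lor L L = 0
  null_R : lor R R = 0
  pairing : lor L R = -1

/-! ### Holomorphic differentials -/

/-- A family `θ` of functions, `θ e` for each complex coordinate `e`, is a holomorphic `k`-form
`θ (dz)^k` on the Riemann surface `M`: each function is holomorphic in its coordinate domain, and
`θ_z = θ_w (dw/dz)^k` under changes of coordinates. -/
structure IsHolomorphicForm (M : Type*) [TopologicalSpace M] [ChartedSpace ℂ M] (k : ℕ)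
    (θ : OpenPartialHomeomorph M ℂ → ℂ → ℂ) : Prop where
  holomorphic : ∀ e ∈ IsManifold.maximalAtlas 𝓘(ℂ) ω M, DifferentiableOn ℂ (θ e) e.target
  transform : ∀ e ∈ IsManifold.maximalAtlas 𝓘(ℂ) ω M, ∀ f ∈ IsManifold.maximalAtlas 𝓘(ℂ) ω M,
    ∀ p ∈ e.source ∩ f.source, θ e (e p) = θ f (f p) * deriv (f ∘ e.symm) (e p) ^ k

end Surface

end Willmore

end

open Willmore

/-! The analytic input is the Euler–Lagrange equation D_z̄ D_z̄ κ + (s̄/2) κ = 0, proved in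
`IsWillmore.willmoreEq`. For a normal field ξ of compact support, Y + tξ + t²·½⟨ξ,ξ⟩N stays on the
light cone. The derivative of its Willmore density is computed on 2-jets (`hasDerivAt_jetDensity`),
rewritten in complex form (`IsIsothermal.hasDerivAt_density`), integrated by parts, and tested
against cut-off normal fields.

The equation says that the second z̄-derivative of κ is a multiple of κ. Now Θ is minus the Gram
determinant of κ and D_z̄ κ. Since the derivatives of this pair are D_z̄ κ and a multiple of κ, the
determinant has vanishing z̄-derivative (`IsIsothermal.dzbar_Theta`). Under a change of coordinate κ
is rescaled, while D_z̄ κ is rescaled and sheared by a multiple of κ; the determinant ignores the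
shear, and the scale factors combine to weight 6 (`IsCoordChange.Theta_eq`). This gives (i).

On the sphere a holomorphic form of positive weight vanishes, by Liouville's theorem
(`IsHolomorphicForm.eq_zero_of_sphere`). So Θ = 0. The complexified normal bundle is a nondegenerate
plane, hence D_z̄ κ is proportional to κ wherever κ ≠ 0 (`exists_smul_eq_of_gram`): the surface is
S-Willmore.

For Ω no removable-singularity argument is needed. The function `quartic` is a polynomial in κ and
its covariant derivatives, so it is smooth across umbilic points. Off them it equals ρ⟨κ,κ⟩, and the
derivative formula for the dual vector gives ⟨Ŷ_zz,Ŷ_zz⟩ = ρ²⟨κ,κ⟩, so Ω = `quartic`²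
(`IsIsothermal.Omega_eq`). The Ricci, Gauss and Willmore equations reduce the z̄-derivative of
`quartic` to an expression that vanishes when D_z̄ κ is parallel to κ
(`IsIsothermal.dzbar_quartic`), and `quartic` has weight 4 (`IsCoordChange.quartic_eq`). Its square
is the required holomorphic 8-form, and vanishes on the sphere. -/

noncomputable section
namespace Willmore

/-! ### Wirtinger calculus -/

section Wirtinger

variable {E : Type*} [NormedAddCommGroup E] [NormedSpace ℂ E]

/-- The operator `(∂_u + c ∂_v) / 2`; it is `∂_z` for `c = -i` and `∂_z̄` for `c = i`. -/
def wirt (c : ℂ) (F : ℂ → E) (z : ℂ) : E :=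
  (1 / 2 : ℂ) • (fderiv ℝ F z 1 + c • fderiv ℝ F z Complex.I)

theorem dz_eq_wirt (F : ℂ → E) : dz F = wirt (-Complex.I) F := by
  funext z; simp only [dz, wirt, neg_smul, sub_eq_add_neg]

theorem dzbar_eq_wirt (F : ℂ → E) : dzbar F = wirt Complex.I F := rfl

theorem wirt_congr {c : ℂ} {F G : ℂ → E} {z : ℂ} (h : F =ᶠ[nhds z] G) :
    wirt c F z = wirt c G z := by
  simp only [wirt, h.fderiv_eq]

theorem wirt_congr_on {c : ℂ} {F G : ℂ → E} {U : Set ℂ} (hU : IsOpen U)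
    (h : ∀ z ∈ U, F z = G z) {z : ℂ} (hz : z ∈ U) : wirt c F z = wirt c G z :=
  wirt_congr (Filter.eventuallyEq_of_mem (hU.mem_nhds hz) h)

theorem wirt_const (c : ℂ) (a : E) (z : ℂ) : wirt c (fun _ => a) z = 0 := by
  simp [wirt]

theorem wirt_add {c : ℂ} {F G : ℂ → E} {z : ℂ} (hF : DifferentiableAt ℝ F z)
    (hG : DifferentiableAt ℝ G z) :
    wirt c (fun w => F w + G w) z = wirt c F z + wirt c G z := by
  simp only [wirt, fderiv_fun_add hF hG, _root_.add_apply, smul_add]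
  abel

theorem wirt_sub {c : ℂ} {F G : ℂ → E} {z : ℂ} (hF : DifferentiableAt ℝ F z)
    (hG : DifferentiableAt ℝ G z) :
    wirt c (fun w => F w - G w) z = wirt c F z - wirt c G z := by
  simp only [wirt, fderiv_fun_sub hF hG, _root_.sub_apply, smul_add, smul_sub]
  abel

theorem wirt_neg {c : ℂ} {F : ℂ → E} {z : ℂ} :
    wirt c (fun w => - F w) z = - wirt c F z := by
  simp only [wirt, fderiv_fun_neg, _root_.neg_apply, smul_add, smul_neg]
  abel

theorem wirt_smul {c : ℂ} {f : ℂ → ℂ} {F : ℂ → E} {z : ℂ} (hf : DifferentiableAt ℝ f z)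
    (hF : DifferentiableAt ℝ F z) :
    wirt c (fun w => f w • F w) z = wirt c f z • F z + f z • wirt c F z := by
  have h := (hf.hasFDerivAt.smul hF.hasFDerivAt).fderiv
  simp only [wirt]
  have h' : fderiv ℝ (fun w => f w • F w) z =
    f z • fderiv ℝ F z + (fderiv ℝ f z).smulRight (F z) := h
  simp only [h', _root_.add_apply, _root_.smul_apply,
    ContinuousLinearMap.smulRight_apply, smul_add, smul_smul, smul_eq_mul]
  match_scalars <;> ring

theorem wirt_const_smul {c a : ℂ} {F : ℂ → E} {z : ℂ} (hF : DifferentiableAt ℝ F z) :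
    wirt c (fun w => a • F w) z = a • wirt c F z := by
  rw [wirt_smul (differentiableAt_const a) hF, wirt_const, zero_smul, zero_add]

theorem wirt_mul {c : ℂ} {f g : ℂ → ℂ} {z : ℂ} (hf : DifferentiableAt ℝ f z)
    (hg : DifferentiableAt ℝ g z) :
    wirt c (fun w => f w * g w) z = wirt c f z * g z + f z * wirt c g z :=
  wirt_smul hf hg

theorem wirt_const_mul {c a : ℂ} {f : ℂ → ℂ} {z : ℂ} (hf : DifferentiableAt ℝ f z) :
    wirt c (fun w => a * f w) z = a * wirt c f z :=
  wirt_const_smul hf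

theorem wirt_pi {c : ℂ} {F : ℂ → Fin 6 → ℂ} {z : ℂ} (hF : DifferentiableAt ℝ F z) (i : Fin 6) :
    wirt c F z i = wirt c (fun w => F w i) z := by
  have h1 : ∀ v, fderiv ℝ F z v i = fderiv ℝ (fun w => F w i) z v := by
    intro v
    have h := (hasFDerivAt_pi'.1 hF.hasFDerivAt i).fderiv
    rw [h]; rfl
  simp only [wirt, Pi.smul_apply, Pi.add_apply, h1]

theorem contDiffAt_wirt {c : ℂ} {F : ℂ → E} {z : ℂ} (hF : ContDiffAt ℝ ∞ F z) :
    ContDiffAt ℝ ∞ (wirt c F) z := by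
  have h := hF.fderiv_right (m := ∞) (by simp)
  unfold wirt
  exact ((h.clm_apply contDiffAt_const).add ((h.clm_apply contDiffAt_const).const_smul c)).const_smul _

theorem wirt_comm {a b : ℂ} {F : ℂ → E} {z : ℂ} (hF : ContDiffAt ℝ ∞ F z) :
    wirt a (wirt b F) z = wirt b (wirt a F) z := by
  have hs := hF.isSymmSndFDerivAt (by simp; exact WithTop.coe_le_coe.2 le_top)
  have h := (hF.fderiv_right (m := ∞) (by simp)).differentiableAt (by simp)
  have key : ∀ (c : ℂ) (v : ℂ), fderiv ℝ (wirt c F) z v =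
      (1 / 2 : ℂ) • (fderiv ℝ (fderiv ℝ F) z v 1 + c • fderiv ℝ (fderiv ℝ F) z v Complex.I) := by
    intro c v
    have h1 : ∀ u : ℂ, HasFDerivAt (fun w => fderiv ℝ F w u) ((fderiv ℝ (fderiv ℝ F) z).flip u) z :=
      fun u => by
        have := h.hasFDerivAt.clm_apply (hasFDerivAt_const u z)
        simpa using this
    have h2 := (((h1 1).add ((h1 Complex.I).const_smul c)).const_smul (1 / 2 : ℂ)).fderiv
    have h3 : fderiv ℝ (wirt c F) z = _ := h2
    rw [h3]
    simp
  have hsym := hs 1 Complex.I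
  simp only [wirt] at key ⊢
  simp only [key, smul_add, smul_smul, hsym]
  ring_nf
  abel

/-- By the Cauchy–Riemann equations the differential of h is multiplication by h', for which 1 +
c·i-type combinations of the two real directions are eigenvectors. The scalar is the eigenvalue: h'
for c = -i and its conjugate for c = i. -/
theorem wirt_comp {c : ℂ} {F : ℂ → E} {h : ℂ → ℂ} {z : ℂ} (hF : DifferentiableAt ℝ F (h z))
    (hh : DifferentiableAt ℂ h z) (hc : c ^ 2 = -1) :
    wirt c (fun w => F (h w)) z =
      (((deriv h z).re : ℂ) + c * (-(deriv h z).im : ℂ)) • wirt c F (h z) := by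
  have h1 : HasFDerivAt h ((ContinuousLinearMap.toSpanSingleton ℂ (deriv h z)).restrictScalars ℝ) z :=
    hh.hasDerivAt.hasFDerivAt.restrictScalars ℝ
  have h2 := (hF.hasFDerivAt.comp z h1).fderiv
  have h3 : fderiv ℝ (fun w => F (h w)) z = _ := h2
  rcases hd : deriv h z with ⟨a, b⟩
  have e1 : (⟨a, b⟩ : ℂ) = a • (1 : ℂ) + b • Complex.I := by
    apply Complex.ext <;> simp
  have e2 : Complex.I * (⟨a, b⟩ : ℂ) = (-b) • (1 : ℂ) + a • Complex.I := by
    apply Complex.ext <;> simp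
  have k1 : fderiv ℝ (fun w => F (h w)) z 1 =
      (a : ℂ) • fderiv ℝ F (h z) 1 + (b : ℂ) • fderiv ℝ F (h z) Complex.I := by
    rw [h3]
    simp only [ContinuousLinearMap.comp_apply, ContinuousLinearMap.coe_restrictScalars',
      ContinuousLinearMap.toSpanSingleton_apply, hd, one_smul]
    rw [e1, map_add, map_smul, map_smul]; simp only [Complex.coe_smul]
  have k2 : fderiv ℝ (fun w => F (h w)) z Complex.I =
      ((-b : ℝ) : ℂ) • fderiv ℝ F (h z) 1 + (a : ℂ) • fderiv ℝ F (h z) Complex.I := by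
    rw [h3]
    simp only [ContinuousLinearMap.comp_apply, ContinuousLinearMap.coe_restrictScalars',
      ContinuousLinearMap.toSpanSingleton_apply, hd, smul_eq_mul]
    rw [e2, map_add, map_smul, map_smul]; simp only [Complex.coe_smul]
  simp only [wirt, k1, k2, smul_add, smul_smul]
  push_cast
  match_scalars
  · ring
  · linear_combination (1 / 2 : ℂ) * b * hc

theorem dz_comp {F : ℂ → E} {h : ℂ → ℂ} {z : ℂ} (hF : DifferentiableAt ℝ F (h z))
    (hh : DifferentiableAt ℂ h z) :
    dz (fun w => F (h w)) z = deriv h z • dz F (h z) := by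
  rw [dz_eq_wirt, dz_eq_wirt, wirt_comp hF hh (by simp)]
  congr 1
  apply Complex.ext <;> simp

theorem dzbar_comp {F : ℂ → E} {h : ℂ → ℂ} {z : ℂ} (hF : DifferentiableAt ℝ F (h z))
    (hh : DifferentiableAt ℂ h z) :
    dzbar (fun w => F (h w)) z = conj (deriv h z) • dzbar F (h z) := by
  rw [dzbar_eq_wirt, dzbar_eq_wirt, wirt_comp hF hh (by simp)]
  congr 1
  apply Complex.ext <;> simp

theorem dz_conj {f : ℂ → ℂ} {z : ℂ} (hf : DifferentiableAt ℝ f z) :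
    dz (fun w => conj (f w)) z = conj (dzbar f z) := by
  have h := (Complex.conjCLE.toContinuousLinearMap.hasFDerivAt.comp z hf.hasFDerivAt).fderiv
  have h' : fderiv ℝ (fun w => conj (f w)) z = _ := h
  simp [dz, dzbar, h', sub_eq_add_neg, Complex.conj_ofNat]

theorem dzbar_conj {f : ℂ → ℂ} {z : ℂ} (hf : DifferentiableAt ℝ f z) :
    dzbar (fun w => conj (f w)) z = conj (dz f z) := by
  have h := (Complex.conjCLE.toContinuousLinearMap.hasFDerivAt.comp z hf.hasFDerivAt).fderiv
  have h' : fderiv ℝ (fun w => conj (f w)) z = _ := h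
  simp [dz, dzbar, h', sub_eq_add_neg, Complex.conj_ofNat]

theorem dzbar_of_differentiableAt {f : ℂ → ℂ} {z : ℂ} (hf : DifferentiableAt ℂ f z) :
    dzbar f z = 0 := by
  have h := (hf.hasDerivAt.hasFDerivAt.restrictScalars ℝ).fderiv
  simp only [dzbar, h, ContinuousLinearMap.coe_restrictScalars',
      ContinuousLinearMap.toSpanSingleton_apply, smul_eq_mul]
  linear_combination (1/2) * deriv f z * Complex.I_mul_I

/-- The Cauchy–Riemann criterion, by which identities between smooth invariants become holomorphy of
Θ and of `quartic`. -/
theorem differentiableAt_of_dzbar {f : ℂ → ℂ} {z : ℂ} (hf : DifferentiableAt ℝ f z)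
    (h : dzbar f z = 0) : DifferentiableAt ℂ f z := by
  rw [differentiableAt_complex_iff_differentiableAt_real]
  refine ⟨hf, ?_⟩
  simp only [dzbar, smul_eq_mul] at h ⊢
  have h2 : fderiv ℝ f z 1 + Complex.I * fderiv ℝ f z Complex.I = 0 := by
    simpa using h
  linear_combination (-Complex.I) * h2 + fderiv ℝ f z Complex.I * Complex.I_mul_I

end Wirtinger

/-! ### The bilinear form -/

section Lor

variable {𝕜 : Type*} [CommRing 𝕜]

theorem lor_comm (x y : Fin 6 → 𝕜) : lor x y = lor y x := by simp only [lor]; ring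

theorem lor_add_left (x y w : Fin 6 → 𝕜) : lor (x + y) w = lor x w + lor y w := by
  simp only [lor, Pi.add_apply]; ring

theorem lor_add_right (x y w : Fin 6 → 𝕜) : lor w (x + y) = lor w x + lor w y := by
  simp only [lor, Pi.add_apply]; ring

theorem lor_sub_left (x y w : Fin 6 → 𝕜) : lor (x - y) w = lor x w - lor y w := by
  simp only [lor, Pi.sub_apply]; ring

theorem lor_sub_right (x y w : Fin 6 → 𝕜) : lor w (x - y) = lor w x - lor w y := by
  simp only [lor, Pi.sub_apply]; ring

theorem lor_neg_left (x w : Fin 6 → 𝕜) : lor (-x) w = -lor x w := by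
  simp only [lor, Pi.neg_apply]; ring

theorem lor_neg_right (x w : Fin 6 → 𝕜) : lor w (-x) = -lor w x := by
  simp only [lor, Pi.neg_apply]; ring

theorem lor_smul_left (c : 𝕜) (x w : Fin 6 → 𝕜) : lor (c • x) w = c * lor x w := by
  simp only [lor, Pi.smul_apply, smul_eq_mul]; ring

theorem lor_smul_right (c : 𝕜) (x w : Fin 6 → 𝕜) : lor w (c • x) = c * lor w x := by
  simp only [lor, Pi.smul_apply, smul_eq_mul]; ring

theorem lor_zero_left (w : Fin 6 → 𝕜) : lor 0 w = 0 := by simp [lor]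

theorem lor_zero_right (w : Fin 6 → 𝕜) : lor w 0 = 0 := by simp [lor]

theorem eq_zero_of_lor_eq_zero {x : Fin 6 → 𝕜} (h : ∀ w, lor x w = 0) : x = 0 := by
  funext i
  have := h (Pi.single i 1)
  fin_cases i <;> simpa [lor, Pi.single_apply] using this

end Lor

/-- Complex conjugation of `ℂ⁶`. -/
def conjVec (v : Fin 6 → ℂ) : Fin 6 → ℂ := fun i => conj (v i)

theorem conjVec_add (v w : Fin 6 → ℂ) : conjVec (v + w) = conjVec v + conjVec w := by
  funext i; simp [conjVec]

theorem conjVec_sub (v w : Fin 6 → ℂ) : conjVec (v - w) = conjVec v - conjVec w := by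
  funext i; simp [conjVec]

theorem conjVec_smul (c : ℂ) (v : Fin 6 → ℂ) : conjVec (c • v) = conj c • conjVec v := by
  funext i; simp [conjVec]

theorem conjVec_conjVec (v : Fin 6 → ℂ) : conjVec (conjVec v) = v := by
  funext i; simp [conjVec]

theorem conjVec_cplx (v : Fin 6 → ℝ) : conjVec (cplx v) = cplx v := by
  funext i; simp [conjVec, cplx]

theorem lor_conjVec (v w : Fin 6 → ℂ) : lor (conjVec v) (conjVec w) = conj (lor v w) := by
  simp [lor, conjVec]

theorem lor_cplx (v w : Fin 6 → ℝ) : lor (cplx v) (cplx w) = (lor v w : ℝ) := by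
  simp [lor, cplx]

theorem exists_cplx_of_conjVec_eq {v : Fin 6 → ℂ} (h : conjVec v = v) :
    cplx (fun i => (v i).re) = v := by
  funext i
  exact Complex.conj_eq_iff_re.1 (congrFun h i)

/-! ### Differentiating the bilinear form and complex conjugation on ℂ⁶. -/

section Calculus

variable {F G : ℂ → Fin 6 → ℂ} {f : ℂ → ℂ} {z c : ℂ}

theorem diffAt {E : Type*} [NormedAddCommGroup E] [NormedSpace ℝ E] {F : ℂ → E} {z : ℂ}
    (h : ContDiffAt ℝ ∞ F z) : DifferentiableAt ℝ F z := h.differentiableAt (by simp)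

theorem contDiffAt_fun_add (hF : ContDiffAt ℝ ∞ F z) (hG : ContDiffAt ℝ ∞ G z) :
    ContDiffAt ℝ ∞ (fun w => F w + G w) z := hF.add hG

theorem contDiffAt_fun_smul (hf : ContDiffAt ℝ ∞ f z) (hF : ContDiffAt ℝ ∞ F z) :
    ContDiffAt ℝ ∞ (fun w => f w • F w) z := hf.smul hF

theorem contDiffAt_lor (hF : ContDiffAt ℝ ∞ F z) (hG : ContDiffAt ℝ ∞ G z) :
    ContDiffAt ℝ ∞ (fun w => lor (F w) (G w)) z := by
  rw [contDiffAt_pi] at hF hG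
  unfold lor
  exact ((((((hF 0).mul (hG 0)).add ((hF 1).mul (hG 1))).add ((hF 2).mul (hG 2))).add
    ((hF 3).mul (hG 3))).sub ((hF 4).mul (hG 4))).sub ((hF 5).mul (hG 5))

theorem contDiffAt_conjVec (hF : ContDiffAt ℝ ∞ F z) :
    ContDiffAt ℝ ∞ (fun w => conjVec (F w)) z := by
  rw [contDiffAt_pi] at hF ⊢
  exact fun i => Complex.conjCLE.contDiff.contDiffAt.comp z (hF i)

theorem contDiffAt_conj (hf : ContDiffAt ℝ ∞ f z) :
    ContDiffAt ℝ ∞ (fun w => conj (f w)) z :=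
  Complex.conjCLE.contDiff.contDiffAt.comp z hf

theorem contDiffAt_cplx {Y : ℂ → Fin 6 → ℝ} (hF : ContDiffAt ℝ ∞ Y z) :
    ContDiffAt ℝ ∞ (fun w => cplx (Y w)) z := by
  rw [contDiffAt_pi] at hF ⊢
  exact fun i => Complex.ofRealCLM.contDiff.contDiffAt.comp z (hF i)

theorem wirt_lor (hF : ContDiffAt ℝ ∞ F z) (hG : ContDiffAt ℝ ∞ G z) :
    wirt c (fun w => lor (F w) (G w)) z = lor (wirt c F z) (G z) + lor (F z) (wirt c G z) := by
  have hF' := fun i => diffAt (contDiffAt_pi.1 hF i)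
  have hG' := fun i => diffAt (contDiffAt_pi.1 hG i)
  simp only [lor, wirt_pi (diffAt hF), wirt_pi (diffAt hG)]
  rw [wirt_sub (by fun_prop) (by fun_prop), wirt_sub (by fun_prop) (by fun_prop),
    wirt_add (by fun_prop) (by fun_prop), wirt_add (by fun_prop) (by fun_prop),
    wirt_add (by fun_prop) (by fun_prop)]
  simp only [wirt_mul (hF' _) (hG' _)]
  ring

/-- Differentiating a constant product moves a derivative from one factor to the other. Nearly all
the frame relations below come from this. -/
theorem lor_wirt_of_const {U : Set ℂ} (hU : IsOpen U) {a : ℂ}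
    (h : ∀ w ∈ U, lor (F w) (G w) = a) (hz : z ∈ U)
    (hF : ContDiffAt ℝ ∞ F z) (hG : ContDiffAt ℝ ∞ G z) :
    lor (wirt c F z) (G z) + lor (F z) (wirt c G z) = 0 := by
  rw [← wirt_lor hF hG, wirt_congr_on hU h hz, wirt_const]

theorem wirt_conjVec (hF : ContDiffAt ℝ ∞ F z) :
    wirt (-Complex.I) (fun w => conjVec (F w)) z = conjVec (wirt Complex.I F z) ∧
    wirt Complex.I (fun w => conjVec (F w)) z = conjVec (wirt (-Complex.I) F z) := by
  have hF' := fun i => diffAt (contDiffAt_pi.1 hF i)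
  constructor
  · funext i
    rw [wirt_pi (diffAt (contDiffAt_conjVec hF))]
    simp only [conjVec]
    rw [← dz_eq_wirt, dz_conj (hF' i), wirt_pi (diffAt hF), dzbar_eq_wirt]
  · funext i
    rw [wirt_pi (diffAt (contDiffAt_conjVec hF))]
    simp only [conjVec]
    rw [← dzbar_eq_wirt, dzbar_conj (hF' i), wirt_pi (diffAt hF), dz_eq_wirt]

end Calculus

/-! ### Surfaces in a conformal coordinate -/

section Local

variable {U : Set ℂ} {Y : ℂ → Fin 6 → ℝ} {z : ℂ}

/-- A smooth map `Y` from `U` to the light cone with `|dY|² = |dz|²`. -/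
structure IsIsothermal (U : Set ℂ) (Y : ℂ → Fin 6 → ℝ) : Prop where
  isOpen : IsOpen U
  smooth : ∀ z ∈ U, ContDiffAt ℝ ∞ Y z
  null : ∀ z ∈ U, lor (cplx (Y z)) (cplx (Y z)) = 0
  null_z : ∀ z ∈ U, lor (Yz Y z) (Yz Y z) = 0
  metric : ∀ z ∈ U, lor (Yz Y z) (Yzbar Y z) = 1 / 2

/-- `Y_z̄z̄`. -/
def Yzbarzbar (Y : ℂ → Fin 6 → ℝ) : ℂ → Fin 6 → ℂ := wirt Complex.I (Yzbar Y)

theorem Yz_eq (Y : ℂ → Fin 6 → ℝ) : Yz Y = wirt (-Complex.I) fun w => cplx (Y w) := dz_eq_wirt _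
theorem Yzbar_eq (Y : ℂ → Fin 6 → ℝ) : Yzbar Y = wirt Complex.I fun w => cplx (Y w) := rfl
theorem Yzz_eq (Y : ℂ → Fin 6 → ℝ) : Yzz Y = wirt (-Complex.I) (Yz Y) := dz_eq_wirt _
theorem Yzzbar_eq (Y : ℂ → Fin 6 → ℝ) : Yzzbar Y = wirt Complex.I (Yz Y) := rfl

theorem contDiffAt_Yz (h : ContDiffAt ℝ ∞ Y z) : ContDiffAt ℝ ∞ (Yz Y) z := by
  rw [Yz_eq]; exact contDiffAt_wirt (contDiffAt_cplx h)
theorem contDiffAt_Yzbar (h : ContDiffAt ℝ ∞ Y z) : ContDiffAt ℝ ∞ (Yzbar Y) z :=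
  contDiffAt_wirt (contDiffAt_cplx h)
theorem contDiffAt_Yzz (h : ContDiffAt ℝ ∞ Y z) : ContDiffAt ℝ ∞ (Yzz Y) z := by
  rw [Yzz_eq]; exact contDiffAt_wirt (contDiffAt_Yz h)
theorem contDiffAt_Yzzbar (h : ContDiffAt ℝ ∞ Y z) : ContDiffAt ℝ ∞ (Yzzbar Y) z :=
  contDiffAt_wirt (contDiffAt_Yz h)
theorem contDiffAt_Yzbarzbar (h : ContDiffAt ℝ ∞ Y z) : ContDiffAt ℝ ∞ (Yzbarzbar Y) z :=
  contDiffAt_wirt (contDiffAt_Yzbar h)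

theorem contDiffAt_frameN (h : ContDiffAt ℝ ∞ Y z) : ContDiffAt ℝ ∞ (frameN Y) z := by
  have hB := contDiffAt_Yzzbar h
  exact (hB.const_smul (2 : ℂ)).add
    ((contDiffAt_const.mul (contDiffAt_lor hB hB)).smul (contDiffAt_cplx h))

theorem contDiffAt_normalPart {F : ℂ → Fin 6 → ℂ} (h : ContDiffAt ℝ ∞ Y z)
    (hF : ContDiffAt ℝ ∞ F z) : ContDiffAt ℝ ∞ (fun w => normalPart Y w (F w)) z := by
  have hN := contDiffAt_frameN h
  have hX := contDiffAt_cplx h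
  have ha := contDiffAt_Yz h
  have hb := contDiffAt_Yzbar h
  exact (((hF.add ((contDiffAt_lor hF hN).smul hX)).add ((contDiffAt_lor hF hX).smul hN)).sub
    ((contDiffAt_const.mul (contDiffAt_lor hF hb)).smul ha)).sub
    ((contDiffAt_const.mul (contDiffAt_lor hF ha)).smul hb)

theorem contDiffAt_kappa (h : ContDiffAt ℝ ∞ Y z) : ContDiffAt ℝ ∞ (kappa Y) z :=
  contDiffAt_normalPart h (contDiffAt_Yzz h)

/-- The normal connection in the direction `(∂_u + c ∂_v) / 2`. -/
def normalD (c : ℂ) (Y : ℂ → Fin 6 → ℝ) (ξ : ℂ → Fin 6 → ℂ) (z : ℂ) : Fin 6 → ℂ :=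
  normalPart Y z (wirt c ξ z)

theorem contDiffAt_normalD {c : ℂ} {F : ℂ → Fin 6 → ℂ} (h : ContDiffAt ℝ ∞ Y z)
    (hF : ContDiffAt ℝ ∞ F z) : ContDiffAt ℝ ∞ (normalD c Y F) z :=
  contDiffAt_normalPart h (contDiffAt_wirt hF)

theorem DzbarKappa_eq (Y : ℂ → Fin 6 → ℝ) : DzbarKappa Y = normalD Complex.I Y (kappa Y) := rfl

theorem conjVec_Yz (h : ContDiffAt ℝ ∞ Y z) : conjVec (Yz Y z) = Yzbar Y z := by
  rw [Yz_eq, Yzbar_eq, ← (wirt_conjVec (contDiffAt_cplx h)).2]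
  simp only [conjVec_cplx]

theorem conjVec_Yzbar (h : ContDiffAt ℝ ∞ Y z) : conjVec (Yzbar Y z) = Yz Y z := by
  rw [← conjVec_Yz h, conjVec_conjVec]

theorem wirt_Yzbar (h : ContDiffAt ℝ ∞ Y z) : wirt (-Complex.I) (Yzbar Y) z = Yzzbar Y z := by
  rw [Yzbar_eq, Yzzbar_eq, Yz_eq]; exact wirt_comm (contDiffAt_cplx h)

namespace IsIsothermal

theorem conjVec_Yzz (H : IsIsothermal U Y) (hz : z ∈ U) : conjVec (Yzz Y z) = Yzbarzbar Y z := by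
  rw [Yzz_eq, ← (wirt_conjVec (contDiffAt_Yz (H.smooth z hz))).2, Yzbarzbar]
  exact wirt_congr_on H.isOpen (fun w hw => conjVec_Yz (H.smooth w hw)) hz

theorem conjVec_Yzzbar (H : IsIsothermal U Y) (hz : z ∈ U) : conjVec (Yzzbar Y z) = Yzzbar Y z := by
  rw [Yzzbar_eq, ← (wirt_conjVec (contDiffAt_Yz (H.smooth z hz))).1, ← Yzzbar_eq,
    ← wirt_Yzbar (H.smooth z hz)]
  exact wirt_congr_on H.isOpen (fun w hw => conjVec_Yz (H.smooth w hw)) hz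

theorem null_zbar (H : IsIsothermal U Y) (hz : z ∈ U) : lor (Yzbar Y z) (Yzbar Y z) = 0 := by
  rw [← conjVec_Yz (H.smooth z hz), lor_conjVec, H.null_z z hz, map_zero]

theorem lor_Yz_Y (H : IsIsothermal U Y) (hz : z ∈ U) : lor (Yz Y z) (cplx (Y z)) = 0 := by
  have hX := contDiffAt_cplx (H.smooth z hz)
  have := lor_wirt_of_const (c := -Complex.I) H.isOpen H.null hz hX hX
  rw [← Yz_eq, lor_comm (cplx (Y z))] at this
  linear_combination this / 2

theorem lor_Yzbar_Y (H : IsIsothermal U Y) (hz : z ∈ U) : lor (Yzbar Y z) (cplx (Y z)) = 0 := by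
  have hX := contDiffAt_cplx (H.smooth z hz)
  have := lor_wirt_of_const (c := Complex.I) H.isOpen H.null hz hX hX
  rw [← Yzbar_eq, lor_comm (cplx (Y z))] at this
  linear_combination this / 2

theorem lor_Yzz_Y (H : IsIsothermal U Y) (hz : z ∈ U) : lor (Yzz Y z) (cplx (Y z)) = 0 := by
  have h := H.smooth z hz
  have := lor_wirt_of_const (c := -Complex.I) H.isOpen (fun w hw => H.lor_Yz_Y hw) hz
    (contDiffAt_Yz h) (contDiffAt_cplx h)
  rw [← Yz_eq, ← Yzz_eq, H.null_z z hz] at this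
  linear_combination this

theorem lor_Yzzbar_Y (H : IsIsothermal U Y) (hz : z ∈ U) : lor (Yzzbar Y z) (cplx (Y z)) = -1 / 2 := by
  have h := H.smooth z hz
  have := lor_wirt_of_const (c := Complex.I) H.isOpen (fun w hw => H.lor_Yz_Y hw) hz
    (contDiffAt_Yz h) (contDiffAt_cplx h)
  rw [← Yzbar_eq, ← Yzzbar_eq, H.metric z hz] at this
  linear_combination this

theorem lor_Yzz_Yz (H : IsIsothermal U Y) (hz : z ∈ U) : lor (Yzz Y z) (Yz Y z) = 0 := by
  have h := contDiffAt_Yz (H.smooth z hz)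
  have := lor_wirt_of_const (c := -Complex.I) H.isOpen H.null_z hz h h
  rw [← Yzz_eq, lor_comm (Yz Y z)] at this
  linear_combination this / 2

theorem lor_Yzzbar_Yz (H : IsIsothermal U Y) (hz : z ∈ U) : lor (Yzzbar Y z) (Yz Y z) = 0 := by
  have h := contDiffAt_Yz (H.smooth z hz)
  have := lor_wirt_of_const (c := Complex.I) H.isOpen H.null_z hz h h
  rw [← Yzzbar_eq, lor_comm (Yz Y z)] at this
  linear_combination this / 2

theorem lor_Yzzbar_Yzbar (H : IsIsothermal U Y) (hz : z ∈ U) : lor (Yzzbar Y z) (Yzbar Y z) = 0 := by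
  rw [← H.conjVec_Yzzbar hz, ← conjVec_Yz (H.smooth z hz), lor_conjVec, H.lor_Yzzbar_Yz hz,
    map_zero]

theorem lor_Yzz_Yzbar (H : IsIsothermal U Y) (hz : z ∈ U) : lor (Yzz Y z) (Yzbar Y z) = 0 := by
  have h := H.smooth z hz
  have := lor_wirt_of_const (c := -Complex.I) H.isOpen H.metric hz
    (contDiffAt_Yz h) (contDiffAt_Yzbar h)
  rw [← Yzz_eq, wirt_Yzbar h, lor_comm (Yz Y z), H.lor_Yzzbar_Yz hz] at this
  linear_combination this

theorem lor_Yzbarzbar_Yz (H : IsIsothermal U Y) (hz : z ∈ U) : lor (Yzbarzbar Y z) (Yz Y z) = 0 := by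
  rw [← H.conjVec_Yzz hz, ← conjVec_Yzbar (H.smooth z hz), lor_conjVec, H.lor_Yzz_Yzbar hz,
    map_zero]

theorem lor_Yzbarzbar_Yzbar (H : IsIsothermal U Y) (hz : z ∈ U) : lor (Yzbarzbar Y z) (Yzbar Y z) = 0 := by
  rw [← H.conjVec_Yzz hz, ← conjVec_Yz (H.smooth z hz), lor_conjVec, H.lor_Yzz_Yz hz, map_zero]

theorem wirt_Yzzbar (H : IsIsothermal U Y) (hz : z ∈ U) : wirt Complex.I (Yzzbar Y) z = wirt (-Complex.I) (Yzbarzbar Y) z := by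
  rw [Yzbarzbar, ← wirt_comm (contDiffAt_Yzbar (H.smooth z hz))]
  exact wirt_congr_on H.isOpen (fun w hw => (wirt_Yzbar (H.smooth w hw)).symm) hz

/-- Differentiate ⟨Y_zz̄, Y_z⟩ = 0 in z̄ and ⟨Y_z̄z̄, Y_z⟩ = 0 in z. Both contain ⟨Y_zz̄z̄, Y_z⟩,
which cancels in the difference. -/
theorem lor_Yzzbar_Yzzbar (H : IsIsothermal U Y) (hz : z ∈ U) :
    lor (Yzzbar Y z) (Yzzbar Y z) = lor (Yzz Y z) (Yzbarzbar Y z) := by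
  have h := H.smooth z hz
  have h1 := lor_wirt_of_const (c := Complex.I) H.isOpen (fun w hw => H.lor_Yzzbar_Yz hw) hz
    (contDiffAt_Yzzbar h) (contDiffAt_Yz h)
  have h2 := lor_wirt_of_const (c := -Complex.I) H.isOpen (fun w hw => H.lor_Yzbarzbar_Yz hw) hz
    (contDiffAt_Yzbarzbar h) (contDiffAt_Yz h)
  rw [H.wirt_Yzzbar hz, ← Yzzbar_eq] at h1
  rw [← Yzz_eq, lor_comm (Yzbarzbar Y z)] at h2
  linear_combination h1 - h2

theorem lor_frameN_Y (H : IsIsothermal U Y) (hz : z ∈ U) : lor (frameN Y z) (cplx (Y z)) = -1 := by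
  simp only [frameN, lor_add_left, lor_smul_left, H.lor_Yzzbar_Y hz, H.null z hz]; ring

theorem lor_frameN_Yz (H : IsIsothermal U Y) (hz : z ∈ U) : lor (frameN Y z) (Yz Y z) = 0 := by
  simp only [frameN, lor_add_left, lor_smul_left, H.lor_Yzzbar_Yz hz, lor_comm (cplx (Y z)),
    H.lor_Yz_Y hz]; ring

theorem lor_frameN_Yzbar (H : IsIsothermal U Y) (hz : z ∈ U) : lor (frameN Y z) (Yzbar Y z) = 0 := by
  simp only [frameN, lor_add_left, lor_smul_left, H.lor_Yzzbar_Yzbar hz, lor_comm (cplx (Y z)),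
    H.lor_Yzbar_Y hz]; ring

theorem lor_frameN_frameN (H : IsIsothermal U Y) (hz : z ∈ U) : lor (frameN Y z) (frameN Y z) = 0 := by
  simp only [frameN, lor_add_left, lor_smul_left, lor_add_right, lor_smul_right,
    lor_comm (cplx (Y z)) (Yzzbar Y z), H.lor_Yzzbar_Y hz, H.null z hz]; ring

theorem conjVec_frameN (H : IsIsothermal U Y) (hz : z ∈ U) : conjVec (frameN Y z) = frameN Y z := by
  have h : conj (lor (Yzzbar Y z) (Yzzbar Y z)) = lor (Yzzbar Y z) (Yzzbar Y z) := by
    rw [← lor_conjVec, H.conjVec_Yzzbar hz]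
  simp only [frameN, conjVec_add, conjVec_smul, conjVec_cplx, H.conjVec_Yzzbar hz, map_mul, h,
    Complex.conj_ofNat]

end IsIsothermal

end Local

/-! ### The normal bundle and the structure equations -/

section Normal

variable {U : Set ℂ} {Y : ℂ → Fin 6 → ℝ} {z : ℂ}

/-- `ψ` lies in the complexified normal space `V^⊥` at `z`. -/
structure IsNormal (Y : ℂ → Fin 6 → ℝ) (z : ℂ) (ψ : Fin 6 → ℂ) : Prop where
  lor_Y : lor ψ (cplx (Y z)) = 0
  lor_N : lor ψ (frameN Y z) = 0
  lor_Yz : lor ψ (Yz Y z) = 0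
  lor_Yzbar : lor ψ (Yzbar Y z) = 0

theorem IsNormal.normalPart_eq {ψ : Fin 6 → ℂ} (h : IsNormal Y z ψ) : normalPart Y z ψ = ψ := by
  simp [normalPart, h.lor_Y, h.lor_N, h.lor_Yz, h.lor_Yzbar]

theorem IsNormal.add {φ ψ : Fin 6 → ℂ} (h : IsNormal Y z φ) (h' : IsNormal Y z ψ) :
    IsNormal Y z (φ + ψ) := by
  constructor <;> simp [lor_add_left, h.lor_Y, h.lor_N, h.lor_Yz, h.lor_Yzbar, h'.lor_Y, h'.lor_N, h'.lor_Yz, h'.lor_Yzbar]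

theorem IsNormal.smul {ψ : Fin 6 → ℂ} (h : IsNormal Y z ψ) (c : ℂ) : IsNormal Y z (c • ψ) := by
  constructor <;> simp [lor_smul_left, h.lor_Y, h.lor_N, h.lor_Yz, h.lor_Yzbar]

theorem IsNormal.lor_normalPart {ψ : Fin 6 → ℂ} (h : IsNormal Y z ψ) (X : Fin 6 → ℂ) :
    lor ψ (normalPart Y z X) = lor ψ X := by
  simp only [normalPart, lor_add_right, lor_sub_right, lor_smul_right, h.lor_Y, h.lor_N, h.lor_Yz, h.lor_Yzbar]
  ring

theorem IsNormal.lor_normalPart_left {ψ : Fin 6 → ℂ} (h : IsNormal Y z ψ) (X : Fin 6 → ℂ) :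
    lor (normalPart Y z X) ψ = lor X ψ := by
  rw [lor_comm, h.lor_normalPart, lor_comm]

theorem normalPart_add (X X' : Fin 6 → ℂ) :
    normalPart Y z (X + X') = normalPart Y z X + normalPart Y z X' := by
  simp only [normalPart, lor_add_left]; module

theorem normalPart_sub (X X' : Fin 6 → ℂ) :
    normalPart Y z (X - X') = normalPart Y z X - normalPart Y z X' := by
  simp only [normalPart, lor_sub_left]; module

theorem normalPart_smul (c : ℂ) (X : Fin 6 → ℂ) :
    normalPart Y z (c • X) = c • normalPart Y z X := by
  simp only [normalPart, lor_smul_left]; module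

/-- The Schwarzian `s`, with `Y_zz = -(s/2) Y + κ`. -/
def schwarzian (Y : ℂ → Fin 6 → ℝ) (z : ℂ) : ℂ := 4 * lor (Yzz Y z) (Yzzbar Y z)

theorem contDiffAt_schwarzian (h : ContDiffAt ℝ ∞ Y z) : ContDiffAt ℝ ∞ (schwarzian Y) z :=
  contDiffAt_const.mul (contDiffAt_lor (contDiffAt_Yzz h) (contDiffAt_Yzzbar h))

namespace IsIsothermal

theorem isNormal_normalPart (H : IsIsothermal U Y) (hz : z ∈ U) (X : Fin 6 → ℂ) :
    IsNormal Y z (normalPart Y z X) := by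
  have e1 := H.null z hz
  have e2 := H.null_z z hz
  have e3 := H.metric z hz
  have e4 := H.null_zbar hz
  have e5 := H.lor_Yz_Y hz
  have e6 := H.lor_Yzbar_Y hz
  have e7 := H.lor_frameN_Y hz
  have e8 := H.lor_frameN_Yz hz
  have e9 := H.lor_frameN_Yzbar hz
  have e10 := H.lor_frameN_frameN hz
  have e3' := lor_comm (Yzbar Y z) (Yz Y z)
  have e5' := lor_comm (cplx (Y z)) (Yz Y z)
  have e6' := lor_comm (cplx (Y z)) (Yzbar Y z)
  have e7' := lor_comm (cplx (Y z)) (frameN Y z)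
  have e8' := lor_comm (Yz Y z) (frameN Y z)
  have e9' := lor_comm (Yzbar Y z) (frameN Y z)
  constructor <;> simp only [normalPart, lor_add_left, lor_sub_left, lor_smul_left, e3', e5', e6',
    e7', e8', e9', e1, e2, e3, e4, e5, e6, e7, e8, e9, e10] <;> ring

theorem normalPart_Y (H : IsIsothermal U Y) (hz : z ∈ U) : normalPart Y z (cplx (Y z)) = 0 := by
  simp only [normalPart, lor_comm (cplx (Y z)), H.null z hz, H.lor_Yz_Y hz, H.lor_Yzbar_Y hz,
    H.lor_frameN_Y hz]; module

theorem normalPart_Yz (H : IsIsothermal U Y) (hz : z ∈ U) : normalPart Y z (Yz Y z) = 0 := by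
  simp only [normalPart, lor_comm (Yz Y z) (frameN Y z), H.lor_frameN_Yz hz, H.lor_Yz_Y hz,
    H.metric z hz, H.null_z z hz]; module

theorem normalPart_Yzbar (H : IsIsothermal U Y) (hz : z ∈ U) : normalPart Y z (Yzbar Y z) = 0 := by
  simp only [normalPart, lor_comm (Yzbar Y z) (frameN Y z), H.lor_frameN_Yzbar hz, H.lor_Yzbar_Y hz,
    lor_comm (Yzbar Y z) (Yz Y z), H.metric z hz, H.null_zbar hz]; module

theorem normalPart_frameN (H : IsIsothermal U Y) (hz : z ∈ U) : normalPart Y z (frameN Y z) = 0 := by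
  simp only [normalPart, H.lor_frameN_Yzbar hz, H.lor_frameN_Yz hz, H.lor_frameN_Y hz,
    H.lor_frameN_frameN hz]; module

theorem Yzzbar_eq_frameN (Y : ℂ → Fin 6 → ℝ) (z : ℂ) :
    Yzzbar Y z = (1 / 2 : ℂ) • frameN Y z - lor (Yzzbar Y z) (Yzzbar Y z) • cplx (Y z) := by
  rw [frameN]; module

theorem normalPart_Yzzbar (H : IsIsothermal U Y) (hz : z ∈ U) : normalPart Y z (Yzzbar Y z) = 0 := by
  rw [Yzzbar_eq_frameN, normalPart_sub, normalPart_smul, normalPart_smul, H.normalPart_frameN hz,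
    H.normalPart_Y hz]; simp

theorem lor_Yzzbar_of_isNormal {ψ : Fin 6 → ℂ} (h : IsNormal Y z ψ) :
    lor ψ (Yzzbar Y z) = 0 := by
  rw [Yzzbar_eq_frameN, lor_sub_right, lor_smul_right, lor_smul_right, h.lor_N, h.lor_Y]; ring

theorem conjVec_normalPart (H : IsIsothermal U Y) (hz : z ∈ U) (X : Fin 6 → ℂ) :
    conjVec (normalPart Y z X) = normalPart Y z (conjVec X) := by
  have h := H.smooth z hz
  have e1 : ∀ v, conj (lor X v) = lor (conjVec X) (conjVec v) := fun v => (lor_conjVec _ _).symm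
  simp only [normalPart, conjVec_add, conjVec_sub, conjVec_smul, map_mul, e1, conjVec_cplx,
    H.conjVec_frameN hz, conjVec_Yz h, conjVec_Yzbar h, Complex.conj_ofNat]
  module

theorem isNormal_conjVec (H : IsIsothermal U Y) (hz : z ∈ U) {ψ : Fin 6 → ℂ}
    (h : IsNormal Y z ψ) : IsNormal Y z (conjVec ψ) := by
  have := H.conjVec_normalPart hz ψ
  rw [h.normalPart_eq] at this
  rw [this]; exact H.isNormal_normalPart hz _

/-- Among the products of Y_zz with the frame only ⟨Y_zz, N⟩ = 2⟨Y_zz, Y_zz̄⟩ can be nonzero, so the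
tangential part is a multiple of Y alone. This fixes the factor 4 in `schwarzian`. -/
theorem kappa_eq (H : IsIsothermal U Y) (hz : z ∈ U) :
    kappa Y z = Yzz Y z + (schwarzian Y z / 2) • cplx (Y z) := by
  have h1 : lor (Yzz Y z) (frameN Y z) = schwarzian Y z / 2 := by
    simp only [frameN, lor_add_right, lor_smul_right, H.lor_Yzz_Y hz, schwarzian]; ring
  simp only [kappa, normalPart, H.lor_Yzz_Y hz, H.lor_Yzz_Yz hz, H.lor_Yzz_Yzbar hz, h1]
  module

theorem Yzz_eq_kappa (H : IsIsothermal U Y) (hz : z ∈ U) :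
    Yzz Y z = kappa Y z - (schwarzian Y z / 2) • cplx (Y z) := by
  rw [H.kappa_eq hz]; module

theorem isNormal_kappa (H : IsIsothermal U Y) (hz : z ∈ U) : IsNormal Y z (kappa Y z) :=
  H.isNormal_normalPart hz _

theorem isNormal_normalD (H : IsIsothermal U Y) (hz : z ∈ U) (c : ℂ) (ξ : ℂ → Fin 6 → ℂ) :
    IsNormal Y z (normalD c Y ξ z) := H.isNormal_normalPart hz _

theorem Yzbarzbar_eq_kappa (H : IsIsothermal U Y) (hz : z ∈ U) :
    Yzbarzbar Y z = conjVec (kappa Y z) - (conj (schwarzian Y z) / 2) • cplx (Y z) := by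
  rw [← H.conjVec_Yzz hz, H.Yzz_eq_kappa hz, conjVec_sub, conjVec_smul, conjVec_cplx, map_div₀,
    Complex.conj_ofNat]

/-- κ and κ̄ differ from Y_zz and Y_z̄z̄ by multiples of the null vector Y, which is orthogonal to
both; then `lor_Yzzbar_Yzzbar` applies. In particular N = 2Y_zz̄ + 2⟨κ,κ̄⟩Y. -/
theorem lor_kappa_conj (H : IsIsothermal U Y) (hz : z ∈ U) :
    lor (kappa Y z) (conjVec (kappa Y z)) = lor (Yzzbar Y z) (Yzzbar Y z) := by
  have hk := H.isNormal_kappa hz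
  have hk' := H.isNormal_conjVec hz hk
  rw [H.lor_Yzzbar_Yzzbar hz, H.Yzz_eq_kappa hz, H.Yzbarzbar_eq_kappa hz]
  simp only [lor_sub_left, lor_sub_right, lor_smul_left, lor_smul_right, hk.lor_Y,
    lor_comm (cplx (Y z)) (conjVec _), hk'.lor_Y, H.null z hz]; ring

theorem lor_Yzz_Yzz (H : IsIsothermal U Y) (hz : z ∈ U) :
    lor (Yzz Y z) (Yzz Y z) = lor (kappa Y z) (kappa Y z) := by
  rw [H.Yzz_eq_kappa hz]
  simp only [lor_sub_left, lor_sub_right, lor_smul_left, lor_smul_right,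
    (H.isNormal_kappa hz).lor_Y, lor_comm (cplx (Y z)) (kappa Y z), H.null z hz]; ring

/-- The normal connection is metric. -/
theorem wirt_lor_normal {c : ℂ} {φ ψ : ℂ → Fin 6 → ℂ}
    (hφ : ContDiffAt ℝ ∞ φ z) (hψ : ContDiffAt ℝ ∞ ψ z) (nφ : IsNormal Y z (φ z))
    (nψ : IsNormal Y z (ψ z)) :
    wirt c (fun w => lor (φ w) (ψ w)) z =
      lor (normalD c Y φ z) (ψ z) + lor (φ z) (normalD c Y ψ z) := by
  rw [wirt_lor hφ hψ, normalD, normalD, nφ.lor_normalPart, nψ.lor_normalPart_left]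

/-- The Leibniz rule for the normal connection. -/
theorem normalD_smul {c : ℂ} {f : ℂ → ℂ} {ψ : ℂ → Fin 6 → ℂ} (hf : ContDiffAt ℝ ∞ f z)
    (hψ : ContDiffAt ℝ ∞ ψ z) (nψ : IsNormal Y z (ψ z)) :
    normalD c Y (fun w => f w • ψ w) z = wirt c f z • ψ z + f z • normalD c Y ψ z := by
  rw [normalD, wirt_smul (diffAt hf) (diffAt hψ), normalPart_add, normalPart_smul, normalPart_smul,
    nψ.normalPart_eq, normalD]

theorem conjVec_normalD (H : IsIsothermal U Y) (hz : z ∈ U) {ψ : ℂ → Fin 6 → ℂ}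
    (hψ : ContDiffAt ℝ ∞ ψ z) :
    conjVec (normalD Complex.I Y ψ z) = normalD (-Complex.I) Y (fun w => conjVec (ψ w)) z := by
  rw [normalD, normalD, H.conjVec_normalPart hz, (wirt_conjVec hψ).1]

theorem conjVec_normalD' (H : IsIsothermal U Y) (hz : z ∈ U) {ψ : ℂ → Fin 6 → ℂ}
    (hψ : ContDiffAt ℝ ∞ ψ z) :
    conjVec (normalD (-Complex.I) Y ψ z) = normalD Complex.I Y (fun w => conjVec (ψ w)) z := by
  rw [normalD, normalD, H.conjVec_normalPart hz, (wirt_conjVec hψ).2]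

/-- `(Y_zz)_z̄` in terms of `κ`. -/
theorem wirt_Yzz (H : IsIsothermal U Y) (hz : z ∈ U) :
    wirt Complex.I (Yzz Y) z = wirt Complex.I (kappa Y) z -
      ((wirt Complex.I (schwarzian Y) z / 2) • cplx (Y z) + (schwarzian Y z / 2) • Yzbar Y z) := by
  have h := H.smooth z hz
  have hs := contDiffAt_schwarzian h
  have hX := contDiffAt_cplx h
  have hs2 : ContDiffAt ℝ ∞ (fun w => schwarzian Y w / 2) z := hs.div_const 2
  have e : wirt Complex.I (fun w => schwarzian Y w / 2) z = wirt Complex.I (schwarzian Y) z / 2 := by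
    have := wirt_const_mul (c := Complex.I) (a := 1 / 2) (diffAt hs)
    rw [div_eq_inv_mul, ← one_div, ← this]
    congr 1; funext w; ring
  rw [wirt_congr_on H.isOpen (fun w hw => H.Yzz_eq_kappa hw) hz,
    wirt_sub (diffAt (contDiffAt_kappa h)) (diffAt (contDiffAt_fun_smul hs2 hX)),
    wirt_smul (diffAt hs2) (diffAt hX), e, Yzbar_eq]

theorem wirt_Yzzbar' (H : IsIsothermal U Y) (hz : z ∈ U) :
    wirt (-Complex.I) (Yzzbar Y) z = wirt Complex.I (Yzz Y) z := by
  rw [Yzzbar_eq, Yzz_eq]; exact wirt_comm (contDiffAt_Yz (H.smooth z hz))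

/-- The normal part of `N_z` is `2 D_z̄ κ`. -/
theorem lor_frameN_z (H : IsIsothermal U Y) (hz : z ∈ U) {ψ : Fin 6 → ℂ} (n : IsNormal Y z ψ) :
    lor ψ (wirt (-Complex.I) (frameN Y) z) = 2 * lor ψ (DzbarKappa Y z) := by
  have h := H.smooth z hz
  have hB := contDiffAt_Yzzbar h
  have hX := contDiffAt_cplx h
  have hBB : ContDiffAt ℝ ∞ (fun w => 2 * lor (Yzzbar Y w) (Yzzbar Y w)) z :=
    contDiffAt_const.mul (contDiffAt_lor hB hB)
  unfold frameN
  rw [wirt_add (diffAt (hB.const_smul (2 : ℂ))) (diffAt (contDiffAt_fun_smul hBB hX)),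
    wirt_const_smul (diffAt hB), wirt_smul (diffAt hBB) (diffAt hX), H.wirt_Yzzbar' hz,
    H.wirt_Yzz hz, ← Yz_eq, DzbarKappa_eq, normalD, n.lor_normalPart]
  simp only [lor_add_right, lor_sub_right, lor_smul_right, n.lor_Y, n.lor_Yz, n.lor_Yzbar]
  ring

theorem lor_frameN_zbar (H : IsIsothermal U Y) (hz : z ∈ U) {ψ : Fin 6 → ℂ}
    (n : IsNormal Y z ψ) :
    lor ψ (wirt Complex.I (frameN Y) z) = 2 * lor ψ (conjVec (DzbarKappa Y z)) := by
  have h := H.smooth z hz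
  have e : wirt Complex.I (frameN Y) z = conjVec (wirt (-Complex.I) (frameN Y) z) := by
    rw [← (wirt_conjVec (contDiffAt_frameN h)).2]
    exact wirt_congr_on H.isOpen (fun w hw => (H.conjVec_frameN hw).symm) hz
  have h1 := H.lor_frameN_z hz (H.isNormal_conjVec hz n)
  have h2 := congrArg conj h1
  rw [map_mul, ← lor_conjVec, ← lor_conjVec, conjVec_conjVec, Complex.conj_ofNat] at h2
  rw [e, h2]

/-- `ψ_z = D_z ψ + 2⟨ψ, D_z̄ κ⟩ Y - 2⟨ψ, κ⟩ Y_z̄` for a normal field `ψ`. -/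
theorem wirt_normal_z (H : IsIsothermal U Y) (hz : z ∈ U) {ψ : ℂ → Fin 6 → ℂ}
    (hψ : ContDiffAt ℝ ∞ ψ z) (n : ∀ w ∈ U, IsNormal Y w (ψ w)) :
    wirt (-Complex.I) ψ z = normalD (-Complex.I) Y ψ z +
      (2 * lor (ψ z) (DzbarKappa Y z)) • cplx (Y z) - (2 * lor (ψ z) (kappa Y z)) • Yzbar Y z := by
  have h := H.smooth z hz
  have e1 := lor_wirt_of_const (c := -Complex.I) H.isOpen (fun w hw => (n w hw).lor_Y) hz hψ
    (contDiffAt_cplx h)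
  have e2 := lor_wirt_of_const (c := -Complex.I) H.isOpen (fun w hw => (n w hw).lor_N) hz hψ
    (contDiffAt_frameN h)
  have e3 := lor_wirt_of_const (c := -Complex.I) H.isOpen (fun w hw => (n w hw).lor_Yz) hz hψ
    (contDiffAt_Yz h)
  have e4 := lor_wirt_of_const (c := -Complex.I) H.isOpen (fun w hw => (n w hw).lor_Yzbar) hz hψ
    (contDiffAt_Yzbar h)
  rw [← Yz_eq, (n z hz).lor_Yz, add_zero] at e1
  rw [H.lor_frameN_z hz (n z hz)] at e2
  rw [← Yzz_eq, H.Yzz_eq_kappa hz, lor_sub_right, lor_smul_right, (n z hz).lor_Y] at e3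
  rw [wirt_Yzbar h, lor_Yzzbar_of_isNormal (n z hz), add_zero] at e4
  have e2' := eq_neg_of_add_eq_zero_left e2
  have e3' : lor (wirt (-Complex.I) ψ z) (Yz Y z) = -lor (ψ z) (kappa Y z) := by
    linear_combination e3
  simp only [normalD, normalPart, e1, e2', e3', e4]
  module

/-- `ψ_z̄ = D_z̄ ψ + 2⟨ψ, D_z κ̄⟩ Y - 2⟨ψ, κ̄⟩ Y_z` for a normal field `ψ`. -/
theorem wirt_normal_zbar (H : IsIsothermal U Y) (hz : z ∈ U) {ψ : ℂ → Fin 6 → ℂ}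
    (hψ : ContDiffAt ℝ ∞ ψ z) (n : ∀ w ∈ U, IsNormal Y w (ψ w)) :
    wirt Complex.I ψ z = normalD Complex.I Y ψ z +
      (2 * lor (ψ z) (conjVec (DzbarKappa Y z))) • cplx (Y z) -
      (2 * lor (ψ z) (conjVec (kappa Y z))) • Yz Y z := by
  have h := H.smooth z hz
  have e1 := lor_wirt_of_const (c := Complex.I) H.isOpen (fun w hw => (n w hw).lor_Y) hz hψ
    (contDiffAt_cplx h)
  have e2 := lor_wirt_of_const (c := Complex.I) H.isOpen (fun w hw => (n w hw).lor_N) hz hψ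
    (contDiffAt_frameN h)
  have e3 := lor_wirt_of_const (c := Complex.I) H.isOpen (fun w hw => (n w hw).lor_Yz) hz hψ
    (contDiffAt_Yz h)
  have e4 := lor_wirt_of_const (c := Complex.I) H.isOpen (fun w hw => (n w hw).lor_Yzbar) hz hψ
    (contDiffAt_Yzbar h)
  rw [← Yzbar_eq, (n z hz).lor_Yzbar, add_zero] at e1
  rw [H.lor_frameN_zbar hz (n z hz)] at e2
  rw [← Yzzbar_eq, lor_Yzzbar_of_isNormal (n z hz), add_zero] at e3
  rw [← Yzbarzbar, H.Yzbarzbar_eq_kappa hz, lor_sub_right, lor_smul_right, (n z hz).lor_Y] at e4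
  have e2' := eq_neg_of_add_eq_zero_left e2
  have e4' : lor (wirt Complex.I ψ z) (Yzbar Y z) = -lor (ψ z) (conjVec (kappa Y z)) := by
    linear_combination e4
  simp only [normalD, normalPart, e1, e2', e3, e4']
  module

/-- Ricci: `D_z̄ D_z ψ - D_z D_z̄ ψ = 2⟨ψ, κ⟩ κ̄ - 2⟨ψ, κ̄⟩ κ`. -/
theorem ricci (H : IsIsothermal U Y) (hz : z ∈ U) {ψ : ℂ → Fin 6 → ℂ}
    (hψ : ∀ w ∈ U, ContDiffAt ℝ ∞ ψ w) (n : ∀ w ∈ U, IsNormal Y w (ψ w)) :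
    normalD Complex.I Y (normalD (-Complex.I) Y ψ) z =
      normalD (-Complex.I) Y (normalD Complex.I Y ψ) z +
      (2 * lor (ψ z) (kappa Y z)) • conjVec (kappa Y z) -
      (2 * lor (ψ z) (conjVec (kappa Y z))) • kappa Y z := by
  have h := H.smooth z hz
  have hk := contDiffAt_kappa h
  have hkb := contDiffAt_conjVec hk
  have hD := contDiffAt_normalD (c := Complex.I) h hk
  have hX := contDiffAt_cplx h
  have f1 : ContDiffAt ℝ ∞ (fun w => 2 * lor (ψ w) (DzbarKappa Y w)) z :=
    contDiffAt_const.mul (contDiffAt_lor (hψ z hz) hD)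
  have f2 : ContDiffAt ℝ ∞ (fun w => 2 * lor (ψ w) (kappa Y w)) z :=
    contDiffAt_const.mul (contDiffAt_lor (hψ z hz) hk)
  have f3 : ContDiffAt ℝ ∞ (fun w => 2 * lor (ψ w) (conjVec (DzbarKappa Y w))) z :=
    contDiffAt_const.mul (contDiffAt_lor (hψ z hz) (contDiffAt_conjVec hD))
  have f4 : ContDiffAt ℝ ∞ (fun w => 2 * lor (ψ w) (conjVec (kappa Y w))) z :=
    contDiffAt_const.mul (contDiffAt_lor (hψ z hz) hkb)
  have g1 := contDiffAt_normalD (c := -Complex.I) h (hψ z hz)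
  have g2 := contDiffAt_normalD (c := Complex.I) h (hψ z hz)
  have key := wirt_comm (a := Complex.I) (b := -Complex.I) (hψ z hz)
  rw [wirt_congr_on H.isOpen (fun w hw => H.wirt_normal_z hw (hψ w hw) n) hz,
    wirt_congr_on H.isOpen (fun w hw => H.wirt_normal_zbar hw (hψ w hw) n) hz,
    wirt_sub (diffAt (contDiffAt_fun_add g1 (contDiffAt_fun_smul f1 hX))) (diffAt (contDiffAt_fun_smul f2 (contDiffAt_Yzbar h))),
    wirt_add (diffAt g1) (diffAt (contDiffAt_fun_smul f1 hX)), wirt_smul (diffAt f1) (diffAt hX),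
    wirt_smul (diffAt f2) (diffAt (contDiffAt_Yzbar h)),
    wirt_sub (diffAt (contDiffAt_fun_add g2 (contDiffAt_fun_smul f3 hX))) (diffAt (contDiffAt_fun_smul f4 (contDiffAt_Yz h))),
    wirt_add (diffAt g2) (diffAt (contDiffAt_fun_smul f3 hX)), wirt_smul (diffAt f3) (diffAt hX),
    wirt_smul (diffAt f4) (diffAt (contDiffAt_Yz h)), ← Yz_eq, ← Yzbar_eq, ← Yzbarzbar, ← Yzz_eq,
    H.Yzbarzbar_eq_kappa hz, H.Yzz_eq_kappa hz] at key
  -- Of the tangential terms of ψ_z and ψ_z̄, only the multiples of Y_z̄ and Y_z acquire a normal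
  -- part when differentiated again, through Y_z̄z̄ and Y_zz. These give the κ̄ and κ terms.
  have key2 := congrArg (normalPart Y z) key
  simp only [normalPart_add, normalPart_sub, normalPart_smul, H.normalPart_Y hz,
    H.normalPart_Yz hz, H.normalPart_Yzbar hz, (H.isNormal_kappa hz).normalPart_eq,
    (H.isNormal_conjVec hz (H.isNormal_kappa hz)).normalPart_eq, smul_zero, add_zero, zero_add,
    sub_zero] at key2
  rw [normalD, normalD]
  rw [sub_eq_iff_eq_add] at key2
  rw [key2]; module

/-- Gauss: `s_z̄ = 6⟨κ, D_z κ̄⟩ + 2⟨D_z κ, κ̄⟩`. -/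
theorem gauss (H : IsIsothermal U Y) (hz : z ∈ U) :
    wirt Complex.I (schwarzian Y) z = 6 * lor (kappa Y z) (conjVec (DzbarKappa Y z)) +
      2 * lor (normalD (-Complex.I) Y (kappa Y) z) (conjVec (kappa Y z)) := by
  have h := H.smooth z hz
  have hk := contDiffAt_kappa h
  have hN := contDiffAt_frameN h
  have nk := H.isNormal_kappa hz
  have nkb := H.isNormal_conjVec hz nk
  have hX := contDiffAt_cplx h
  have hB := contDiffAt_Yzzbar h
  have hBB := contDiffAt_lor hB hB
  have e1 := H.wirt_Yzz hz
  have e2 := H.wirt_Yzzbar' hz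
  have e3 : wirt (-Complex.I) (Yzzbar Y) z = (1 / 2 : ℂ) • wirt (-Complex.I) (frameN Y) z -
      (wirt (-Complex.I) (fun w => lor (Yzzbar Y w) (Yzzbar Y w)) z • cplx (Y z) +
        lor (Yzzbar Y z) (Yzzbar Y z) • Yz Y z) := by
    conv_lhs => rw [wirt_congr_on H.isOpen (fun w _ => Yzzbar_eq_frameN Y w) hz]
    rw [wirt_sub (diffAt (hN.const_smul (1 / 2 : ℂ))) (diffAt (contDiffAt_fun_smul hBB hX)),
      wirt_const_smul (diffAt hN), wirt_smul (diffAt hBB) (diffAt hX), ← Yz_eq]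
  have e4 := lor_wirt_of_const (c := -Complex.I) H.isOpen (fun w hw => H.lor_frameN_frameN hw) hz
    hN hN
  rw [lor_comm (frameN Y z)] at e4
  have e5 : wirt (-Complex.I) (fun w => lor (Yzzbar Y w) (Yzzbar Y w)) z =
      lor (normalD (-Complex.I) Y (kappa Y) z) (conjVec (kappa Y z)) +
        lor (kappa Y z) (conjVec (DzbarKappa Y z)) := by
    rw [wirt_congr_on H.isOpen (fun w hw => (H.lor_kappa_conj hw).symm) hz,
      wirt_lor_normal hk (contDiffAt_conjVec hk) nk nkb, DzbarKappa_eq,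
      H.conjVec_normalD hz hk]
  have e6 := lor_wirt_of_const (c := Complex.I) H.isOpen (fun w hw => (H.isNormal_kappa hw).lor_N) hz
    hk hN
  rw [H.lor_frameN_zbar hz nk] at e6
  -- The third derivative Y_zzz̄ is expressed once through κ and s and once through N; pairing both
  -- expressions with N isolates s_z̄.
  have key := congrArg (fun v => lor v (frameN Y z)) (e1.symm.trans (e2.symm.trans e3))
  simp only [lor_sub_left, lor_add_left, lor_smul_left, lor_comm (cplx (Y z)) (frameN Y z),
    lor_comm (Yz Y z) (frameN Y z), lor_comm (Yzbar Y z) (frameN Y z),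
    H.lor_frameN_Y hz, H.lor_frameN_Yz hz, H.lor_frameN_Yzbar hz, e5] at key
  linear_combination 2 * key + e4 / 2 - 2 * e6

end IsIsothermal

end Normal

/-! ### Consequences of the Willmore equation -/

section WillmoreEquation

variable {U : Set ℂ} {Y : ℂ → Fin 6 → ℝ} {z : ℂ}

theorem contDiffAt_DzbarKappa (h : ContDiffAt ℝ ∞ Y z) : ContDiffAt ℝ ∞ (DzbarKappa Y) z :=
  contDiffAt_normalD h (contDiffAt_kappa h)

theorem contDiffAt_Theta (h : ContDiffAt ℝ ∞ Y z) : ContDiffAt ℝ ∞ (Theta Y) z := by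
  have hk := contDiffAt_kappa h
  have hD := contDiffAt_DzbarKappa h
  exact ((contDiffAt_lor hD hk).pow 2).sub ((contDiffAt_lor hk hk).mul (contDiffAt_lor hD hD))

/-- The Willmore equation `D_z̄ D_z̄ κ + (s̄/2) κ = 0`. -/
def WillmoreEq (U : Set ℂ) (Y : ℂ → Fin 6 → ℝ) : Prop :=
  ∀ z ∈ U, normalD Complex.I Y (DzbarKappa Y) z = (-(conj (schwarzian Y z) / 2)) • kappa Y z

/-- The function `-2⟨D_z D_z̄ κ, κ⟩ + 2⟨D_z̄ κ, D_z κ⟩ - 2⟨κ, κ⟩⟨κ, κ̄⟩`, which is `ρ⟨κ, κ⟩` on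
S-Willmore surfaces without umbilic points. -/
def quartic (Y : ℂ → Fin 6 → ℝ) (z : ℂ) : ℂ :=
  -2 * lor (normalD (-Complex.I) Y (DzbarKappa Y) z) (kappa Y z) +
    2 * lor (DzbarKappa Y z) (normalD (-Complex.I) Y (kappa Y) z) -
    2 * (lor (kappa Y z) (kappa Y z) * lor (kappa Y z) (conjVec (kappa Y z)))

theorem contDiffAt_quartic (h : ContDiffAt ℝ ∞ Y z) : ContDiffAt ℝ ∞ (quartic Y) z := by
  have hk := contDiffAt_kappa h
  have hD := contDiffAt_DzbarKappa h
  exact ((contDiffAt_const.mul (contDiffAt_lor (contDiffAt_normalD h hD) hk)).add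
    (contDiffAt_const.mul (contDiffAt_lor hD (contDiffAt_normalD h hk)))).sub
    (contDiffAt_const.mul ((contDiffAt_lor hk hk).mul
      (contDiffAt_lor hk (contDiffAt_conjVec hk))))

namespace IsIsothermal

theorem isNormal_DzbarKappa (H : IsIsothermal U Y) (hz : z ∈ U) : IsNormal Y z (DzbarKappa Y z) :=
  H.isNormal_normalPart hz _

/-- For a pair a, b with a' = b and b' a multiple of a, the derivative of a ∧ b is b ∧ b plus a
multiple of a ∧ a, hence zero. Here a = κ and b = D_z̄ κ, and the connection is metric. -/
theorem dzbar_Theta (H : IsIsothermal U Y) (hW : WillmoreEq U Y) (hz : z ∈ U) :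
    dzbar (Theta Y) z = 0 := by
  have h := H.smooth z hz
  have hk := contDiffAt_kappa h
  have hD := contDiffAt_DzbarKappa h
  have nk := H.isNormal_kappa hz
  have nD := H.isNormal_DzbarKappa hz
  have h1 := diffAt (contDiffAt_lor hD hk)
  have h2 := diffAt (contDiffAt_lor hk hk)
  have h3 := diffAt (contDiffAt_lor hD hD)
  rw [dzbar_eq_wirt]
  unfold Theta
  simp only [pow_two]
  rw [wirt_sub (by fun_prop) (by fun_prop), wirt_mul h1 h1, wirt_mul h2 h3,
    wirt_lor_normal hD hk nD nk, wirt_lor_normal hk hk nk nk, wirt_lor_normal hD hD nD nD,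
    hW z hz, ← DzbarKappa_eq]
  simp only [lor_smul_left, lor_smul_right, lor_comm (kappa Y z) (DzbarKappa Y z)]
  ring

/-- Pairing a relation with Y, N, Y_z, Y_z̄ kills the tangential coefficients one at a time. With
six vectors in ℂ⁶ this yields a basis adapted to the normal plane. -/
theorem linearIndependent_of_isNormal (H : IsIsothermal U Y) (hz : z ∈ U) {a b : Fin 6 → ℂ}
    (na : IsNormal Y z a) (nb : IsNormal Y z b) (hab : ∀ s t : ℂ, s • a + t • b = 0 → s = 0 ∧ t = 0) :
    LinearIndependent ℂ ![a, b, cplx (Y z), frameN Y z, Yz Y z, Yzbar Y z] := by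
  rw [Fintype.linearIndependent_iff]
  intro g hg
  simp only [Fin.sum_univ_six, Matrix.cons_val_zero, Matrix.cons_val_one, Matrix.cons_val] at hg
  have p : ∀ v, lor (g 0 • a + g 1 • b + g 2 • cplx (Y z) + g 3 • frameN Y z + g 4 • Yz Y z +
      g 5 • Yzbar Y z) v = 0 := fun v => by rw [hg, lor_zero_left]
  have e3' := lor_comm (Yzbar Y z) (Yz Y z)
  have e5' := lor_comm (cplx (Y z)) (Yz Y z)
  have e6' := lor_comm (cplx (Y z)) (Yzbar Y z)
  have e7' := lor_comm (cplx (Y z)) (frameN Y z)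
  have e8' := lor_comm (Yz Y z) (frameN Y z)
  have e9' := lor_comm (Yzbar Y z) (frameN Y z)
  have p1 := p (cplx (Y z))
  have p2 := p (frameN Y z)
  have p3 := p (Yz Y z)
  have p4 := p (Yzbar Y z)
  simp only [lor_add_left, lor_smul_left, e3', e5', e6', e7', e8', e9', H.null z hz,
    H.null_z z hz, H.metric z hz, H.null_zbar hz, H.lor_Yz_Y hz, H.lor_Yzbar_Y hz,
    H.lor_frameN_Y hz, H.lor_frameN_Yz hz, H.lor_frameN_Yzbar hz, H.lor_frameN_frameN hz,
    na.lor_Y, na.lor_N, na.lor_Yz, na.lor_Yzbar, nb.lor_Y, nb.lor_N, nb.lor_Yz, nb.lor_Yzbar]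
    at p1 p2 p3 p4
  have q3 : g 3 = 0 := by linear_combination -p1
  have q2 : g 2 = 0 := by linear_combination -p2
  have q5 : g 5 = 0 := by linear_combination 2 * p3
  have q4 : g 4 = 0 := by linear_combination 2 * p4
  obtain ⟨q0, q1⟩ := hab (g 0) (g 1) (by
    rw [q2, q3, q4, q5] at hg
    simpa using hg)
  intro i
  fin_cases i <;> assumption

/-- The normal plane is nondegenerate: two of its vectors with vanishing Gram determinant are
linearly dependent. -/
theorem exists_smul_eq_of_gram (H : IsIsothermal U Y) (hz : z ∈ U) {a b : Fin 6 → ℂ}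
    (na : IsNormal Y z a) (nb : IsNormal Y z b) (ha : a ≠ 0)
    (hg : lor b a ^ 2 - lor a a * lor b b = 0) : ∃ c : ℂ, b = c • a := by
  by_contra hne
  have hab : ∀ s t : ℂ, s • a + t • b = 0 → s = 0 ∧ t = 0 := by
    intro s t hst
    have ht : t = 0 := by
      by_contra ht
      refine hne ⟨-(t⁻¹ * s), ?_⟩
      have : t⁻¹ • (s • a + t • b) = 0 := by rw [hst, smul_zero]
      rw [smul_add, smul_smul, smul_smul, inv_mul_cancel₀ ht, one_smul] at this
      rw [neg_smul]
      exact eq_neg_of_add_eq_zero_right this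
    refine ⟨?_, ht⟩
    rw [ht, zero_smul, add_zero] at hst
    exact (smul_eq_zero.1 hst).resolve_right ha
  have hli := H.linearIndependent_of_isNormal hz na nb hab
  have hspan := hli.span_eq_top_of_card_eq_finrank (by simp)
  -- If a and b were independent, they and the tangential frame would span ℂ⁶, so a normal vector
  -- orthogonal to both would be orthogonal to everything.
  have hzero : ∀ x : Fin 6 → ℂ, IsNormal Y z x → lor x a = 0 → lor x b = 0 → x = 0 := by
    intro x nx hxa hxb
    apply eq_zero_of_lor_eq_zero
    intro w
    have hw : w ∈ Submodule.span ℂ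
        (Set.range ![a, b, cplx (Y z), frameN Y z, Yz Y z, Yzbar Y z]) := by
      rw [hspan]; trivial
    induction hw using Submodule.span_induction with
    | mem v hv =>
      obtain ⟨i, rfl⟩ := hv
      fin_cases i
      · exact hxa
      · exact hxb
      · exact nx.lor_Y
      · exact nx.lor_N
      · exact nx.lor_Yz
      · exact nx.lor_Yzbar
    | zero => exact lor_zero_right _
    | add u v _ _ hu hv => rw [lor_add_right, hu, hv, add_zero]
    | smul c v _ hv => rw [lor_smul_right, hv, mul_zero]
  -- The combination ⟨a,b⟩a − ⟨a,a⟩b is orthogonal to a identically and to b because the Gram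
  -- determinant vanishes. Hence it is zero; independence then makes a orthogonal to a and b,
  -- contradicting a ≠ 0.
  have h1 := hzero (lor a b • a + (-lor a a) • b) ((na.smul _).add (nb.smul _))
    (by simp only [lor_add_left, lor_smul_left, lor_comm b a]; ring)
    (by simp only [lor_add_left, lor_smul_left]; rw [lor_comm b a] at hg; linear_combination hg)
  obtain ⟨h2, h3⟩ := hab _ _ h1
  exact ha (hzero a na (neg_eq_zero.1 h3) h2)

theorem exists_DzbarKappa_eq (H : IsIsothermal U Y) (hz : z ∈ U) (hΘ : Theta Y z = 0)
    (hk : kappa Y z ≠ 0) : ∃ c : ℂ, DzbarKappa Y z = c • kappa Y z :=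
  H.exists_smul_eq_of_gram hz (H.isNormal_kappa hz) (H.isNormal_DzbarKappa hz) hk hΘ

/-- The Ricci equation moves D_z̄ past D_z, the Willmore equation and its D_z-derivative remove D_z̄
D_z̄ κ, and the conjugate Gauss equation removes s̄_z. What is left is proportional to
⟨D_z̄κ,κ⟩⟨κ,κ̄⟩ − ⟨κ,κ⟩⟨D_z̄κ,κ̄⟩, which vanishes if κ = 0 or D_z̄ κ is parallel to κ. -/
theorem dzbar_quartic (H : IsIsothermal U Y) (hW : WillmoreEq U Y) (hz : z ∈ U)
    (hΘ : Theta Y z = 0) : dzbar (quartic Y) z = 0 := by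
  have h := H.smooth z hz
  have hk := contDiffAt_kappa h
  have hD := contDiffAt_DzbarKappa h
  have hkb := contDiffAt_conjVec hk
  have hDk := contDiffAt_normalD (c := -Complex.I) h hk
  have hDD := contDiffAt_normalD (c := -Complex.I) h hD
  have nk := H.isNormal_kappa hz
  have nD := H.isNormal_DzbarKappa hz
  have nkb := H.isNormal_conjVec hz nk
  have nDk := H.isNormal_normalD hz (-Complex.I) (kappa Y)
  have nDD := H.isNormal_normalD hz (-Complex.I) (DzbarKappa Y)
  have hs := contDiffAt_schwarzian h
  have hsb : ContDiffAt ℝ ∞ (fun w => -(conj (schwarzian Y w) / 2)) z :=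
    ((contDiffAt_conj hs).div_const 2).neg
  have es : wirt (-Complex.I) (fun w => -(conj (schwarzian Y w) / 2)) z =
      -(conj (wirt Complex.I (schwarzian Y) z) / 2) := by
    rw [← dzbar_eq_wirt, ← dz_conj (diffAt hs), dz_eq_wirt, wirt_neg, neg_inj, div_eq_inv_mul,
      ← wirt_const_mul (diffAt (contDiffAt_conj hs))]
    congr 1; funext w; ring
  have r1 := H.ricci hz (fun w hw => contDiffAt_DzbarKappa (H.smooth w hw))
    (fun w hw => H.isNormal_DzbarKappa hw)
  have r2 := H.ricci hz (fun w hw => contDiffAt_kappa (H.smooth w hw))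
    (fun w hw => H.isNormal_kappa hw)
  rw [← DzbarKappa_eq] at r2
  have r3 : normalD (-Complex.I) Y (normalD Complex.I Y (DzbarKappa Y)) z =
      (-(conj (wirt Complex.I (schwarzian Y) z) / 2)) • kappa Y z +
        (-(conj (schwarzian Y z) / 2)) • normalD (-Complex.I) Y (kappa Y) z := by
    rw [← es, ← normalD_smul hsb hk nk, normalD, normalD, wirt_congr_on H.isOpen hW hz]
  have g := congrArg conj (H.gauss hz)
  rw [map_add, map_mul, map_mul, ← lor_conjVec, ← lor_conjVec, conjVec_conjVec, conjVec_conjVec,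
    H.conjVec_normalD' hz hk, Complex.conj_ofNat, Complex.conj_ofNat] at g
  have d1 := diffAt (contDiffAt_lor hDD hk)
  have d2 := diffAt (contDiffAt_lor hD hDk)
  have d3 := diffAt (contDiffAt_lor hk hk)
  have d4 := diffAt (contDiffAt_lor hk hkb)
  -- This identity holds on every Willmore surface; the vanishing of Θ enters only afterwards.
  have key : dzbar (quartic Y) z = -12 * (lor (DzbarKappa Y z) (kappa Y z) *
      lor (kappa Y z) (conjVec (kappa Y z)) -
      lor (kappa Y z) (kappa Y z) * lor (DzbarKappa Y z) (conjVec (kappa Y z))) := by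
    rw [dzbar_eq_wirt]
    unfold quartic
    rw [wirt_sub (by fun_prop) (by fun_prop), wirt_add (by fun_prop) (by fun_prop),
      wirt_const_mul d1, wirt_const_mul d2, wirt_const_mul (by fun_prop), wirt_mul d3 d4,
      wirt_lor_normal hDD hk nDD nk, wirt_lor_normal hD hDk nD nDk, wirt_lor_normal hk hk nk nk,
      wirt_lor_normal hk hkb nk nkb, r1, r2, r3, g, hW z hz, ← DzbarKappa_eq]
    simp only [lor_smul_left, lor_smul_right, lor_add_left, lor_add_right, lor_sub_left,
      lor_sub_right, lor_comm (kappa Y z) (DzbarKappa Y z),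
      lor_comm (conjVec (kappa Y z)) (DzbarKappa Y z), lor_comm (conjVec (kappa Y z)) (kappa Y z),
      lor_comm (normalD (-Complex.I) Y (kappa Y) z) (kappa Y z),
      lor_comm (normalD Complex.I Y (fun w => conjVec (kappa Y w)) z) (kappa Y z),
      lor_comm (normalD (-Complex.I) Y (DzbarKappa Y) z) (DzbarKappa Y z)]
    ring
  rw [key]
  by_cases h0 : kappa Y z = 0
  · simp [h0, lor_zero_left, lor_zero_right]
  · obtain ⟨c, hc⟩ := H.exists_DzbarKappa_eq hz hΘ h0
    rw [hc, lor_smul_left, lor_smul_left]; ring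

/-- The vector N_z is recovered from its normal part and its products with the frame. It has no Y
and no N component, since N is null and ⟨N,Y⟩ is constant. -/
theorem frameN_z (H : IsIsothermal U Y) (hz : z ∈ U) :
    wirt (-Complex.I) (frameN Y) z = (2 : ℂ) • DzbarKappa Y z -
      (2 * lor (kappa Y z) (conjVec (kappa Y z))) • Yz Y z - schwarzian Y z • Yzbar Y z := by
  have h := H.smooth z hz
  have hN := contDiffAt_frameN h
  have hB := contDiffAt_Yzzbar h
  have hX := contDiffAt_cplx h
  have hBB : ContDiffAt ℝ ∞ (fun w => 2 * lor (Yzzbar Y w) (Yzzbar Y w)) z :=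
    contDiffAt_const.mul (contDiffAt_lor hB hB)
  have e0 : normalPart Y z (wirt (-Complex.I) (frameN Y) z) = (2 : ℂ) • DzbarKappa Y z := by
    unfold frameN
    rw [wirt_add (diffAt (hB.const_smul (2 : ℂ))) (diffAt (contDiffAt_fun_smul hBB hX)),
      wirt_const_smul (diffAt hB), wirt_smul (diffAt hBB) (diffAt hX), H.wirt_Yzzbar' hz,
      H.wirt_Yzz hz, ← Yz_eq, DzbarKappa_eq, normalD]
    simp only [normalPart_add, normalPart_sub, normalPart_smul, H.normalPart_Y hz,
      H.normalPart_Yz hz, H.normalPart_Yzbar hz]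
    module
  have e1 := lor_wirt_of_const (c := -Complex.I) H.isOpen (fun w hw => H.lor_frameN_Y hw) hz hN hX
  have e2 := lor_wirt_of_const (c := -Complex.I) H.isOpen (fun w hw => H.lor_frameN_frameN hw) hz
    hN hN
  have e3 := lor_wirt_of_const (c := -Complex.I) H.isOpen (fun w hw => H.lor_frameN_Yz hw) hz hN
    (contDiffAt_Yz h)
  have e4 := lor_wirt_of_const (c := -Complex.I) H.isOpen (fun w hw => H.lor_frameN_Yzbar hw) hz hN
    (contDiffAt_Yzbar h)
  rw [← Yz_eq, H.lor_frameN_Yz hz, add_zero] at e1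
  rw [lor_comm (frameN Y z)] at e2
  have e2' : lor (wirt (-Complex.I) (frameN Y) z) (frameN Y z) = 0 := by linear_combination e2 / 2
  rw [← Yzz_eq, H.Yzz_eq_kappa hz, lor_sub_right, lor_smul_right, lor_comm (frameN Y z),
    (H.isNormal_kappa hz).lor_N, H.lor_frameN_Y hz] at e3
  rw [wirt_Yzbar h, Yzzbar_eq_frameN, lor_sub_right, lor_smul_right, lor_smul_right,
    H.lor_frameN_frameN hz, H.lor_frameN_Y hz, ← H.lor_kappa_conj hz] at e4
  have e3' : lor (wirt (-Complex.I) (frameN Y) z) (Yz Y z) = -(schwarzian Y z / 2) := by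
    linear_combination e3
  have e4' : lor (wirt (-Complex.I) (frameN Y) z) (Yzbar Y z) =
      -lor (kappa Y z) (conjVec (kappa Y z)) := by
    linear_combination e4
  rw [← e0]
  simp only [normalPart, e1, e2', e3', e4']
  module

end IsIsothermal

end WillmoreEquation

/-! ### The dual surface -/

section Dual

variable {U : Set ℂ} {Y : ℂ → Fin 6 → ℝ} {z : ℂ} {μ : ℂ → ℂ}

theorem wirt_div_two {c : ℂ} {f : ℂ → ℂ} (hf : ContDiffAt ℝ ∞ f z) :
    wirt c (fun w => f w / 2) z = wirt c f z / 2 := by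
  rw [div_eq_inv_mul, ← wirt_const_mul (diffAt hf)]
  congr 1; funext w; ring

theorem beta_eq (Y : ℂ → Fin 6 → ℝ) (z : ℂ) :
    beta Y z = -lor (kappa Y z) (conjVec (kappa Y z)) := rfl

/-- Writing |μ|² as μ̄μ makes the coefficient accessible to the product rule. -/
theorem dualVector_eq (Y : ℂ → Fin 6 → ℝ) (μ : ℂ → ℂ) (z : ℂ) :
    dualVector Y μ z = (conj (μ z) / 2 * μ z) • cplx (Y z) + conj (μ z) • Yz Y z +
      μ z • Yzbar Y z + frameN Y z := by
  have : ((‖μ z‖ ^ 2 / 2 : ℝ) : ℂ) = conj (μ z) / 2 * μ z := by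
    push_cast
    rw [← Complex.conj_mul']; ring
  rw [dualVector, this]

theorem contDiffAt_dualVector (h : ContDiffAt ℝ ∞ Y z) (hμ : ContDiffAt ℝ ∞ μ z) :
    ContDiffAt ℝ ∞ (dualVector Y μ) z := by
  have e : dualVector Y μ = _ := funext (dualVector_eq Y μ)
  rw [e]
  have hc := contDiffAt_conj hμ
  exact (((((hc.div_const 2).mul hμ).smul (contDiffAt_cplx h)).add
    (hc.smul (contDiffAt_Yz h))).add (hμ.smul (contDiffAt_Yzbar h))).add (contDiffAt_frameN h)

namespace IsIsothermal

/-- Nothing is assumed about the regularity of μ. Near each point some component of κ is nonzero,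
and there μ̄ is −2 times a quotient of components of D_z̄ κ and κ. -/
theorem contDiffAt_mu (H : IsIsothermal U Y) (hk : ∀ z ∈ U, kappa Y z ≠ 0) (hμ : IsMu Y U μ)
    (hz : z ∈ U) : ContDiffAt ℝ ∞ μ z := by
  have h := H.smooth z hz
  obtain ⟨i, hi⟩ := Function.ne_iff.1 (hk z hz)
  have hki := contDiffAt_pi.1 (contDiffAt_kappa h) i
  have hDi := contDiffAt_pi.1 (contDiffAt_DzbarKappa h) i
  have hq : ContDiffAt ℝ ∞ (fun w => conj (-2 * (DzbarKappa Y w i * (kappa Y w i)⁻¹))) z :=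
    contDiffAt_conj (contDiffAt_const.mul (hDi.mul (hki.inv hi)))
  refine hq.congr_of_eventuallyEq ?_
  filter_upwards [H.isOpen.mem_nhds hz, hki.continuousAt.eventually_ne hi] with w hw hne
  have e := congrFun (hμ w hw) i
  simp only [Pi.smul_apply, smul_eq_mul] at e
  have : -2 * (DzbarKappa Y w i * (kappa Y w i)⁻¹) = conj (μ w) := by
    have hne' : kappa Y w i ≠ 0 := hne
    rw [e]; field_simp
  rw [this, Complex.conj_conj]

/-- The Riccati equation `μ_z = s + μ² / 2`. -/
theorem riccati (H : IsIsothermal U Y) (hW : WillmoreEq U Y) (hk : ∀ z ∈ U, kappa Y z ≠ 0)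
    (hμ : IsMu Y U μ) (hz : z ∈ U) :
    wirt (-Complex.I) μ z = schwarzian Y z + μ z ^ 2 / 2 := by
  have h := H.smooth z hz
  have hm := H.contDiffAt_mu hk hμ hz
  have hc := contDiffAt_conj hm
  have hf : ContDiffAt ℝ ∞ (fun w => -(conj (μ w) / 2)) z := (hc.div_const 2).neg
  have e1 := hW z hz
  rw [normalD, wirt_congr_on H.isOpen hμ hz, ← normalD,
    normalD_smul hf (contDiffAt_kappa h) (H.isNormal_kappa hz), wirt_neg, wirt_div_two hc,
    ← DzbarKappa_eq, hμ z hz, smul_smul, ← add_smul] at e1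
  -- Both sides express D_z̄ D_z̄ κ as a multiple of κ, once from the formula for D_z̄ κ and once
  -- from the Willmore equation. As κ ≠ 0 the coefficients agree; this is the conjugate of the
  -- claim.
  have e2 := smul_left_injective ℂ (hk z hz) e1
  rw [← dzbar_eq_wirt, dzbar_conj (diffAt hm), dz_eq_wirt] at e2
  have e3 := congrArg conj e2
  simp only [map_add, map_neg, map_div₀, map_mul, Complex.conj_conj, Complex.conj_ofNat] at e3
  linear_combination (-2) * e3

theorem rho_eq (Y : ℂ → Fin 6 → ℝ) (μ : ℂ → ℂ) (z : ℂ) :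
    rho Y μ z = wirt (-Complex.I) (fun w => conj (μ w)) z -
      2 * lor (kappa Y z) (conjVec (kappa Y z)) := by
  rw [rho, dz_eq_wirt, beta_eq]; ring

/-- After substituting D_z̄ κ = −(μ̄/2)κ the two terms with ⟨κ, D_z κ⟩ cancel, and the derivative of
the coefficient leaves μ̄_z⟨κ,κ⟩. Thus ρ⟨κ,κ⟩ is given by a formula free of μ, which makes sense at
umbilic points. -/
theorem quartic_eq (H : IsIsothermal U Y) (hk : ∀ z ∈ U, kappa Y z ≠ 0)
    (hμ : IsMu Y U μ) (hz : z ∈ U) :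
    quartic Y z = rho Y μ z * lor (kappa Y z) (kappa Y z) := by
  have h := H.smooth z hz
  have hm := H.contDiffAt_mu hk hμ hz
  have hc := contDiffAt_conj hm
  have hf : ContDiffAt ℝ ∞ (fun w => -(conj (μ w) / 2)) z := (hc.div_const 2).neg
  have e1 : normalD (-Complex.I) Y (DzbarKappa Y) z =
      (-(wirt (-Complex.I) (fun w => conj (μ w)) z / 2)) • kappa Y z +
        (-(conj (μ z) / 2)) • normalD (-Complex.I) Y (kappa Y) z := by
    rw [normalD, wirt_congr_on H.isOpen hμ hz, ← normalD,
      normalD_smul hf (contDiffAt_kappa h) (H.isNormal_kappa hz), wirt_neg, wirt_div_two hc]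
  rw [quartic, e1, hμ z hz, rho_eq]
  simp only [lor_add_left, lor_smul_left, lor_comm (normalD (-Complex.I) Y (kappa Y) z) (kappa Y z)]
  ring

/-- `Ŷ_z = (μ/2) Ŷ + ρ (Y_z + (μ/2) Y)`. -/
theorem dualVector_z (H : IsIsothermal U Y) (hW : WillmoreEq U Y) (hk : ∀ z ∈ U, kappa Y z ≠ 0)
    (hμ : IsMu Y U μ) (hz : z ∈ U) :
    wirt (-Complex.I) (dualVector Y μ) z = (μ z / 2) • dualVector Y μ z +
      rho Y μ z • (Yz Y z + (μ z / 2) • cplx (Y z)) := by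
  have h := H.smooth z hz
  have hm := H.contDiffAt_mu hk hμ hz
  have hc := contDiffAt_conj hm
  have hf : ContDiffAt ℝ ∞ (fun w => conj (μ w) / 2) z := hc.div_const 2
  have hg : ContDiffAt ℝ ∞ (fun w => conj (μ w) / 2 * μ w) z := hf.mul hm
  have hX := contDiffAt_cplx h
  have t1 := contDiffAt_fun_smul hg hX
  have t2 := contDiffAt_fun_smul hc (contDiffAt_Yz h)
  have t3 := contDiffAt_fun_smul hm (contDiffAt_Yzbar h)
  have e : dualVector Y μ = _ := funext (dualVector_eq Y μ)
  conv_lhs => rw [e]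
  -- The κ-terms μ̄κ and 2D_z̄ κ cancel, and the Riccati equation turns the coefficient μ_z − s of
  -- Y_z̄ into μ²/2, which matches (μ/2)Ŷ.
  rw [wirt_add (diffAt (contDiffAt_fun_add (contDiffAt_fun_add t1 t2) t3))
      (diffAt (contDiffAt_frameN h)),
    wirt_add (diffAt (contDiffAt_fun_add t1 t2)) (diffAt t3), wirt_add (diffAt t1) (diffAt t2),
    wirt_smul (diffAt hg) (diffAt hX), wirt_smul (diffAt hc) (diffAt (contDiffAt_Yz h)),
    wirt_smul (diffAt hm) (diffAt (contDiffAt_Yzbar h)), wirt_mul (diffAt hf) (diffAt hm),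
    wirt_div_two hc, H.frameN_z hz, wirt_Yzbar h, ← Yz_eq, ← Yzz_eq, Yzzbar_eq_frameN,
    ← H.lor_kappa_conj hz, H.Yzz_eq_kappa hz, hμ z hz, H.riccati hW hk hμ hz, dualVector_eq, rho_eq]
  module

/-- `⟨Ŷ_zz, Ŷ_zz⟩ = ρ² ⟨κ, κ⟩`. -/
theorem lor_dualVector_zz (H : IsIsothermal U Y) (hW : WillmoreEq U Y)
    (hk : ∀ z ∈ U, kappa Y z ≠ 0) (hμ : IsMu Y U μ) (hz : z ∈ U) :
    lor (wirt (-Complex.I) (wirt (-Complex.I) (dualVector Y μ)) z)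
      (wirt (-Complex.I) (wirt (-Complex.I) (dualVector Y μ)) z) =
      rho Y μ z ^ 2 * lor (kappa Y z) (kappa Y z) := by
  have h := H.smooth z hz
  have hm := H.contDiffAt_mu hk hμ hz
  have hm2 : ContDiffAt ℝ ∞ (fun w => μ w / 2) z := hm.div_const 2
  have hc := contDiffAt_conj hm
  have hX := contDiffAt_cplx h
  have hr : ContDiffAt ℝ ∞ (rho Y μ) z := by
    have e : rho Y μ = _ := funext (rho_eq Y μ)
    rw [e]
    exact (contDiffAt_wirt hc).sub (contDiffAt_const.mul
      (contDiffAt_lor (contDiffAt_kappa h) (contDiffAt_conjVec (contDiffAt_kappa h))))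
  have hd := contDiffAt_dualVector h hm
  have ha := contDiffAt_Yz h
  have hp := contDiffAt_fun_add ha (contDiffAt_fun_smul hm2 hX)
  -- The vectors Ŷ and Y_z + (μ/2)Y are null, and orthogonal to each other and to κ. Hence only the
  -- term ρκ contributes to ⟨Ŷ_zz, Ŷ_zz⟩.
  have key : wirt (-Complex.I) (wirt (-Complex.I) (dualVector Y μ)) z =
      (wirt (-Complex.I) μ z / 2 + μ z ^ 2 / 4) • dualVector Y μ z +
      (rho Y μ z * μ z + wirt (-Complex.I) (rho Y μ) z) • (Yz Y z + (μ z / 2) • cplx (Y z)) +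
      rho Y μ z • kappa Y z := by
    rw [wirt_congr_on H.isOpen (fun w hw => H.dualVector_z hW hk hμ hw) hz,
      wirt_add (diffAt (contDiffAt_fun_smul hm2 hd)) (diffAt (contDiffAt_fun_smul hr hp)),
      wirt_smul (diffAt hm2) (diffAt hd), wirt_smul (diffAt hr) (diffAt hp),
      wirt_add (diffAt ha) (diffAt (contDiffAt_fun_smul hm2 hX)),
      wirt_smul (diffAt hm2) (diffAt hX), ← Yz_eq, ← Yzz_eq, H.dualVector_z hW hk hμ hz,
      wirt_div_two hm, H.Yzz_eq_kappa hz, H.riccati hW hk hμ hz]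
    module
  have nk := H.isNormal_kappa hz
  have e3' := lor_comm (Yzbar Y z) (Yz Y z)
  have e5' := lor_comm (cplx (Y z)) (Yz Y z)
  have e6' := lor_comm (cplx (Y z)) (Yzbar Y z)
  have e7' := lor_comm (cplx (Y z)) (frameN Y z)
  have e8' := lor_comm (Yz Y z) (frameN Y z)
  have e9' := lor_comm (Yzbar Y z) (frameN Y z)
  rw [key, dualVector_eq]
  simp only [lor_add_left, lor_smul_left, lor_add_right, lor_smul_right, e3', e5', e6', e7', e8',
    e9', H.null z hz, H.null_z z hz, H.metric z hz, H.null_zbar hz, H.lor_Yz_Y hz,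
    H.lor_Yzbar_Y hz, H.lor_frameN_Y hz, H.lor_frameN_Yz hz, H.lor_frameN_Yzbar hz,
    H.lor_frameN_frameN hz, nk.lor_Y, nk.lor_N, nk.lor_Yz, nk.lor_Yzbar,
    lor_comm _ (kappa Y z)]
  ring

theorem conjVec_dualVector (H : IsIsothermal U Y) (hz : z ∈ U) :
    conjVec (dualVector Y μ z) = dualVector Y μ z := by
  simp only [dualVector, conjVec_add, conjVec_smul, conjVec_cplx, conjVec_Yz (H.smooth z hz),
    conjVec_Yzbar (H.smooth z hz), H.conjVec_frameN hz, Complex.conj_conj, Complex.conj_ofReal]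
  module

theorem lor_dualVector_Y (H : IsIsothermal U Y) (hz : z ∈ U) :
    lor (cplx (Y z)) (dualVector Y μ z) = -1 := by
  rw [lor_comm]
  simp only [dualVector, lor_add_left, lor_smul_left, H.null z hz, H.lor_Yz_Y hz,
    H.lor_Yzbar_Y hz, H.lor_frameN_Y hz]; ring

/-- Both vectors have product −1 with Y, so the proportionality factor is 1. -/
theorem eq_dualVector (H : IsIsothermal U Y) {Yh : ℂ → Fin 6 → ℝ} (hd : IsDualLift Y U μ Yh)
    (hz : z ∈ U) : cplx (Yh z) = dualVector Y μ z := by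
  obtain ⟨c, -, hc⟩ := hd.lifts z hz
  have h1 : lor (cplx (Y z)) (cplx (Yh z)) = -1 := by
    rw [lor_cplx, hd.normalized z hz]; simp
  rw [hc, lor_smul_right, H.lor_dualVector_Y hz] at h1
  have : (c : ℂ) = 1 := by linear_combination -h1
  rw [hc, this, one_smul]

/-- The two factors of Ω are ⟨κ,κ⟩ and ρ²⟨κ,κ⟩, so Ω is a perfect square; by `quartic_eq` it is the
square of a function defined at umbilic points too. -/
theorem Omega_eq (H : IsIsothermal U Y) (hW : WillmoreEq U Y)
    (hk : ∀ z ∈ U, kappa Y z ≠ 0) (hμ : IsMu Y U μ) {Yh : ℂ → Fin 6 → ℝ}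
    (hd : IsDualLift Y U μ Yh) (hz : z ∈ U) :
    Omega Y Yh z = (rho Y μ z * lor (kappa Y z) (kappa Y z)) ^ 2 := by
  have e : Yzz Yh z = wirt (-Complex.I) (wirt (-Complex.I) (dualVector Y μ)) z := by
    rw [Yzz_eq, Yz_eq]
    exact wirt_congr_on H.isOpen (fun w hw => wirt_congr_on H.isOpen
      (fun v hv => H.eq_dualVector hd hv) hw) hz
  rw [Omega, H.lor_Yzz_Yzz hz, e, H.lor_dualVector_zz hW hk hμ hz]; ring

theorem lor_kappa_of_nullFrame {L R : Fin 6 → ℝ} (hLR : IsNullFrame Y z L R) {l₁ l₂ : ℂ}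
    (hk : kappa Y z = l₁ • cplx L + l₂ • cplx R) :
    lor (kappa Y z) (kappa Y z) = -2 * (l₁ * l₂) := by
  rw [hk]
  simp only [lor_add_left, lor_add_right, lor_smul_left, lor_smul_right, lor_comm (cplx R) (cplx L),
    lor_cplx, hLR.null_L, hLR.null_R, hLR.pairing]
  push_cast; ring

/-- μ may be chosen point by point, since `contDiffAt_mu` makes it smooth. The dual vector is real,
so taking real parts loses nothing. -/
theorem exists_dualLift (H : IsIsothermal U Y) (hΘ : ∀ z ∈ U, Theta Y z = 0)
    (hk : ∀ z ∈ U, kappa Y z ≠ 0) :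
    ∃ (μ : ℂ → ℂ) (Yh : ℂ → Fin 6 → ℝ),
      ContDiffOn ℝ ∞ Yh U ∧ IsMu Y U μ ∧ IsDualLift Y U μ Yh := by
  have h1 : ∀ z, ∃ m : ℂ, z ∈ U → DzbarKappa Y z = (-(conj m / 2)) • kappa Y z := by
    intro z
    by_cases hz : z ∈ U
    · obtain ⟨c, hc⟩ := H.exists_DzbarKappa_eq hz (hΘ z hz) (hk z hz)
      -- Solves c = −μ̄/2.
      refine ⟨conj (-2 * c), fun _ => ?_⟩
      rw [hc, Complex.conj_conj]
      congr 1; ring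
    · exact ⟨0, fun h => absurd h hz⟩
  choose μ hμ using h1
  have hre : ∀ z ∈ U, cplx (fun i => (dualVector Y μ z i).re) = dualVector Y μ z := fun z hz =>
    exists_cplx_of_conjVec_eq (H.conjVec_dualVector hz)
  refine ⟨μ, fun z i => (dualVector Y μ z i).re, ?_, hμ, ⟨fun z hz => ⟨1, one_ne_zero, ?_⟩, ?_⟩⟩
  · intro z hz
    have := contDiffAt_dualVector (H.smooth z hz) (H.contDiffAt_mu hk hμ hz)
    rw [contDiffAt_pi] at this
    exact (contDiffAt_pi.2 fun i =>
      Complex.reCLM.contDiff.contDiffAt.comp z (this i)).contDiffWithinAt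
  · rw [hre z hz, Complex.ofReal_one, one_smul]
  · intro z hz
    have := H.lor_dualVector_Y (μ := μ) hz
    rw [← hre z hz, lor_cplx] at this
    exact_mod_cast this

end IsIsothermal

end Dual

/-! ### Change of coordinates -/

section Change

/-- The map `Y'` is, in the new coordinate `h`, the multiple `r Y` of `Y`. -/
structure IsCoordChange (U : Set ℂ) (Y : ℂ → Fin 6 → ℝ) (U' : Set ℂ) (Y' : ℂ → Fin 6 → ℝ)
    (h : ℂ → ℂ) (r : ℂ → ℝ) : Prop where
  left : IsIsothermal U Y
  right : IsIsothermal U' Y'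
  maps : ∀ z ∈ U, h z ∈ U'
  holomorphic : DifferentiableOn ℂ h U
  deriv_ne : ∀ z ∈ U, deriv h z ≠ 0
  smooth : ∀ z ∈ U, ContDiffAt ℝ ∞ r z
  eq : ∀ z ∈ U, Y' (h z) = r z • Y z
  sq : ∀ z ∈ U, (r z : ℂ) ^ 2 = deriv h z * conj (deriv h z)

variable {U U' : Set ℂ} {Y Y' : ℂ → Fin 6 → ℝ} {h : ℂ → ℂ} {r : ℂ → ℝ} {z : ℂ}

theorem contDiffAt_of_holomorphic {f : ℂ → ℂ} (hU : IsOpen U) (hf : DifferentiableOn ℂ f U)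
    (hz : z ∈ U) : ContDiffAt ℝ ∞ f z :=
  ((hf.analyticAt (hU.mem_nhds hz)).contDiffAt (n := ∞)).restrict_scalars ℝ

theorem dz_of_differentiableAt {f : ℂ → ℂ} (hf : DifferentiableAt ℂ f z) : dz f z = deriv f z := by
  have h := (hf.hasDerivAt.hasFDerivAt.restrictScalars ℝ).fderiv
  simp only [dz, h, ContinuousLinearMap.coe_restrictScalars',
      ContinuousLinearMap.toSpanSingleton_apply, smul_eq_mul]
  linear_combination (-1/2) * deriv f z * Complex.I_mul_I

namespace IsCoordChange

theorem differentiableAt (C : IsCoordChange U Y U' Y' h r) (hz : z ∈ U) :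
    DifferentiableAt ℂ h z :=
  C.holomorphic.differentiableAt (C.left.isOpen.mem_nhds hz)

theorem differentiableOn_deriv (C : IsCoordChange U Y U' Y' h r) :
    DifferentiableOn ℂ (deriv h) U := C.holomorphic.deriv C.left.isOpen

theorem differentiableOn_inv (C : IsCoordChange U Y U' Y' h r) :
    DifferentiableOn ℂ (fun w => (deriv h w)⁻¹) U := C.differentiableOn_deriv.inv C.deriv_ne

theorem r_ne (C : IsCoordChange U Y U' Y' h r) (hz : z ∈ U) : (r z : ℂ) ≠ 0 := by
  intro h0
  have := C.sq z hz
  rw [h0] at this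
  have h1 := C.deriv_ne z hz
  have h2 : conj (deriv h z) ≠ 0 := (map_ne_zero _).2 h1
  exact mul_ne_zero h1 h2 (by rw [← this]; ring)

theorem conj_ne (C : IsCoordChange U Y U' Y' h r) (hz : z ∈ U) : conj (deriv h z) ≠ 0 :=
  (map_ne_zero _).2 (C.deriv_ne z hz)

theorem contDiffAt_r (C : IsCoordChange U Y U' Y' h r) (hz : z ∈ U) :
    ContDiffAt ℝ ∞ (fun w => (r w : ℂ)) z :=
  Complex.ofRealCLM.contDiff.contDiffAt.comp z (C.smooth z hz)

theorem wirt_comp_neg (C : IsCoordChange U Y U' Y' h r) (hz : z ∈ U) {F G : ℂ → Fin 6 → ℂ}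
    (hF : ContDiffAt ℝ ∞ F (h z)) (hFG : ∀ w ∈ U, F (h w) = G w) :
    deriv h z • wirt (-Complex.I) F (h z) = wirt (-Complex.I) G z := by
  rw [← dz_eq_wirt, ← dz_comp (diffAt hF) (C.differentiableAt hz), dz_eq_wirt]
  exact wirt_congr_on C.left.isOpen hFG hz

theorem wirt_comp_pos (C : IsCoordChange U Y U' Y' h r) (hz : z ∈ U) {F G : ℂ → Fin 6 → ℂ}
    (hF : ContDiffAt ℝ ∞ F (h z)) (hFG : ∀ w ∈ U, F (h w) = G w) :
    conj (deriv h z) • wirt Complex.I F (h z) = wirt Complex.I G z := by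
  rw [← dzbar_eq_wirt, ← dzbar_comp (diffAt hF) (C.differentiableAt hz), dzbar_eq_wirt]
  exact wirt_congr_on C.left.isOpen hFG hz

theorem cplx_eq (C : IsCoordChange U Y U' Y' h r) (hz : z ∈ U) :
    cplx (Y' (h z)) = (r z : ℂ) • cplx (Y z) := by
  rw [C.eq z hz]; funext i; simp [cplx]

theorem smooth' (C : IsCoordChange U Y U' Y' h r) (hz : z ∈ U) : ContDiffAt ℝ ∞ Y' (h z) :=
  C.right.smooth _ (C.maps z hz)

theorem Yz_eq (C : IsCoordChange U Y U' Y' h r) (hz : z ∈ U) :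
    Yz Y' (h z) = (deriv h z)⁻¹ • (wirt (-Complex.I) (fun w => (r w : ℂ)) z • cplx (Y z) +
      (r z : ℂ) • Yz Y z) := by
  rw [eq_inv_smul_iff₀ (C.deriv_ne z hz), Willmore.Yz_eq, Willmore.Yz_eq,
    ← wirt_smul (diffAt (C.contDiffAt_r hz)) (diffAt (contDiffAt_cplx (C.left.smooth z hz)))]
  exact C.wirt_comp_neg hz (contDiffAt_cplx (C.smooth' hz)) (fun w hw => C.cplx_eq hw)

theorem Yzbar_eq (C : IsCoordChange U Y U' Y' h r) (hz : z ∈ U) :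
    conj (deriv h z) • Yzbar Y' (h z) =
      wirt Complex.I (fun w => (r w : ℂ)) z • cplx (Y z) + (r z : ℂ) • Yzbar Y z := by
  rw [Willmore.Yzbar_eq, Willmore.Yzbar_eq,
    ← wirt_smul (diffAt (C.contDiffAt_r hz)) (diffAt (contDiffAt_cplx (C.left.smooth z hz)))]
  exact C.wirt_comp_pos hz (contDiffAt_cplx (C.smooth' hz)) (fun w hw => C.cplx_eq hw)

theorem wirt_inv (C : IsCoordChange U Y U' Y' h r) (hz : z ∈ U) :
    wirt Complex.I (fun w => (deriv h w)⁻¹) z = 0 :=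
  dzbar_of_differentiableAt (C.differentiableOn_inv.differentiableAt (C.left.isOpen.mem_nhds hz))

theorem wirt_Yz (C : IsCoordChange U Y U' Y' h r) (hz : z ∈ U) (c : ℂ) :
    wirt c (fun w => Yz Y' (h w)) z =
      wirt c (fun w => (deriv h w)⁻¹) z • (wirt (-Complex.I) (fun w => (r w : ℂ)) z • cplx (Y z) +
        (r z : ℂ) • Yz Y z) +
      (deriv h z)⁻¹ • (wirt c (wirt (-Complex.I) (fun w => (r w : ℂ))) z • cplx (Y z) +
        wirt (-Complex.I) (fun w => (r w : ℂ)) z • wirt c (fun w => cplx (Y w)) z +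
        (wirt c (fun w => (r w : ℂ)) z • Yz Y z + (r z : ℂ) • wirt c (Yz Y) z)) := by
  have hY := C.left.smooth z hz
  have hX := contDiffAt_cplx hY
  have ha := contDiffAt_Yz hY
  have hr := C.contDiffAt_r hz
  have hrz := contDiffAt_wirt (c := -Complex.I) hr
  have hi := contDiffAt_of_holomorphic C.left.isOpen C.differentiableOn_inv hz
  have t1 := contDiffAt_fun_smul hrz hX
  have t2 := contDiffAt_fun_smul hr ha
  rw [wirt_congr_on C.left.isOpen (fun w hw => C.Yz_eq hw) hz,
    wirt_smul (diffAt hi) (diffAt (contDiffAt_fun_add t1 t2)), wirt_add (diffAt t1) (diffAt t2),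
    wirt_smul (diffAt hrz) (diffAt hX), wirt_smul (diffAt hr) (diffAt ha)]

theorem Yzzbar_eq (C : IsCoordChange U Y U' Y' h r) (hz : z ∈ U) :
    (deriv h z * conj (deriv h z)) • Yzzbar Y' (h z) =
      wirt Complex.I (wirt (-Complex.I) (fun w => (r w : ℂ))) z • cplx (Y z) +
        wirt (-Complex.I) (fun w => (r w : ℂ)) z • Yzbar Y z +
        (wirt Complex.I (fun w => (r w : ℂ)) z • Yz Y z + (r z : ℂ) • Yzzbar Y z) := by
  have e := C.wirt_comp_pos hz (contDiffAt_Yz (C.smooth' hz)) (fun w _ => rfl)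
  rw [C.wirt_Yz hz, C.wirt_inv hz, zero_smul, zero_add, eq_inv_smul_iff₀ (C.deriv_ne z hz),
    smul_smul] at e
  exact e

/-- Here and in the next three lemmas: each derivative of Y' is, up to a nonzero factor, r times the
same derivative of Y plus multiples of lower ones. So the new projection annihilates the old frame
step by step. -/
theorem normalPart_Y (C : IsCoordChange U Y U' Y' h r) (hz : z ∈ U) :
    normalPart Y' (h z) (cplx (Y z)) = 0 := by
  have e := C.right.normalPart_Y (C.maps z hz)
  rw [C.cplx_eq hz, normalPart_smul] at e
  exact (smul_eq_zero.1 e).resolve_left (C.r_ne hz)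

theorem normalPart_Yz (C : IsCoordChange U Y U' Y' h r) (hz : z ∈ U) :
    normalPart Y' (h z) (Yz Y z) = 0 := by
  have e := C.right.normalPart_Yz (C.maps z hz)
  rw [C.Yz_eq hz, normalPart_smul, normalPart_add, normalPart_smul, normalPart_smul,
    C.normalPart_Y hz, smul_zero, zero_add] at e
  exact (smul_eq_zero.1 ((smul_eq_zero.1 e).resolve_left
    (inv_ne_zero (C.deriv_ne z hz)))).resolve_left (C.r_ne hz)

theorem normalPart_Yzbar (C : IsCoordChange U Y U' Y' h r) (hz : z ∈ U) :
    normalPart Y' (h z) (Yzbar Y z) = 0 := by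
  have e := congrArg (normalPart Y' (h z)) (C.Yzbar_eq hz)
  rw [normalPart_smul, C.right.normalPart_Yzbar (C.maps z hz), normalPart_add, normalPart_smul,
    normalPart_smul, C.normalPart_Y hz, smul_zero, smul_zero, zero_add] at e
  exact (smul_eq_zero.1 e.symm).resolve_left (C.r_ne hz)

theorem normalPart_Yzzbar (C : IsCoordChange U Y U' Y' h r) (hz : z ∈ U) :
    normalPart Y' (h z) (Yzzbar Y z) = 0 := by
  have e := congrArg (normalPart Y' (h z)) (C.Yzzbar_eq hz)
  simp only [normalPart_smul, C.right.normalPart_Yzzbar (C.maps z hz), normalPart_add,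
    C.normalPart_Y hz, C.normalPart_Yz hz, C.normalPart_Yzbar hz, smul_zero, zero_add] at e
  exact (smul_eq_zero.1 e.symm).resolve_left (C.r_ne hz)

theorem isNormal (C : IsCoordChange U Y U' Y' h r) (hz : z ∈ U) {ψ : Fin 6 → ℂ}
    (n : IsNormal Y z ψ) : IsNormal Y' (h z) ψ := by
  have e1 : lor ψ (cplx (Y' (h z))) = 0 := by
    rw [C.cplx_eq hz, lor_smul_right, n.lor_Y, mul_zero]
  have e2 := congrArg (lor ψ) (C.Yzbar_eq hz)
  have e3 := congrArg (lor ψ) (C.Yzzbar_eq hz)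
  simp only [lor_add_right, lor_smul_right, n.lor_Y, n.lor_Yz, n.lor_Yzbar,
    IsIsothermal.lor_Yzzbar_of_isNormal n, mul_zero, add_zero] at e2 e3
  refine ⟨e1, ?_, ?_, (mul_eq_zero.1 e2).resolve_left (C.conj_ne hz)⟩
  · rw [frameN, lor_add_right, lor_smul_right, lor_smul_right, e1, (mul_eq_zero.1 e3).resolve_left
      (mul_ne_zero (C.deriv_ne z hz) (C.conj_ne hz))]; ring
  · rw [C.Yz_eq hz, lor_smul_right, lor_add_right, lor_smul_right, lor_smul_right, n.lor_Y,
      n.lor_Yz]; ring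

/-- The normal bundle does not depend on the coordinate. -/
theorem normalPart_eq (C : IsCoordChange U Y U' Y' h r) (hz : z ∈ U) (X : Fin 6 → ℂ) :
    normalPart Y' (h z) X = normalPart Y z X := by
  have hN : normalPart Y' (h z) (frameN Y z) = 0 := by
    rw [frameN, normalPart_add, normalPart_smul, normalPart_smul, C.normalPart_Yzzbar hz,
      C.normalPart_Y hz, smul_zero, smul_zero, add_zero]
  -- X and its old normal part differ by old frame vectors, which the new projection annihilates;
  -- and an old normal vector is fixed by the new projection.
  have e : normalPart Y' (h z) (normalPart Y z X) = normalPart Y' (h z) X := by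
    have hX : normalPart Y z X = X + lor X (frameN Y z) • cplx (Y z) +
      lor X (cplx (Y z)) • frameN Y z - (2 * lor X (Yzbar Y z)) • Yz Y z -
      (2 * lor X (Yz Y z)) • Yzbar Y z := rfl
    rw [hX]
    simp only [normalPart_add, normalPart_sub, normalPart_smul, hN, C.normalPart_Y hz,
      C.normalPart_Yz hz, C.normalPart_Yzbar hz, smul_zero, add_zero, sub_zero]
  rw [← e]
  exact (C.isNormal hz (C.left.isNormal_normalPart hz X)).normalPart_eq

theorem normalD_neg (C : IsCoordChange U Y U' Y' h r) (hz : z ∈ U) {F G : ℂ → Fin 6 → ℂ}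
    (hF : ContDiffAt ℝ ∞ F (h z)) (hFG : ∀ w ∈ U, F (h w) = G w) :
    deriv h z • normalD (-Complex.I) Y' F (h z) = normalD (-Complex.I) Y G z := by
  rw [normalD, C.normalPart_eq hz, ← normalPart_smul, C.wirt_comp_neg hz hF hFG, normalD]

theorem normalD_pos (C : IsCoordChange U Y U' Y' h r) (hz : z ∈ U) {F G : ℂ → Fin 6 → ℂ}
    (hF : ContDiffAt ℝ ∞ F (h z)) (hFG : ∀ w ∈ U, F (h w) = G w) :
    conj (deriv h z) • normalD Complex.I Y' F (h z) = normalD Complex.I Y G z := by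
  rw [normalD, C.normalPart_eq hz, ← normalPart_smul, C.wirt_comp_pos hz hF hFG, normalD]

/-- In the second z-derivative of Y' every term but the multiple of Y_zz is tangential. One factor r
comes from the lift, and one h'⁻¹ from each derivative. -/
theorem kappa_eq (C : IsCoordChange U Y U' Y' h r) (hz : z ∈ U) :
    kappa Y' (h z) = ((r z : ℂ) * (deriv h z)⁻¹ ^ 2) • kappa Y z := by
  have e := C.wirt_comp_neg hz (contDiffAt_Yz (C.smooth' hz)) (fun w _ => rfl)
  rw [C.wirt_Yz hz, ← Yzz_eq, ← Yzz_eq, ← Willmore.Yz_eq] at e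
  have e2 := congrArg (normalPart Y z) e
  simp only [normalPart_smul, normalPart_add, C.left.normalPart_Y hz, C.left.normalPart_Yz hz,
    smul_zero, zero_add] at e2
  have e3 := (eq_inv_smul_iff₀ (C.deriv_ne z hz)).2 e2
  rw [kappa, C.normalPart_eq hz, e3, kappa, smul_smul, smul_smul]
  congr 1; ring

/-- Only r² = |h'|² is given, as the sign of r is free, so this square is differentiated. The
holomorphic factor h' contributes nothing to ∂_z̄. -/
theorem wirt_r (C : IsCoordChange U Y U' Y' h r) (hz : z ∈ U) :
    wirt Complex.I (fun w => (r w : ℂ)) z =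
      (r z : ℂ) * conj (deriv (deriv h) z * (deriv h z)⁻¹ / 2) := by
  have hr := C.contDiffAt_r hz
  have hφ := contDiffAt_of_holomorphic C.left.isOpen C.differentiableOn_deriv hz
  have dφ := C.differentiableOn_deriv.differentiableAt (C.left.isOpen.mem_nhds hz)
  have e : wirt Complex.I (fun w => (r w : ℂ) * (r w : ℂ)) z =
      wirt Complex.I (fun w => deriv h w * conj (deriv h w)) z :=
    wirt_congr_on C.left.isOpen (fun w hw => by rw [← C.sq w hw]; ring) hz
  rw [wirt_mul (diffAt hr) (diffAt hr), wirt_mul (diffAt hφ) (diffAt (contDiffAt_conj hφ)),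
    ← dzbar_eq_wirt (deriv h), dzbar_of_differentiableAt dφ, ← dzbar_eq_wirt (fun w => conj _),
    dzbar_conj (diffAt hφ), dz_of_differentiableAt dφ] at e
  have h1 := C.conj_ne hz
  have h2 := C.r_ne hz
  have h3 := C.sq z hz
  rw [map_div₀, map_mul, map_inv₀, Complex.conj_ofNat]
  apply mul_left_cancel₀ (mul_ne_zero two_ne_zero h2)
  have h4 : 2 * (r z : ℂ) * wirt Complex.I (fun w => (r w : ℂ)) z =
      deriv h z * conj (deriv (deriv h) z) := by linear_combination e
  rw [h4]
  field_simp
  linear_combination (-conj (deriv (deriv h) z)) * h3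

theorem contDiffAt_factor (C : IsCoordChange U Y U' Y' h r) (hz : z ∈ U) :
    ContDiffAt ℝ ∞ (fun w => (r w : ℂ) * (deriv h w)⁻¹ ^ 2) z :=
  (C.contDiffAt_r hz).mul
    ((contDiffAt_of_holomorphic C.left.isOpen C.differentiableOn_inv hz).pow 2)

theorem wirt_factor (C : IsCoordChange U Y U' Y' h r) (hz : z ∈ U) :
    wirt Complex.I (fun w => (r w : ℂ) * (deriv h w)⁻¹ ^ 2) z =
      ((r z : ℂ) * (deriv h z)⁻¹ ^ 2) * conj (deriv (deriv h) z * (deriv h z)⁻¹ / 2) := by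
  have hi := (contDiffAt_of_holomorphic C.left.isOpen C.differentiableOn_inv hz).pow 2
  have e : wirt Complex.I (fun w => (deriv h w)⁻¹ ^ 2) z = 0 :=
    dzbar_of_differentiableAt ((C.differentiableOn_inv.pow 2).differentiableAt
      (C.left.isOpen.mem_nhds hz))
  rw [wirt_mul (diffAt (C.contDiffAt_r hz)) (diffAt hi), e, C.wirt_r hz]; ring

/-- The scale factor of κ is holomorphic apart from r, so its logarithmic z̄-derivative is that of
r. It produces the additional multiple of κ, a shear that determinants in κ and D_z̄ κ do not see.
-/
theorem DzbarKappa_eq (C : IsCoordChange U Y U' Y' h r) (hz : z ∈ U) :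
    DzbarKappa Y' (h z) = (conj (deriv h z)⁻¹ * ((r z : ℂ) * (deriv h z)⁻¹ ^ 2)) •
      (conj (deriv (deriv h) z * (deriv h z)⁻¹ / 2) • kappa Y z + DzbarKappa Y z) := by
  have e := C.normalD_pos hz (contDiffAt_kappa (C.smooth' hz)) (fun w hw => C.kappa_eq hw)
  rw [IsIsothermal.normalD_smul (C.contDiffAt_factor hz) (contDiffAt_kappa (C.left.smooth z hz))
    (C.left.isNormal_kappa hz), C.wirt_factor hz, ← Willmore.DzbarKappa_eq,
    ← Willmore.DzbarKappa_eq] at e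
  rw [(eq_inv_smul_iff₀ (C.conj_ne hz)).2 e, map_inv₀]
  module

theorem factor_sq (C : IsCoordChange U Y U' Y' h r) (hz : z ∈ U) :
    ((r z : ℂ) * (deriv h z)⁻¹ ^ 2) ^ 2 = conj (deriv h z) * (deriv h z)⁻¹ ^ 3 := by
  have h1 := C.deriv_ne z hz
  rw [mul_pow, C.sq z hz]; field_simp

/-- The shear by κ drops out of the Gram determinant. With f = r h'⁻², the remaining factor is f⁴
times the conjugate of h'⁻², and f² = h̄' h'⁻³ turns it into h'⁻⁶. -/
theorem Theta_eq (C : IsCoordChange U Y U' Y' h r) (hz : z ∈ U) :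
    Theta Y z = Theta Y' (h z) * deriv h z ^ 6 := by
  have h1 := C.deriv_ne z hz
  have h2 := C.conj_ne hz
  have hf := C.factor_sq hz
  rw [Theta, Theta, C.kappa_eq hz, C.DzbarKappa_eq hz]
  simp only [lor_smul_left, lor_smul_right, lor_add_left, lor_add_right,
    lor_comm (kappa Y z) (DzbarKappa Y z)]
  generalize (r z : ℂ) * (deriv h z)⁻¹ ^ 2 = f at hf ⊢
  have hf4 : f ^ 4 = (conj (deriv h z) * (deriv h z)⁻¹ ^ 3) ^ 2 := by rw [← hf]; ring
  have hc : conj (deriv h z)⁻¹ = (conj (deriv h z))⁻¹ := map_inv₀ _ _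
  have hf5 : (conj (deriv h z)⁻¹) ^ 2 * f ^ 4 * deriv h z ^ 6 = 1 := by
    rw [hf4, hc]; field_simp
  linear_combination (-(lor (DzbarKappa Y z) (kappa Y z) ^ 2 -
    lor (kappa Y z) (kappa Y z) * lor (DzbarKappa Y z) (DzbarKappa Y z))) * hf5

/-- The shear coefficient is antiholomorphic, so D_z passes through it. Both the shear and the
z-derivative of the scale factor contribute equally to ⟨D_z D_z̄ κ, κ⟩ and ⟨D_z̄ κ, D_z κ⟩, and
cancel in their difference. The scale factors of the surviving terms are h'⁻⁴. -/
theorem quartic_eq (C : IsCoordChange U Y U' Y' h r) (hz : z ∈ U) :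
    quartic Y z = quartic Y' (h z) * deriv h z ^ 4 := by
  have h1 := C.deriv_ne z hz
  have h2 := C.conj_ne hz
  have hY := C.left.smooth z hz
  have hk := contDiffAt_kappa hY
  have hD := contDiffAt_DzbarKappa hY
  have nk := C.left.isNormal_kappa hz
  have nD := C.left.isNormal_DzbarKappa hz
  have e1 := C.normalD_neg hz (contDiffAt_kappa (C.smooth' hz)) (fun w hw => C.kappa_eq hw)
  rw [IsIsothermal.normalD_smul (C.contDiffAt_factor hz) hk nk] at e1
  have e2 := C.normalD_neg hz (contDiffAt_DzbarKappa (C.smooth' hz))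
    (fun w hw => C.DzbarKappa_eq hw)
  have dg : DifferentiableOn ℂ (fun w => deriv (deriv h) w * (deriv h w)⁻¹ / 2) U :=
    ((C.differentiableOn_deriv.deriv C.left.isOpen).mul C.differentiableOn_inv).div_const 2
  have sg := contDiffAt_of_holomorphic C.left.isOpen dg hz
  have si := contDiffAt_of_holomorphic C.left.isOpen C.differentiableOn_inv hz
  have wg : wirt (-Complex.I) (fun w => conj (deriv (deriv h) w * (deriv h w)⁻¹ / 2)) z = 0 := by
    rw [← dz_eq_wirt, dz_conj (diffAt sg),
      dzbar_of_differentiableAt (dg.differentiableAt (C.left.isOpen.mem_nhds hz)), map_zero]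
  have wi : wirt (-Complex.I) (fun w => conj (deriv h w)⁻¹) z = 0 := by
    rw [← dz_eq_wirt, dz_conj (diffAt si), dzbar_eq_wirt, C.wirt_inv hz, map_zero]
  have t1 := contDiffAt_fun_smul (contDiffAt_conj sg) hk
  have sf := C.contDiffAt_factor hz
  have sm : ContDiffAt ℝ ∞ (fun w => conj (deriv h w)⁻¹ * ((r w : ℂ) * (deriv h w)⁻¹ ^ 2)) z :=
    (contDiffAt_conj si).mul sf
  rw [IsIsothermal.normalD_smul sm (contDiffAt_fun_add t1 hD) ((nk.smul _).add nD),
    wirt_mul (diffAt (contDiffAt_conj si)) (diffAt sf), wi] at e2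
  have e3 : normalD (-Complex.I) Y (fun w => conj (deriv (deriv h) w * (deriv h w)⁻¹ / 2) •
      kappa Y w + DzbarKappa Y w) z =
      conj (deriv (deriv h) z * (deriv h z)⁻¹ / 2) • normalD (-Complex.I) Y (kappa Y) z +
        normalD (-Complex.I) Y (DzbarKappa Y) z := by
    have := IsIsothermal.normalD_smul (c := -Complex.I) (contDiffAt_conj sg) hk nk
    rw [wg, zero_smul, zero_add] at this
    rw [← this, normalD, wirt_add (diffAt t1) (diffAt hD), normalPart_add, normalD, normalD]
  rw [e3] at e2
  have hf := C.factor_sq hz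
  have hff : ((r z : ℂ) * (deriv h z)⁻¹ ^ 2) * conj ((r z : ℂ) * (deriv h z)⁻¹ ^ 2) *
      (deriv h z * conj (deriv h z)) = 1 := by
    simp only [map_mul, map_pow, map_inv₀, Complex.conj_ofReal]
    have := C.sq z hz
    field_simp
    linear_combination this
  rw [quartic, quartic, (eq_inv_smul_iff₀ h1).2 e1, (eq_inv_smul_iff₀ h1).2 e2, C.kappa_eq hz,
    C.DzbarKappa_eq hz]
  simp only [conjVec_smul, lor_smul_left, lor_smul_right, lor_add_left, lor_add_right,
    lor_comm (normalD (-Complex.I) Y (kappa Y) z) (kappa Y z)]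
  generalize (r z : ℂ) * (deriv h z)⁻¹ ^ 2 = f at hf hff ⊢
  have hc : conj (deriv h z)⁻¹ = (conj (deriv h z))⁻¹ := map_inv₀ _ _
  have hf5 : (deriv h z)⁻¹ * conj (deriv h z)⁻¹ * f ^ 2 * deriv h z ^ 4 = 1 := by
    rw [hf, hc]; field_simp
  have hf6 : f ^ 2 * (f * conj f) * deriv h z ^ 4 = 1 := by
    rw [← hf5, hc]
    field_simp
    linear_combination f ^ 2 * hff
  linear_combination (2 * (lor (normalD (-Complex.I) Y (DzbarKappa Y) z) (kappa Y z) -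
    lor (DzbarKappa Y z) (normalD (-Complex.I) Y (kappa Y) z))) * hf5 +
    (2 * (lor (kappa Y z) (kappa Y z) * lor (kappa Y z) (conjVec (kappa Y z)))) * hf6

end IsCoordChange

end Change

/-! ### First variation of the Willmore density -/

section Jets

/-- The metric of a first jet. -/
def jetMetric (p : Fin 2 → Fin 6 → ℝ) : Matrix (Fin 2) (Fin 2) ℝ :=
  Matrix.of fun i j => lor (p i) (p j)

/-- The trace-free part of a second jet. -/
def jetTracefree (p : Fin 2 → Fin 6 → ℝ) (q : Fin 2 → Fin 2 → Fin 6 → ℝ) (i j : Fin 2) :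
    Fin 6 → ℝ :=
  q i j - (jetMetric p i j / 2) • ∑ k, ∑ l, (jetMetric p)⁻¹ k l • q k l

/-- The trace-free second fundamental form of a second jet. -/
def jetSFF (p : Fin 2 → Fin 6 → ℝ) (q : Fin 2 → Fin 2 → Fin 6 → ℝ) (i j : Fin 2) : Fin 6 → ℝ :=
  jetTracefree p q i j -
    ∑ m, ∑ n, ((jetMetric p)⁻¹ m n * lor (jetTracefree p q i j) (p m)) • p n

/-- The Willmore density of a second jet. -/
def jetDensity (p : Fin 2 → Fin 6 → ℝ) (q : Fin 2 → Fin 2 → Fin 6 → ℝ) : ℝ :=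
  (1 / 8) * (∑ i, ∑ j, ∑ k, ∑ l, (jetMetric p)⁻¹ i k * (jetMetric p)⁻¹ j l *
    lor (jetSFF p q i j) (jetSFF p q k l)) * √(jetMetric p).det

theorem willmoreDensity_eq_jetDensity (Y : ℂ → Fin 6 → ℝ) (z : ℂ) :
    willmoreDensity Y z = jetDensity (fun i => pd i Y z) (fun i j => pd i (pd j Y) z) := rfl

/-! ### Smooth dependence of the Willmore density on the 2-jet. -/

section Smooth

variable {E : Type*} [NormedAddCommGroup E] [NormedSpace ℝ E] {x : E}

theorem contDiffAt_lor_real {F G : E → Fin 6 → ℝ} (hF : ContDiffAt ℝ ∞ F x)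
    (hG : ContDiffAt ℝ ∞ G x) : ContDiffAt ℝ ∞ (fun w => lor (F w) (G w)) x := by
  rw [contDiffAt_pi] at hF hG
  unfold lor
  exact ((((((hF 0).mul (hG 0)).add ((hF 1).mul (hG 1))).add ((hF 2).mul (hG 2))).add
    ((hF 3).mul (hG 3))).sub ((hF 4).mul (hG 4))).sub ((hF 5).mul (hG 5))

theorem inv_fin_two (M : Matrix (Fin 2) (Fin 2) ℝ) (i j : Fin 2) :
    M⁻¹ i j = M.det⁻¹ * (!![M 1 1, -M 0 1; -M 1 0, M 0 0]) i j := by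
  rw [Matrix.inv_def, Ring.inverse_eq_inv, Matrix.adjugate_fin_two, Matrix.smul_apply, smul_eq_mul]

variable {p : E → Fin 2 → Fin 6 → ℝ} {q : E → Fin 2 → Fin 2 → Fin 6 → ℝ}

theorem contDiffAt_jetMetric (hp : ∀ i, ContDiffAt ℝ ∞ (fun w => p w i) x) (i j : Fin 2) :
    ContDiffAt ℝ ∞ (fun w => jetMetric (p w) i j) x :=
  contDiffAt_lor_real (hp i) (hp j)

theorem contDiffAt_jetMetric_det (hp : ∀ i, ContDiffAt ℝ ∞ (fun w => p w i) x) :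
    ContDiffAt ℝ ∞ (fun w => (jetMetric (p w)).det) x := by
  have h := contDiffAt_jetMetric hp
  simp only [Matrix.det_fin_two]
  exact ((h 0 0).mul (h 1 1)).sub ((h 0 1).mul (h 1 0))

theorem contDiffAt_jetMetric_inv (hp : ∀ i, ContDiffAt ℝ ∞ (fun w => p w i) x)
    (hd : (jetMetric (p x)).det ≠ 0) (i j : Fin 2) :
    ContDiffAt ℝ ∞ (fun w => (jetMetric (p w))⁻¹ i j) x := by
  have h := contDiffAt_jetMetric hp
  simp only [inv_fin_two]
  refine ((contDiffAt_jetMetric_det hp).inv hd).mul ?_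
  fin_cases i <;> fin_cases j
  · exact h 1 1
  · exact (h 0 1).neg
  · exact (h 1 0).neg
  · exact h 0 0

theorem contDiffAt_jetDensity (hp : ∀ i, ContDiffAt ℝ ∞ (fun w => p w i) x)
    (hq : ∀ i j, ContDiffAt ℝ ∞ (fun w => q w i j) x) (hd : (jetMetric (p x)).det ≠ 0) :
    ContDiffAt ℝ ∞ (fun w => jetDensity (p w) (q w)) x := by
  have hg := contDiffAt_jetMetric hp
  have hi := contDiffAt_jetMetric_inv hp hd
  have hT : ∀ i j, ContDiffAt ℝ ∞ (fun w => jetTracefree (p w) (q w) i j) x := fun i j =>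
    (hq i j).sub (((hg i j).div_const 2).smul (ContDiffAt.sum fun k _ => ContDiffAt.sum fun l _ =>
      (hi k l).smul (hq k l)))
  have hS : ∀ i j, ContDiffAt ℝ ∞ (fun w => jetSFF (p w) (q w) i j) x := fun i j =>
    (hT i j).sub (ContDiffAt.sum fun m _ => ContDiffAt.sum fun n _ =>
      ((hi m n).mul (contDiffAt_lor_real (hT i j) (hp m))).smul (hp n))
  unfold jetDensity
  exact (contDiffAt_const.mul (ContDiffAt.sum fun i _ => ContDiffAt.sum fun j _ =>
    ContDiffAt.sum fun k _ => ContDiffAt.sum fun l _ =>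
      ((hi i k).mul (hi j l)).mul (contDiffAt_lor_real (hS i j) (hS k l)))).mul
    ((contDiffAt_jetMetric_det hp).sqrt hd)

end Smooth

/-! ### Derivative of the density along a curve of 2-jets. -/

section Derivative

theorem HasDerivAt.lor {F G : ℝ → Fin 6 → ℝ} {F' G' : Fin 6 → ℝ} {t : ℝ} (hF : HasDerivAt F F' t)
    (hG : HasDerivAt G G' t) :
    HasDerivAt (fun s => lor (F s) (G s)) (lor F' (G t) + lor (F t) G') t := by
  rw [hasDerivAt_pi] at hF hG
  have h := fun i => (hF i).mul (hG i)
  have := (((((h 0).add (h 1)).add (h 2)).add (h 3)).sub (h 4)).sub (h 5)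
  unfold Willmore.lor
  convert! this using 1
  ring

variable {p : ℝ → Fin 2 → Fin 6 → ℝ} {q : ℝ → Fin 2 → Fin 2 → Fin 6 → ℝ}
  {p' : Fin 2 → Fin 6 → ℝ} {q' : Fin 2 → Fin 2 → Fin 6 → ℝ}

/-- The derivative of the metric along a curve of jets. -/
def jetMetricDeriv (p p' : Fin 2 → Fin 6 → ℝ) (i j : Fin 2) : ℝ :=
  lor (p' i) (p j) + lor (p i) (p' j)

theorem hasDerivAt_jetMetric (hp : ∀ i, HasDerivAt (fun t => p t i) (p' i) 0) (i j : Fin 2) :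
    HasDerivAt (fun t => jetMetric (p t) i j) (jetMetricDeriv (p 0) p' i j) 0 :=
  HasDerivAt.lor (hp i) (hp j)

theorem hasDerivAt_jetMetric_det (hp : ∀ i, HasDerivAt (fun t => p t i) (p' i) 0)
    (h1 : jetMetric (p 0) = 1) :
    HasDerivAt (fun t => (jetMetric (p t)).det)
      (jetMetricDeriv (p 0) p' 0 0 + jetMetricDeriv (p 0) p' 1 1) 0 := by
  have h := hasDerivAt_jetMetric hp
  simp only [Matrix.det_fin_two]
  have := ((h 0 0).mul (h 1 1)).sub ((h 0 1).mul (h 1 0))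
  simp only [h1] at this
  convert! this using 1
  simp

theorem hasDerivAt_jetMetric_inv (hp : ∀ i, HasDerivAt (fun t => p t i) (p' i) 0)
    (h1 : jetMetric (p 0) = 1) (i j : Fin 2) :
    HasDerivAt (fun t => (jetMetric (p t))⁻¹ i j) (-jetMetricDeriv (p 0) p' i j) 0 := by
  have h := hasDerivAt_jetMetric hp
  have hd := (hasDerivAt_jetMetric_det hp h1).inv (by simp [h1])
  simp only [inv_fin_two]
  fin_cases i <;> fin_cases j
  · have := hd.mul (h 1 1)
    simp only [h1] at this
    convert! this using 1
    simp [h1]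
  · have := hd.mul (h 0 1).neg
    simp only [h1] at this
    convert! this using 1
    simp [h1]
  · have := hd.mul (h 1 0).neg
    simp only [h1] at this
    convert! this using 1
    simp [h1]
  · have := hd.mul (h 0 0)
    simp only [h1] at this
    convert! this using 1
    simp [h1]

/-- First variation of the Willmore density at an isothermal jet without tangential second
derivatives, in directions that do not change the area element. -/
theorem hasDerivAt_jetDensity (hp : ∀ i, HasDerivAt (fun t => p t i) (p' i) 0)
    (hq : ∀ i j, HasDerivAt (fun t => q t i j) (q' i j) 0) (h1 : jetMetric (p 0) = 1)
    (hqp : ∀ i j k, lor (q 0 i j) (p 0 k) = 0) (hsym : q 0 0 1 = q 0 1 0)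
    (htr : jetMetricDeriv (p 0) p' 0 0 + jetMetricDeriv (p 0) p' 1 1 = 0) :
    HasDerivAt (fun t => jetDensity (p t) (q t))
      ((1 / 4) * ∑ i, ∑ j, (lor (jetTracefree (p 0) (q 0) i j) (q' i j) -
        jetMetricDeriv (p 0) p' i j / 2 *
          lor (jetTracefree (p 0) (q 0) i j) (q 0 0 0 + q 0 1 1))) 0 := by
  have hg := hasDerivAt_jetMetric hp
  have hi := hasDerivAt_jetMetric_inv hp h1
  have hd := hasDerivAt_jetMetric_det hp h1
  rw [htr] at hd
  have hs := hd.sqrt (by simp [h1])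
  set g' := jetMetricDeriv (p 0) p' with hg'
  have g'sym : g' 1 0 = g' 0 1 := by
    simp only [hg', jetMetricDeriv, lor_comm (p' 1), lor_comm (p 0 1)]; ring
  have hT : ∀ i j, HasDerivAt (fun t => jetTracefree (p t) (q t) i j)
      (q' i j - ((g' i j / 2) • (q 0 0 0 + q 0 1 1) + ((1 : Matrix (Fin 2) (Fin 2) ℝ) i j / 2) •
        (∑ k, ∑ l, (-g' k l • q 0 k l) + (q' 0 0 + q' 1 1)))) 0 := by
    intro i j
    have := (hq i j).sub (((hg i j).div_const 2).smul
      (HasDerivAt.fun_sum (u := Finset.univ) fun k _ => HasDerivAt.fun_sum (u := Finset.univ) fun l _ =>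
        (hi k l).smul (hq k l)))
    simp only [h1, inv_one] at this
    unfold jetTracefree
    convert! this using 1
    congr 1
    simp only [Fin.sum_univ_two, Matrix.one_apply_eq, ne_eq, zero_ne_one, one_ne_zero,
      not_false_eq_true, Matrix.one_apply_ne, one_smul, zero_smul, Pi.smul_apply', zero_add, h1, inv_one]
    module
  have hT0 : ∀ i j, jetTracefree (p 0) (q 0) i j =
      q 0 i j - ((1 : Matrix (Fin 2) (Fin 2) ℝ) i j / 2) • (q 0 0 0 + q 0 1 1) := by
    intro i j
    simp only [jetTracefree, h1, inv_one, Fin.sum_univ_two]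
    simp
  have hTp : ∀ i j k, lor (jetTracefree (p 0) (q 0) i j) (p 0 k) = 0 := by
    intro i j k
    rw [hT0, lor_sub_left, lor_smul_left, lor_add_left, hqp, hqp, hqp]; ring
  have hS0 : ∀ i j, jetSFF (p 0) (q 0) i j = jetTracefree (p 0) (q 0) i j := by
    intro i j
    simp [jetSFF, hTp]
  -- The tangential coefficients a need no explicit form: the trace-free second derivatives at t = 0
  -- are orthogonal to the tangent vectors, so these terms drop out of the density.
  have hS : ∀ i j, ∃ a : Fin 2 → ℝ, HasDerivAt (fun t => jetSFF (p t) (q t) i j)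
      (q' i j - ((g' i j / 2) • (q 0 0 0 + q 0 1 1) + ((1 : Matrix (Fin 2) (Fin 2) ℝ) i j / 2) •
        (∑ k, ∑ l, (-g' k l • q 0 k l) + (q' 0 0 + q' 1 1))) - ∑ n, a n • p 0 n) 0 := by
    intro i j
    have := (hT i j).sub (HasDerivAt.fun_sum (u := Finset.univ) fun m _ =>
      HasDerivAt.fun_sum (u := Finset.univ) fun n _ =>
        ((hi m n).mul (HasDerivAt.lor (hT i j) (hp m))).smul (hp n))
    simp only [hTp, h1, inv_one, mul_zero, zero_add, Pi.mul_apply, zero_smul] at this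
    refine ⟨fun n => ∑ m, (1 : Matrix (Fin 2) (Fin 2) ℝ) m n * (lor (q' i j - ((g' i j / 2) •
        (q 0 0 0 + q 0 1 1) + ((1 : Matrix (Fin 2) (Fin 2) ℝ) i j / 2) •
        (∑ k, ∑ l, (-g' k l • q 0 k l) + (q' 0 0 + q' 1 1)))) (p 0 m) +
        lor (jetTracefree (p 0) (q 0) i j) (p' m)), ?_⟩
    unfold jetSFF
    convert! this using 1
    congr 1
    simp only [Finset.sum_smul]
    rw [Finset.sum_comm]
  choose a hS using hS
  have main := ((HasDerivAt.fun_sum (u := Finset.univ) fun i _ =>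
    HasDerivAt.fun_sum (u := Finset.univ) fun j _ =>
    HasDerivAt.fun_sum (u := Finset.univ) fun k _ =>
    HasDerivAt.fun_sum (u := Finset.univ) fun l _ =>
      ((hi i k).mul (hi j l)).mul (HasDerivAt.lor (hS i j) (hS k l))).const_mul (1 / 8)).mul hs
  unfold jetDensity
  convert! main using 1
  -- For a symmetric trace-free T in dimension two, Σ_j ⟨T_ij, T_kj⟩ is a multiple of δ_ik. As the
  -- metric variation is trace-free too, varying the inverse metric contributes nothing; likewise
  -- the terms proportional to δ_ij pair to zero with T.
  have hT11 : jetTracefree (p 0) (q 0) 1 1 = -jetTracefree (p 0) (q 0) 0 0 := by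
    simp only [hT0, Matrix.one_apply_eq]; module
  have hT10 : jetTracefree (p 0) (q 0) 1 0 = jetTracefree (p 0) (q 0) 0 1 := by
    simp only [hT0, hsym]; simp
  have hg11 : g' 1 1 = -g' 0 0 := by linear_combination htr
  have c1 : ∀ i j k l, lor (q' i j) (jetTracefree (p 0) (q 0) k l) =
      lor (jetTracefree (p 0) (q 0) k l) (q' i j) := fun _ _ _ _ => lor_comm _ _
  have c2 : ∀ i j k l, lor (q 0 i j) (jetTracefree (p 0) (q 0) k l) =
      lor (jetTracefree (p 0) (q 0) k l) (q 0 i j) := fun _ _ _ _ => lor_comm _ _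
  have c3 : ∀ i k l, lor (p 0 i) (jetTracefree (p 0) (q 0) k l) = 0 := fun i k l => by
    rw [lor_comm, hTp]
  have c4 := lor_comm (jetTracefree (p 0) (q 0) 0 1) (jetTracefree (p 0) (q 0) 0 0)
  simp only [Fin.sum_univ_two, hS0, h1, inv_one, Pi.mul_apply, Matrix.det_one, Real.sqrt_one,
    Matrix.one_apply_eq, ne_eq, zero_ne_one, one_ne_zero, not_false_eq_true, Matrix.one_apply_ne,
    hT11, hT10, g'sym, hg11, lor_add_left, lor_add_right, lor_sub_left, lor_sub_right,
    lor_smul_left, lor_smul_right, lor_neg_left, lor_neg_right, c1, c2, c3, c4,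
    hTp]
  ring

end Derivative

end Jets

/-! ### Real partial derivatives in terms of Wirtinger derivatives. -/

section RealJets

variable {U : Set ℂ} {Y ξ η : ℂ → Fin 6 → ℝ} {z : ℂ}

theorem Yzbarzbar_eq (Y : ℂ → Fin 6 → ℝ) : Yzbarzbar Y = wirt Complex.I (Yzbar Y) := rfl

theorem cplx_add (v w : Fin 6 → ℝ) : cplx (v + w) = cplx v + cplx w := by
  funext i; simp [cplx]

theorem cplx_sub (v w : Fin 6 → ℝ) : cplx (v - w) = cplx v - cplx w := by
  funext i; simp [cplx]

theorem cplx_smul (c : ℝ) (v : Fin 6 → ℝ) : cplx (c • v) = (c : ℂ) • cplx v := by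
  funext i; simp [cplx]

theorem fderiv_cplx (hY : ContDiffAt ℝ ∞ Y z) (v : ℂ) :
    fderiv ℝ (fun w => cplx (Y w)) z v = cplx (fderiv ℝ Y z v) := by
  have h1 := (diffAt hY).hasFDerivAt
  funext i
  have h2 := (hasFDerivAt_pi'.1 (diffAt (contDiffAt_cplx hY)).hasFDerivAt i).fderiv
  have h3 := (Complex.ofRealCLM.hasFDerivAt.comp z (hasFDerivAt_pi'.1 h1 i)).fderiv
  have h4 := congrArg (fun L : ℂ →L[ℝ] ℂ => L v) (h2.symm.trans h3)
  exact h4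

theorem cplx_pd_zero (hY : ContDiffAt ℝ ∞ Y z) :
    cplx (pd 0 Y z) = wirt (-Complex.I) (fun w => cplx (Y w)) z +
      wirt Complex.I (fun w => cplx (Y w)) z := by
  simp only [wirt, fderiv_cplx hY, pd, Matrix.cons_val_zero]
  module

theorem cplx_pd_one (hY : ContDiffAt ℝ ∞ Y z) :
    cplx (pd 1 Y z) = Complex.I • (wirt (-Complex.I) (fun w => cplx (Y w)) z -
      wirt Complex.I (fun w => cplx (Y w)) z) := by
  have e : pd 1 Y z = fderiv ℝ Y z Complex.I := rfl
  simp only [wirt, fderiv_cplx hY, e]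
  match_scalars
  · linear_combination Complex.I_mul_I
  · ring

theorem contDiffAt_pd (i : Fin 2) (hY : ContDiffAt ℝ ∞ Y z) : ContDiffAt ℝ ∞ (pd i Y) z :=
  (hY.fderiv_right (m := ∞) (by simp)).clm_apply contDiffAt_const

theorem pd_congr_on (hU : IsOpen U) (h : ∀ w ∈ U, Y w = ξ w) (hz : z ∈ U) (i : Fin 2) :
    pd i Y z = pd i ξ z := by
  simp only [pd, (Filter.eventuallyEq_of_mem (hU.mem_nhds hz) h).fderiv_eq]

theorem pd_variation (t : ℝ) (i : Fin 2) (hY : ContDiffAt ℝ ∞ Y z) (hξ : ContDiffAt ℝ ∞ ξ z)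
    (hη : ContDiffAt ℝ ∞ η z) :
    pd i (fun w => Y w + t • ξ w + t ^ 2 • η w) z =
      pd i Y z + t • pd i ξ z + t ^ 2 • pd i η z := by
  have h := (((diffAt hY).hasFDerivAt.add ((diffAt hξ).hasFDerivAt.const_smul t)).add
    ((diffAt hη).hasFDerivAt.const_smul (t ^ 2))).fderiv
  have h' : fderiv ℝ (fun w => Y w + t • ξ w + t ^ 2 • η w) z = _ := h
  simp only [pd, h']
  rfl

theorem cplx_pd_zero_zero (hU : IsOpen U) (hY : ∀ w ∈ U, ContDiffAt ℝ ∞ Y w) (hz : z ∈ U) :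
    cplx (pd 0 (pd 0 Y) z) = wirt (-Complex.I) (wirt (-Complex.I) (fun w => cplx (Y w))) z +
      (2 : ℂ) • wirt Complex.I (wirt (-Complex.I) (fun w => cplx (Y w))) z +
      wirt Complex.I (wirt Complex.I (fun w => cplx (Y w))) z := by
  have hX := contDiffAt_cplx (hY z hz)
  have h1 := contDiffAt_wirt (c := -Complex.I) hX
  have h2 := contDiffAt_wirt (c := Complex.I) hX
  rw [cplx_pd_zero (contDiffAt_pd 0 (hY z hz)),
    wirt_congr_on hU (fun w hw => cplx_pd_zero (hY w hw)) hz,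
    wirt_congr_on hU (fun w hw => cplx_pd_zero (hY w hw)) hz, wirt_add (diffAt h1) (diffAt h2),
    wirt_add (diffAt h1) (diffAt h2), wirt_comm (a := -Complex.I) (b := Complex.I) hX]
  module

theorem cplx_pd_zero_one (hU : IsOpen U) (hY : ∀ w ∈ U, ContDiffAt ℝ ∞ Y w) (hz : z ∈ U) :
    cplx (pd 0 (pd 1 Y) z) = Complex.I •
      (wirt (-Complex.I) (wirt (-Complex.I) (fun w => cplx (Y w))) z -
      wirt Complex.I (wirt Complex.I (fun w => cplx (Y w))) z) := by
  have hX := contDiffAt_cplx (hY z hz)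
  have h1 := contDiffAt_wirt (c := -Complex.I) hX
  have h2 := contDiffAt_wirt (c := Complex.I) hX
  rw [cplx_pd_zero (contDiffAt_pd 1 (hY z hz)),
    wirt_congr_on hU (fun w hw => cplx_pd_one (hY w hw)) hz,
    wirt_congr_on hU (fun w hw => cplx_pd_one (hY w hw)) hz,
    wirt_const_smul ((diffAt h1).fun_sub (diffAt h2)),
    wirt_const_smul ((diffAt h1).fun_sub (diffAt h2)), wirt_sub (diffAt h1) (diffAt h2),
    wirt_sub (diffAt h1) (diffAt h2), wirt_comm (a := -Complex.I) (b := Complex.I) hX]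
  module

theorem cplx_pd_one_zero (hU : IsOpen U) (hY : ∀ w ∈ U, ContDiffAt ℝ ∞ Y w) (hz : z ∈ U) :
    cplx (pd 1 (pd 0 Y) z) = Complex.I •
      (wirt (-Complex.I) (wirt (-Complex.I) (fun w => cplx (Y w))) z -
      wirt Complex.I (wirt Complex.I (fun w => cplx (Y w))) z) := by
  have hX := contDiffAt_cplx (hY z hz)
  have h1 := contDiffAt_wirt (c := -Complex.I) hX
  have h2 := contDiffAt_wirt (c := Complex.I) hX
  rw [cplx_pd_one (contDiffAt_pd 0 (hY z hz)),
    wirt_congr_on hU (fun w hw => cplx_pd_zero (hY w hw)) hz,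
    wirt_congr_on hU (fun w hw => cplx_pd_zero (hY w hw)) hz, wirt_add (diffAt h1) (diffAt h2),
    wirt_add (diffAt h1) (diffAt h2), wirt_comm (a := -Complex.I) (b := Complex.I) hX]
  module

theorem cplx_pd_one_one (hU : IsOpen U) (hY : ∀ w ∈ U, ContDiffAt ℝ ∞ Y w) (hz : z ∈ U) :
    cplx (pd 1 (pd 1 Y) z) = -(wirt (-Complex.I) (wirt (-Complex.I) (fun w => cplx (Y w))) z) +
      (2 : ℂ) • wirt Complex.I (wirt (-Complex.I) (fun w => cplx (Y w))) z -
      wirt Complex.I (wirt Complex.I (fun w => cplx (Y w))) z := by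
  have hX := contDiffAt_cplx (hY z hz)
  have h1 := contDiffAt_wirt (c := -Complex.I) hX
  have h2 := contDiffAt_wirt (c := Complex.I) hX
  rw [cplx_pd_one (contDiffAt_pd 1 (hY z hz)),
    wirt_congr_on hU (fun w hw => cplx_pd_one (hY w hw)) hz,
    wirt_congr_on hU (fun w hw => cplx_pd_one (hY w hw)) hz,
    wirt_const_smul ((diffAt h1).fun_sub (diffAt h2)),
    wirt_const_smul ((diffAt h1).fun_sub (diffAt h2)), wirt_sub (diffAt h1) (diffAt h2),
    wirt_sub (diffAt h1) (diffAt h2), wirt_comm (a := -Complex.I) (b := Complex.I) hX]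
  match_scalars
  · linear_combination Complex.I_mul_I
  · linear_combination (-2) * Complex.I_mul_I
  · linear_combination Complex.I_mul_I

theorem cplx_injective {v w : Fin 6 → ℝ} (h : cplx v = cplx w) : v = w := by
  funext i
  exact Complex.ofReal_injective (congrFun h i)

end RealJets

/-! ### The first variation of the Willmore functional -/

section Variation

variable {U : Set ℂ} {Y ξ η : ℂ → Fin 6 → ℝ} {z : ℂ}

/-- The first variation of the Willmore density of `Y` in the direction `ξ`. -/
def densityVariation (Y ξ : ℂ → Fin 6 → ℝ) (z : ℂ) : ℂ :=
  lor (Yzz Y z) (Yzbarzbar ξ z) + lor (Yzbarzbar Y z) (Yzz ξ z) +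
    conj (schwarzian Y z) * lor (Yzz Y z) (cplx (ξ z)) +
    schwarzian Y z * lor (Yzbarzbar Y z) (cplx (ξ z))

/-- The first jet of the variation `Y + t ξ + t² η`. -/
def variationJet (Y ξ η : ℂ → Fin 6 → ℝ) (x : ℝ × ℂ) (i : Fin 2) : Fin 6 → ℝ :=
  pd i Y x.2 + x.1 • pd i ξ x.2 + x.1 ^ 2 • pd i η x.2

/-- The second jet of the variation `Y + t ξ + t² η`. -/
def variationJetTwo (Y ξ η : ℂ → Fin 6 → ℝ) (x : ℝ × ℂ) (i j : Fin 2) : Fin 6 → ℝ :=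
  pd i (pd j Y) x.2 + x.1 • pd i (pd j ξ) x.2 + x.1 ^ 2 • pd i (pd j η) x.2

theorem willmoreDensity_variation (hU : IsOpen U) (hY : ∀ w ∈ U, ContDiffAt ℝ ∞ Y w)
    (hξ : ∀ w ∈ U, ContDiffAt ℝ ∞ ξ w) (hη : ∀ w ∈ U, ContDiffAt ℝ ∞ η w) (hz : z ∈ U) (t : ℝ) :
    willmoreDensity (fun w => Y w + t • ξ w + t ^ 2 • η w) z =
      jetDensity (variationJet Y ξ η (t, z)) (variationJetTwo Y ξ η (t, z)) := by
  rw [willmoreDensity_eq_jetDensity]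
  congr 1
  · funext i
    exact pd_variation t i (hY z hz) (hξ z hz) (hη z hz)
  · funext i j
    rw [pd_congr_on hU (fun w hw => pd_variation t j (hY w hw) (hξ w hw) (hη w hw)) hz]
    exact pd_variation t i (contDiffAt_pd j (hY z hz)) (contDiffAt_pd j (hξ z hz))
      (contDiffAt_pd j (hη z hz))

theorem IsIsothermal.jetMetric_eq (H : IsIsothermal U Y) (hz : z ∈ U) :
    jetMetric (fun i => pd i Y z) = 1 := by
  have h := H.smooth z hz
  have e0 := cplx_pd_zero h
  have e1 := cplx_pd_one h
  rw [← Yz_eq, ← Yzbar_eq] at e0 e1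
  have hr : ∀ a b : ℝ, (a : ℂ) = b → a = b := fun a b => Complex.ofReal_injective.eq_iff.1
  have c := lor_comm (Yzbar Y z) (Yz Y z)
  have k00 : lor (pd 0 Y z) (pd 0 Y z) = 1 := by
    apply hr
    rw [← lor_cplx, e0]
    simp only [lor_add_left, lor_add_right, c, H.null_z z hz, H.metric z hz, H.null_zbar hz]
    norm_num
  have k01 : lor (pd 0 Y z) (pd 1 Y z) = 0 := by
    apply hr
    rw [← lor_cplx, e0, e1]
    simp only [lor_add_left, lor_sub_right, lor_smul_right, c, H.null_z z hz, H.metric z hz,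
      H.null_zbar hz]
    norm_num
  have k11 : lor (pd 1 Y z) (pd 1 Y z) = 1 := by
    apply hr
    rw [← lor_cplx, e1]
    simp only [lor_sub_left, lor_sub_right, lor_smul_right, lor_smul_left, c, H.null_z z hz,
      H.metric z hz, H.null_zbar hz]
    push_cast
    linear_combination (-1) * Complex.I_mul_I
  ext i j
  fin_cases i <;> fin_cases j
  · exact k00
  · exact k01
  · exact (lor_comm _ _).trans k01
  · exact k11

/-- The induced metric is du² + dv², whose Christoffel symbols vanish. -/
theorem IsIsothermal.lor_pd_pd (H : IsIsothermal U Y) (hz : z ∈ U) (i j k : Fin 2) :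
    lor (pd i (pd j Y) z) (pd k Y z) = 0 := by
  have h := H.smooth z hz
  have e0 := cplx_pd_zero h
  have e1 := cplx_pd_one h
  have e00 := cplx_pd_zero_zero H.isOpen H.smooth hz
  have e01 := cplx_pd_zero_one H.isOpen H.smooth hz
  have e10 := cplx_pd_one_zero H.isOpen H.smooth hz
  have e11 := cplx_pd_one_one H.isOpen H.smooth hz
  simp only [← Yz_eq, ← Yzbar_eq, ← Yzz_eq, ← Yzbarzbar_eq, ← Yzzbar_eq] at e0 e1 e00 e01 e10 e11
  apply Complex.ofReal_injective
  rw [← lor_cplx]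
  fin_cases i <;> fin_cases j <;> fin_cases k <;>
  simp only [Fin.zero_eta, Fin.mk_one, Fin.isValue, e0, e1, e00, e01, e10, e11, lor_add_left,
    lor_sub_left, lor_neg_left, lor_smul_left, lor_add_right, lor_sub_right, lor_smul_right,
    H.lor_Yzz_Yz hz, H.lor_Yzz_Yzbar hz, H.lor_Yzzbar_Yz hz, H.lor_Yzzbar_Yzbar hz,
    H.lor_Yzbarzbar_Yz hz, H.lor_Yzbarzbar_Yzbar hz] <;> simp

/-- A normal ξ changes the metric by −2⟨ξ, Y_ij⟩. Its trace is a multiple of ⟨ξ, Y_zz̄⟩ = 0, so the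
area element is stationary and `hasDerivAt_jetDensity` applies. The t²-term plays no role at first
order. -/
theorem IsIsothermal.hasDerivAt_density (H : IsIsothermal U Y)
    (hξ : ∀ w ∈ U, ContDiffAt ℝ ∞ ξ w) (n : ∀ w ∈ U, IsNormal Y w (cplx (ξ w))) (hz : z ∈ U) :
    ∃ D : ℝ, (D : ℂ) = densityVariation Y ξ z ∧ HasDerivAt (fun t =>
      jetDensity (variationJet Y ξ η (t, z)) (variationJetTwo Y ξ η (t, z))) D 0 := by
  have h := H.smooth z hz
  have hΞ := contDiffAt_cplx (hξ z hz)
  have hder : ∀ a b c : Fin 6 → ℝ,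
      HasDerivAt (fun t : ℝ => a + t • b + t ^ 2 • c) b 0 := by
    intro a b c
    have := (((hasDerivAt_id (0 : ℝ)).smul_const b).const_add a).add
      (((hasDerivAt_id (0 : ℝ)).pow 2).smul_const c)
    convert! this using 1
    simp
  have p0 : variationJet Y ξ η (0, z) = fun i => pd i Y z := by
    funext i; simp [variationJet]
  have q0 : variationJetTwo Y ξ η (0, z) = fun i j => pd i (pd j Y) z := by
    funext i j; simp [variationJetTwo]
  have e0 := cplx_pd_zero h
  have e1 := cplx_pd_one h
  have e00 := cplx_pd_zero_zero H.isOpen H.smooth hz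
  have e01 := cplx_pd_zero_one H.isOpen H.smooth hz
  have e10 := cplx_pd_one_zero H.isOpen H.smooth hz
  have e11 := cplx_pd_one_one H.isOpen H.smooth hz
  have f0 := cplx_pd_zero (hξ z hz)
  have f1 := cplx_pd_one (hξ z hz)
  have f00 := cplx_pd_zero_zero H.isOpen hξ hz
  have f01 := cplx_pd_zero_one H.isOpen hξ hz
  have f10 := cplx_pd_one_zero H.isOpen hξ hz
  have f11 := cplx_pd_one_one H.isOpen hξ hz
  have x1 := lor_wirt_of_const (c := -Complex.I) H.isOpen (fun w hw => (n w hw).lor_Yz) hz hΞ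
    (contDiffAt_Yz h)
  have x2 := lor_wirt_of_const (c := -Complex.I) H.isOpen (fun w hw => (n w hw).lor_Yzbar) hz hΞ
    (contDiffAt_Yzbar h)
  have x3 := lor_wirt_of_const (c := Complex.I) H.isOpen (fun w hw => (n w hw).lor_Yz) hz hΞ
    (contDiffAt_Yz h)
  have x4 := lor_wirt_of_const (c := Complex.I) H.isOpen (fun w hw => (n w hw).lor_Yzbar) hz hΞ
    (contDiffAt_Yzbar h)
  have hB := IsIsothermal.lor_Yzzbar_of_isNormal (n z hz)
  rw [wirt_Yzbar h] at x2
  simp only [← Yz_eq, ← Yzbar_eq, ← Yzz_eq, ← Yzbarzbar_eq, ← Yzzbar_eq] at e0 e1 e00 e01 e10 e11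
  simp only [← Yz_eq, ← Yzbar_eq, ← Yzz_eq, ← Yzbarzbar_eq, ← Yzzbar_eq] at f0 f1 f00 f01 f10 f11
  simp only [← Yz_eq, ← Yzbar_eq, ← Yzz_eq, ← Yzbarzbar_eq, ← Yzzbar_eq] at x1 x2 x3 x4
  rw [hB, add_zero] at x2 x3
  rw [lor_comm (cplx (ξ z))] at x1 x4
  replace x1 := eq_neg_of_add_eq_zero_left x1
  replace x4 := eq_neg_of_add_eq_zero_left x4
  have hg : ∀ i j, ((jetMetricDeriv (fun i => pd i Y z) (fun i => pd i ξ z) i j : ℝ) : ℂ) =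
      lor (cplx (pd i ξ z)) (cplx (pd j Y z)) + lor (cplx (pd j ξ z)) (cplx (pd i Y z)) := by
    intro i j
    simp only [jetMetricDeriv, lor_cplx, lor_comm (pd i Y z)]; push_cast; rfl
  have g00 := hg 0 0
  have g01 := hg 0 1
  have g10 := hg 1 0
  have g11 := hg 1 1
  simp only [f0, f1, e0, e1, lor_add_left, lor_sub_left, lor_smul_left, lor_add_right,
    lor_sub_right, lor_smul_right, x1, x2, x3, x4] at g00 g01 g10 g11
  have htr : jetMetricDeriv (fun i => pd i Y z) (fun i => pd i ξ z) 0 0 +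
      jetMetricDeriv (fun i => pd i Y z) (fun i => pd i ξ z) 1 1 = 0 := by
    apply Complex.ofReal_injective
    push_cast
    rw [g00, g11]
    linear_combination (-2 * (lor (Yzz Y z) (cplx (ξ z)) + lor (Yzbarzbar Y z) (cplx (ξ z)))) *
      Complex.I_mul_I
  have main := hasDerivAt_jetDensity (p := fun t => variationJet Y ξ η (t, z))
    (q := fun t => variationJetTwo Y ξ η (t, z)) (p' := fun i => pd i ξ z)
    (q' := fun i j => pd i (pd j ξ) z)
    (fun i => hder (pd i Y z) (pd i ξ z) (pd i η z))
    (fun i j => hder (pd i (pd j Y) z) (pd i (pd j ξ) z) (pd i (pd j η) z))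
    (by rw [p0]; exact H.jetMetric_eq hz) (by rw [p0, q0]; exact H.lor_pd_pd hz)
    (by rw [q0]; exact cplx_injective (e01.trans e10.symm)) (by rw [p0]; exact htr)
  refine ⟨_, ?_, main⟩
  rw [p0, q0, densityVariation]
  have hT0 : ∀ i j, jetTracefree (fun i => pd i Y z) (fun i j => pd i (pd j Y) z) i j =
      pd i (pd j Y) z - ((1 : Matrix (Fin 2) (Fin 2) ℝ) i j / 2) •
        (pd 0 (pd 0 Y) z + pd 1 (pd 1 Y) z) := by
    intro i j
    simp only [jetTracefree, H.jetMetric_eq hz, inv_one, Fin.sum_univ_two]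
    simp
  have hs : schwarzian Y z = 4 * lor (Yzz Y z) (Yzzbar Y z) := rfl
  have hsb : conj (schwarzian Y z) = 4 * lor (Yzbarzbar Y z) (Yzzbar Y z) := by
    rw [hs, map_mul, ← lor_conjVec, H.conjVec_Yzz hz, H.conjVec_Yzzbar hz, Complex.conj_ofNat]
  rw [hsb, hs]
  simp only [Fin.sum_univ_two, hT0, Matrix.one_apply_eq, ne_eq, zero_ne_one, one_ne_zero,
    not_false_eq_true, Matrix.one_apply_ne]
  push_cast
  simp only [g00, g01, g10, g11, ← lor_cplx, cplx_add, cplx_sub, cplx_smul, e00, e01, e10, e11,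
    f00, f01, f10, f11]
  push_cast
  simp only [lor_add_left, lor_sub_left, lor_neg_left, lor_smul_left, lor_add_right, lor_sub_right,
    lor_neg_right, lor_smul_right]
  ring_nf
  simp only [Complex.I_sq]
  ring

end Variation

/-! ### Differentiation under the integral and integration by parts. -/

section Integrals

open MeasureTheory

/-- Differentiation under the integral sign over a compact set. -/
theorem hasDerivAt_setIntegral_of_contDiffAt {G : ℝ × ℂ → ℝ} {K : Set ℂ} (hK : IsCompact K)
    {W : Set (ℝ × ℂ)} (hW : IsOpen W) (hKW : ∀ z ∈ K, ((0 : ℝ), z) ∈ W)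
    (hG : ∀ x ∈ W, ContDiffAt ℝ ∞ G x) {D : ℂ → ℝ}
    (hD : ∀ z ∈ K, HasDerivAt (fun t => G (t, z)) (D z) 0) :
    HasDerivAt (fun t => ∫ z in K, G (t, z)) (∫ z in K, D z) 0 := by
  -- Compactness of K provides one interval of t that works for all points of K, and thereby a
  -- uniform bound on the t-derivative.
  obtain ⟨u, v, hu, hv, h0u, hKv, huv⟩ := generalized_tube_lemma (isCompact_singleton (x := (0 : ℝ)))
    hK hW (by rintro ⟨t, z⟩ ⟨ht, hz⟩; obtain rfl : t = 0 := ht; exact hKW z hz)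
  obtain ⟨δ, hδ, hδu⟩ := Metric.isOpen_iff.1 hu 0 (h0u rfl)
  have hsub : ∀ t ∈ Metric.closedBall (0 : ℝ) (δ / 2), ∀ z ∈ K, (t, z) ∈ W := fun t ht z hz =>
    huv ⟨hδu (Metric.closedBall_subset_ball (by linarith) ht), hKv hz⟩
  let G' : ℝ × ℂ → ℝ := fun x => fderiv ℝ G x (1, 0)
  have hG'c : ∀ x ∈ W, ContinuousAt G' x := fun x hx =>
    (((hG x hx).fderiv_right (m := ∞) (by simp)).clm_apply contDiffAt_const).continuousAt
  have hcomp : IsCompact (Metric.closedBall (0 : ℝ) (δ / 2) ×ˢ K) :=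
    (isCompact_closedBall _ _).prod hK
  obtain ⟨C, hC⟩ := hcomp.exists_bound_of_continuousOn (f := G') (fun x hx =>
    (hG'c x (hsub x.1 hx.1 x.2 hx.2)).continuousWithinAt)
  have hder : ∀ t ∈ Metric.closedBall (0 : ℝ) (δ / 2), ∀ z ∈ K,
      HasDerivAt (fun s => G (s, z)) (G' (t, z)) t := by
    intro t ht z hz
    have h1 := ((hG _ (hsub t ht z hz)).differentiableAt (by simp)).hasFDerivAt
    have h2 : HasDerivAt (fun s : ℝ => (s, z)) ((1 : ℝ), (0 : ℂ)) t :=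
      (hasDerivAt_id t).prodMk (hasDerivAt_const t z)
    exact h1.comp_hasDerivAt t h2
  have hslice : ∀ (f : ℝ × ℂ → ℝ), (∀ x ∈ W, ContinuousAt f x) →
      ∀ t ∈ Metric.closedBall (0 : ℝ) (δ / 2), ContinuousOn (fun z => f (t, z)) K := by
    intro f hf t ht z hz
    exact ((hf _ (hsub t ht z hz)).comp (by fun_prop : ContinuousAt (fun w : ℂ => (t, w)) z)).continuousWithinAt
  have h0 : (0 : ℝ) ∈ Metric.closedBall (0 : ℝ) (δ / 2) := Metric.mem_closedBall_self (by linarith)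
  have hnhds : Metric.closedBall (0 : ℝ) (δ / 2) ∈ nhds (0 : ℝ) :=
    Metric.closedBall_mem_nhds _ (by linarith)
  have hGc : ∀ x ∈ W, ContinuousAt G x := fun x hx => (hG x hx).continuousAt
  have main := (hasDerivAt_integral_of_dominated_loc_of_deriv_le (μ := volume.restrict K)
    (F := fun t z => G (t, z)) (F' := fun t z => G' (t, z)) (bound := fun _ => C) (x₀ := (0 : ℝ))
    hnhds
    (Filter.eventually_of_mem hnhds fun t ht =>
      (hslice G hGc t ht).aestronglyMeasurable hK.measurableSet)
    ((hslice G hGc 0 h0).integrableOn_compact hK)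
    ((hslice G' hG'c 0 h0).aestronglyMeasurable hK.measurableSet)
    ((ae_restrict_iff' hK.measurableSet).2 (Filter.Eventually.of_forall fun z hz t ht =>
      hC (t, z) ⟨ht, hz⟩))
    (integrableOn_const hK.measure_lt_top.ne)
    ((ae_restrict_iff' hK.measurableSet).2 (Filter.Eventually.of_forall fun z hz t ht =>
      hder t ht z hz))).2
  have e : ∫ z in K, D z = ∫ z in K, G' (0, z) :=
    setIntegral_congr_fun hK.measurableSet fun z hz => (hD z hz).unique (hder 0 h0 z hz)
  rw [e]
  exact main

theorem integral_wirt_eq_zero {g : ℂ → ℂ} (hg : ContDiff ℝ ∞ g) (hs : HasCompactSupport g)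
    (c : ℂ) : ∫ z, wirt c g z = 0 := by
  have hd : ∀ v : ℂ, Continuous fun z => fderiv ℝ g z v := fun v =>
    (hg.continuous_fderiv (by simp)).clm_apply continuous_const
  have hds : ∀ v : ℂ, HasCompactSupport fun z => fderiv ℝ g z v := fun v =>
    (hs.fderiv (𝕜 := ℝ)).comp_left (g := fun L : ℂ →L[ℝ] ℂ => L v) (by simp)
  have hi : ∀ v : ℂ, Integrable fun z => fderiv ℝ g z v := fun v =>
    (hd v).integrable_of_hasCompactSupport (hds v)
  have key : ∀ v : ℂ, ∫ z, fderiv ℝ g z v = 0 := by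
    intro v
    -- Integration by parts against the constant 1.
    have := integral_mul_fderiv_eq_neg_fderiv_mul_of_integrable (𝕜 := ℂ) (μ := volume)
      (f := fun _ : ℂ => (1 : ℂ)) (g := g) (v := v) (by simp) (by simpa using hi v)
      (by simpa using hg.continuous.integrable_of_hasCompactSupport hs)
      (fun x _ => differentiableAt_const _) (fun x _ => (hg.differentiable (by simp)) x)
    simpa using this
  simp only [wirt, smul_eq_mul]
  rw [integral_const_mul, integral_add (hi 1) ((hi _).const_mul c), integral_const_mul, key, key]
  simp

/-- Extension by zero. It turns products of fields controlled only on U with a field supported in K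
into smooth functions on the whole plane. -/
theorem contDiff_of_support {E : Type*} [NormedAddCommGroup E] [NormedSpace ℝ E] {f : ℂ → E}
    {U K : Set ℂ} (hK : IsClosed K)
    (hKU : K ⊆ U) (h : ∀ z ∈ U, ContDiffAt ℝ ∞ f z) (h0 : ∀ z, z ∉ K → f z = 0) :
    ContDiff ℝ ∞ f := by
  rw [contDiff_iff_contDiffAt]
  intro z
  by_cases hz : z ∈ K
  · exact h z (hKU hz)
  · exact contDiffAt_const.congr_of_eventuallyEq
      (Filter.eventuallyEq_of_mem (hK.isOpen_compl.mem_nhds hz) h0)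

theorem wirt_eq_zero_of_support {E : Type*} [NormedAddCommGroup E] [NormedSpace ℂ E] {f : ℂ → E}
    {K : Set ℂ} (hK : IsClosed K) (h0 : ∀ z, z ∉ K → f z = 0) {c : ℂ} :
    ∀ z, z ∉ K → wirt c f z = 0 := by
  intro z hz
  rw [wirt_congr_on hK.isOpen_compl h0 hz, wirt_const]

/-- Integration by parts: the second order operator `∂²` is symmetric. -/
theorem integral_lor_wirt_wirt {U K : Set ℂ} {A Ξ : ℂ → Fin 6 → ℂ} (hK : IsCompact K)
    (hKU : K ⊆ U) (hA : ∀ z ∈ U, ContDiffAt ℝ ∞ A z) (hΞ : ∀ z ∈ U, ContDiffAt ℝ ∞ Ξ z)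
    (h0 : ∀ z, z ∉ K → Ξ z = 0) (c : ℂ) :
    ∫ z, lor (A z) (wirt c (wirt c Ξ) z) = ∫ z, lor (wirt c (wirt c A) z) (Ξ z) := by
  have hc := hK.isClosed
  have w0 := wirt_eq_zero_of_support (c := c) hc h0
  have ww0 := wirt_eq_zero_of_support (c := c) hc w0
  have sΞ : ContDiff ℝ ∞ Ξ := contDiff_of_support hc hKU hΞ h0
  have hwΞ : ∀ z ∈ U, ContDiffAt ℝ ∞ (wirt c Ξ) z := fun z hz => contDiffAt_wirt (hΞ z hz)
  have hwA : ∀ z ∈ U, ContDiffAt ℝ ∞ (wirt c A) z := fun z hz => contDiffAt_wirt (hA z hz)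
  have z1 : ∀ z, z ∉ K → lor (A z) (wirt c Ξ z) = 0 := fun z hz => by rw [w0 z hz, lor_zero_right]
  have z2 : ∀ z, z ∉ K → lor (wirt c A z) (Ξ z) = 0 := fun z hz => by rw [h0 z hz, lor_zero_right]
  have s1 := contDiff_of_support hc hKU (fun z hz => contDiffAt_lor (hA z hz) (hwΞ z hz)) z1
  have s2 := contDiff_of_support hc hKU (fun z hz => contDiffAt_lor (hwA z hz) (hΞ z hz)) z2
  have c1 := HasCompactSupport.intro hK z1
  have c2 := HasCompactSupport.intro hK z2
  have i1 := integral_wirt_eq_zero s1 c1 c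
  have i2 := integral_wirt_eq_zero s2 c2 c
  have t1 : ∀ z, z ∉ K → lor (A z) (wirt c (wirt c Ξ) z) = 0 := fun z hz => by
    rw [ww0 z hz, lor_zero_right]
  have t2 : ∀ z, z ∉ K → lor (wirt c (wirt c A) z) (Ξ z) = 0 := fun z hz => by
    rw [h0 z hz, lor_zero_right]
  have j1 : Integrable fun z => lor (A z) (wirt c (wirt c Ξ) z) :=
    (contDiff_of_support hc hKU (fun z hz => contDiffAt_lor (hA z hz)
      (contDiffAt_wirt (hwΞ z hz))) t1).continuous.integrable_of_hasCompactSupport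
      (HasCompactSupport.intro hK t1)
  have j2 : Integrable fun z => lor (wirt c (wirt c A) z) (Ξ z) :=
    (contDiff_of_support hc hKU (fun z hz => contDiffAt_lor (contDiffAt_wirt (hwA z hz))
      (hΞ z hz)) t2).continuous.integrable_of_hasCompactSupport (HasCompactSupport.intro hK t2)
  have k1 : Integrable fun z => wirt c (fun w => lor (A w) (wirt c Ξ w)) z :=
    (contDiff_iff_contDiffAt.2 fun z => contDiffAt_wirt s1.contDiffAt
      ).continuous.integrable_of_hasCompactSupport
      (HasCompactSupport.intro hK (wirt_eq_zero_of_support hc z1))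
  -- With ∂ the operator `wirt c`, the difference of the integrands is ∂⟨A, ∂Ξ⟩ − ∂⟨∂A, Ξ⟩, and each
  -- term integrates to zero.
  have e : ∀ z, lor (A z) (wirt c (wirt c Ξ) z) - lor (wirt c (wirt c A) z) (Ξ z) =
      wirt c (fun w => lor (A w) (wirt c Ξ w)) z - wirt c (fun w => lor (wirt c A w) (Ξ w)) z := by
    intro z
    by_cases hz : z ∈ K
    · rw [wirt_lor (hA z (hKU hz)) (hwΞ z (hKU hz)), wirt_lor (hwA z (hKU hz)) (hΞ z (hKU hz))]
      ring
    · rw [t1 z hz, t2 z hz, wirt_eq_zero_of_support hc z1 z hz,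
        wirt_eq_zero_of_support hc z2 z hz]
  have k2 : Integrable fun z => wirt c (fun w => lor (wirt c A w) (Ξ w)) z :=
    (contDiff_iff_contDiffAt.2 fun z => contDiffAt_wirt s2.contDiffAt
      ).continuous.integrable_of_hasCompactSupport
      (HasCompactSupport.intro hK (wirt_eq_zero_of_support hc z2))
  rw [← sub_eq_zero, ← integral_sub j1 j2]
  simp only [e]
  rw [integral_sub k1 k2, i1, i2, sub_zero]

end Integrals

/-! ### The Euler–Lagrange equation -/

section EulerLagrange

open MeasureTheory

variable {U K : Set ℂ} {Y ξ : ℂ → Fin 6 → ℝ} {z : ℂ}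

theorem wirt_wirt_wirt_wirt_comm {F : ℂ → Fin 6 → ℂ} (hU : IsOpen U)
    (hF : ∀ w ∈ U, ContDiffAt ℝ ∞ F w) (hz : z ∈ U) (a b : ℂ) :
    wirt a (wirt a (wirt b (wirt b F))) z = wirt b (wirt b (wirt a (wirt a F))) z := by
  have key : ∀ G : ℂ → Fin 6 → ℂ, (∀ w ∈ U, ContDiffAt ℝ ∞ G w) → ∀ w ∈ U,
      wirt a (wirt b (wirt b G)) w = wirt b (wirt b (wirt a G)) w := by
    intro G hG w hw
    rw [wirt_comm (contDiffAt_wirt (hG w hw))]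
    exact wirt_congr_on hU (fun x hx => wirt_comm (hG x hx)) hw
  rw [wirt_congr_on hU (key F hF) hz]
  exact key _ (fun w hw => contDiffAt_wirt (hF w hw)) z hz

theorem IsIsothermal.wirt_wirt_Yzbarzbar (H : IsIsothermal U Y) (hz : z ∈ U) :
    wirt (-Complex.I) (wirt (-Complex.I) (Yzbarzbar Y)) z =
      wirt Complex.I (wirt Complex.I (Yzz Y)) z := by
  rw [Yzbarzbar_eq, Yzbar_eq, Yzz_eq, Yz_eq]
  exact wirt_wirt_wirt_wirt_comm H.isOpen (fun w hw => contDiffAt_cplx (H.smooth w hw)) hz _ _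

/-- The first z̄-derivative of Y_zz is D_z̄ κ plus multiples of Y, Y_z and Y_z̄. In the second, the
multiple −(s/2) of Y_z̄ produces Y_z̄z̄ and with it κ̄; Y and Y_z give nothing normal. -/
theorem IsIsothermal.normalPart_wirt_wirt_Yzz (H : IsIsothermal U Y) (hz : z ∈ U) :
    normalPart Y z (wirt Complex.I (wirt Complex.I (Yzz Y)) z) =
      normalD Complex.I Y (DzbarKappa Y) z - (schwarzian Y z / 2) • conjVec (kappa Y z) := by
  have h := H.smooth z hz
  have hk := contDiffAt_kappa h
  have hD : ContDiffAt ℝ ∞ (DzbarKappa Y) z := contDiffAt_normalD h hk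
  have hs := contDiffAt_schwarzian h
  have hX := contDiffAt_cplx h
  have e : ∀ w ∈ U, wirt Complex.I (Yzz Y) w =
      DzbarKappa Y w + (2 * lor (kappa Y w) (conjVec (DzbarKappa Y w)) -
        wirt Complex.I (schwarzian Y) w / 2) • cplx (Y w) -
      (2 * lor (kappa Y w) (conjVec (kappa Y w))) • Yz Y w - (schwarzian Y w / 2) • Yzbar Y w := by
    intro w hw
    rw [H.wirt_Yzz hw, H.wirt_normal_zbar hw (contDiffAt_kappa (H.smooth w hw))
      (fun x hx => H.isNormal_kappa hx), DzbarKappa_eq]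
    module
  have ha : ContDiffAt ℝ ∞ (fun w => 2 * lor (kappa Y w) (conjVec (DzbarKappa Y w)) -
      wirt Complex.I (schwarzian Y) w / 2) z :=
    (contDiffAt_const.mul (contDiffAt_lor hk (contDiffAt_conjVec hD))).sub
      ((contDiffAt_wirt hs).div_const 2)
  have hb : ContDiffAt ℝ ∞ (fun w => 2 * lor (kappa Y w) (conjVec (kappa Y w))) z :=
    contDiffAt_const.mul (contDiffAt_lor hk (contDiffAt_conjVec hk))
  have hc : ContDiffAt ℝ ∞ (fun w => schwarzian Y w / 2) z := hs.div_const 2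
  have t1 := contDiffAt_fun_smul ha hX
  have t2 := contDiffAt_fun_smul hb (contDiffAt_Yz h)
  have t3 := contDiffAt_fun_smul hc (contDiffAt_Yzbar h)
  rw [wirt_congr_on H.isOpen e hz, wirt_sub (diffAt ((hD.add t1).sub t2)) (diffAt t3),
    wirt_sub (diffAt (hD.add t1)) (diffAt t2), wirt_add (diffAt hD) (diffAt t1),
    wirt_smul (diffAt ha) (diffAt hX), wirt_smul (diffAt hb) (diffAt (contDiffAt_Yz h)),
    wirt_smul (diffAt hc) (diffAt (contDiffAt_Yzbar h)), ← Yzbarzbar_eq, ← Yzbar_eq, ← Yzzbar_eq]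
  simp only [normalPart_add, normalPart_sub, normalPart_smul, H.normalPart_Y hz,
    H.normalPart_Yz hz, H.normalPart_Yzbar hz, H.normalPart_Yzzbar hz, H.Yzbarzbar_eq_kappa hz,
    (H.isNormal_conjVec hz (H.isNormal_kappa hz)).normalPart_eq, normalD]
  module

theorem integrable_of_support {f : ℂ → ℂ} (hK : IsCompact K) (hKU : K ⊆ U)
    (h : ∀ z ∈ U, ContDiffAt ℝ ∞ f z) (h0 : ∀ z, z ∉ K → f z = 0) : Integrable f :=
  (contDiff_of_support hK.isClosed hKU h h0).continuous.integrable_of_hasCompactSupport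
    (HasCompactSupport.intro hK h0)

theorem integral_add_add_add {f g h k : ℂ → ℂ} (hf : Integrable f) (hg : Integrable g)
    (hh : Integrable h) (hk : Integrable k) :
    ∫ z, (f z + g z + h z + k z) = (∫ z, f z) + (∫ z, g z) + (∫ z, h z) + ∫ z, k z := by
  have h1 : Integrable fun z => f z + g z := hf.add hg
  have h2 : Integrable fun z => f z + g z + h z := h1.add hh
  rw [integral_add h2 hk, integral_add h1 hh, integral_add hf hg]

/-- The first variation in the direction `ξ`, after integration by parts. -/
theorem IsIsothermal.integral_densityVariation (H : IsIsothermal U Y) (hK : IsCompact K)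
    (hKU : K ⊆ U) (hξ : ∀ w ∈ U, ContDiffAt ℝ ∞ ξ w) (h0 : ∀ w, w ∉ K → ξ w = 0)
    (n : ∀ w ∈ U, IsNormal Y w (cplx (ξ w))) :
    ∫ z, densityVariation Y ξ z = ∫ z, lor ((2 : ℂ) • normalD Complex.I Y (DzbarKappa Y) z +
      conj (schwarzian Y z) • kappa Y z) (cplx (ξ z)) := by
  have hΞ : ∀ w ∈ U, ContDiffAt ℝ ∞ (fun w => cplx (ξ w)) w := fun w hw => contDiffAt_cplx (hξ w hw)
  have hΞ0 : ∀ w, w ∉ K → cplx (ξ w) = 0 := fun w hw => by rw [h0 w hw]; funext i; simp [cplx]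
  have hA : ∀ w ∈ U, ContDiffAt ℝ ∞ (Yzz Y) w := fun w hw => contDiffAt_Yzz (H.smooth w hw)
  have hC : ∀ w ∈ U, ContDiffAt ℝ ∞ (Yzbarzbar Y) w :=
    fun w hw => contDiffAt_Yzbarzbar (H.smooth w hw)
  have hs : ∀ w ∈ U, ContDiffAt ℝ ∞ (schwarzian Y) w :=
    fun w hw => contDiffAt_schwarzian (H.smooth w hw)
  have p1 := integral_lor_wirt_wirt hK hKU hA hΞ hΞ0 Complex.I
  have p2 := integral_lor_wirt_wirt hK hKU hC hΞ hΞ0 (-Complex.I)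
  have z0 : ∀ c : ℂ, ∀ w, w ∉ K → wirt c (wirt c fun x => cplx (ξ x)) w = 0 := fun c =>
    wirt_eq_zero_of_support hK.isClosed (wirt_eq_zero_of_support hK.isClosed hΞ0)
  have i1 : Integrable fun z => lor (Yzz Y z) (Yzbarzbar ξ z) :=
    integrable_of_support hK hKU (fun w hw => contDiffAt_lor (hA w hw)
      (contDiffAt_Yzbarzbar (hξ w hw))) fun w hw => by
        rw [Yzbarzbar_eq, Yzbar_eq, z0 _ w hw, lor_zero_right]
  have i2 : Integrable fun z => lor (Yzbarzbar Y z) (Yzz ξ z) :=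
    integrable_of_support hK hKU (fun w hw => contDiffAt_lor (hC w hw)
      (contDiffAt_Yzz (hξ w hw))) fun w hw => by
        rw [Yzz_eq, Yz_eq, z0 _ w hw, lor_zero_right]
  have i3 : Integrable fun z => conj (schwarzian Y z) * lor (Yzz Y z) (cplx (ξ z)) :=
    integrable_of_support hK hKU (fun w hw => (contDiffAt_conj (hs w hw)).mul
      (contDiffAt_lor (hA w hw) (hΞ w hw))) fun w hw => by rw [hΞ0 w hw, lor_zero_right, mul_zero]
  have i4 : Integrable fun z => schwarzian Y z * lor (Yzbarzbar Y z) (cplx (ξ z)) :=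
    integrable_of_support hK hKU (fun w hw => (hs w hw).mul
      (contDiffAt_lor (hC w hw) (hΞ w hw))) fun w hw => by rw [hΞ0 w hw, lor_zero_right, mul_zero]
  have j1 : Integrable fun z => lor (wirt Complex.I (wirt Complex.I (Yzz Y)) z) (cplx (ξ z)) :=
    integrable_of_support hK hKU (fun w hw => contDiffAt_lor
      (contDiffAt_wirt (contDiffAt_wirt (hA w hw))) (hΞ w hw)) fun w hw => by
        rw [hΞ0 w hw, lor_zero_right]
  have j2 : Integrable fun z =>
      lor (wirt (-Complex.I) (wirt (-Complex.I) (Yzbarzbar Y)) z) (cplx (ξ z)) :=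
    integrable_of_support hK hKU (fun w hw => contDiffAt_lor
      (contDiffAt_wirt (contDiffAt_wirt (hC w hw))) (hΞ w hw)) fun w hw => by
        rw [hΞ0 w hw, lor_zero_right]
  have q1 : ∫ z, lor (Yzz Y z) (Yzbarzbar ξ z) =
      ∫ z, lor (wirt Complex.I (wirt Complex.I (Yzz Y)) z) (cplx (ξ z)) := p1
  have q2 : ∫ z, lor (Yzbarzbar Y z) (Yzz ξ z) =
      ∫ z, lor (wirt (-Complex.I) (wirt (-Complex.I) (Yzbarzbar Y)) z) (cplx (ξ z)) := by
    rw [Yzz_eq ξ, Yz_eq]; exact p2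
  simp only [densityVariation]
  rw [integral_add_add_add i1 i2 i3 i4, q1, q2, ← integral_add_add_add j1 j2 i3 i4]
  congr 1
  funext z
  by_cases hz : z ∈ K
  · have hz := hKU hz
    have nz := n z hz
    -- Both fourth-order terms are Y_zzz̄z̄, so together they contribute −s κ̄, which cancels the s
    -- κ̄ coming from the zeroth-order term.
    rw [H.wirt_wirt_Yzbarzbar hz, ← nz.lor_normalPart_left (wirt _ _ _),
      H.normalPart_wirt_wirt_Yzz hz, H.Yzz_eq_kappa hz, H.Yzbarzbar_eq_kappa hz]
    simp only [lor_add_left, lor_sub_left, lor_smul_left, lor_comm (cplx (Y z)), nz.lor_Y]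
    ring
  · simp only [hΞ0 z hz, lor_zero_right]
    ring

/-- The fundamental lemma of the calculus of variations, for normal variations. -/
theorem IsIsothermal.willmoreEq_of_integral_eq_zero (H : IsIsothermal U Y)
    (hcrit : ∀ (K : Set ℂ) (ξ : ℂ → Fin 6 → ℝ), IsCompact K → K ⊆ U →
      (∀ w ∈ U, ContDiffAt ℝ ∞ ξ w) → (∀ w, w ∉ K → ξ w = 0) →
      (∀ w ∈ U, IsNormal Y w (cplx (ξ w))) → ∫ z, densityVariation Y ξ z = 0) :
    WillmoreEq U Y := by
  set E : ℂ → Fin 6 → ℂ := fun z => (2 : ℂ) • normalD Complex.I Y (DzbarKappa Y) z +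
      conj (schwarzian Y z) • kappa Y z with hE
  have sE : ∀ z ∈ U, ContDiffAt ℝ ∞ E z := fun z hz => by
    have h := H.smooth z hz
    exact ((contDiffAt_normalD h (contDiffAt_normalD h (contDiffAt_kappa h))).const_smul
      (2 : ℂ)).add ((contDiffAt_conj (contDiffAt_schwarzian h)).smul (contDiffAt_kappa h))
  have nE : ∀ z ∈ U, IsNormal Y z (E z) := fun z hz =>
    ((H.isNormal_normalD hz _ _).smul _).add ((H.isNormal_kappa hz).smul _)
  have key : ∀ v : Fin 6 → ℝ, ∀ z ∈ U, lor (E z) (cplx v) = 0 := by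
    intro v
    have cf : ContinuousOn (fun z => lor (E z) (cplx v)) U := fun z hz =>
      (contDiffAt_lor (sE z hz) contDiffAt_const).continuousAt.continuousWithinAt
    have hae := H.isOpen.ae_eq_zero_of_integral_contDiff_smul_eq_zero (μ := volume)
      (f := fun z => lor (E z) (cplx v))
      (cf.locallyIntegrableOn H.isOpen.measurableSet) ?_
    · have h2 : (fun z => lor (E z) (cplx v)) =ᵐ[volume.restrict U] fun _ => 0 :=
        (ae_restrict_iff' H.isOpen.measurableSet).2 hae
      exact Measure.eqOn_open_of_ae_eq h2 H.isOpen cf continuousOn_const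
    intro χ hχ hχc hχU
    -- The test field is χ times the normal projection of the constant vector v. As E is normal,
    -- pairing it with this field gives χ⟨E, v⟩, which is the integrand required by the fundamental
    -- lemma.
    let ξ : ℂ → Fin 6 → ℝ := fun w => χ w • fun i => (normalPart Y w (cplx v) i).re
    have hreal : ∀ w ∈ U, cplx (ξ w) = (χ w : ℂ) • normalPart Y w (cplx v) := by
      intro w hw
      have : conjVec (normalPart Y w (cplx v)) = normalPart Y w (cplx v) := by
        rw [H.conjVec_normalPart hw, conjVec_cplx]
      rw [cplx_smul, exists_cplx_of_conjVec_eq this]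
    have hξ0 : ∀ w, w ∉ tsupport χ → ξ w = 0 := fun w hw => by
      simp [ξ, image_eq_zero_of_notMem_tsupport hw]
    have hξ : ∀ w ∈ U, ContDiffAt ℝ ∞ ξ w := by
      intro w hw
      have h1 := contDiffAt_normalPart (H.smooth w hw) (F := fun _ => cplx v) contDiffAt_const
      rw [contDiffAt_pi] at h1
      exact hχ.contDiffAt.smul (contDiffAt_pi.2 fun i =>
        (Complex.reCLM.contDiff.contDiffAt (n := ∞)).comp w (h1 i))
    have nξ : ∀ w ∈ U, IsNormal Y w (cplx (ξ w)) := fun w hw => by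
      rw [hreal w hw]; exact (H.isNormal_normalPart hw _).smul _
    have h1 := hcrit _ ξ hχc hχU hξ hξ0 nξ
    rw [H.integral_densityVariation hχc hχU hξ hξ0 nξ] at h1
    rw [← h1]
    congr 1
    funext z
    by_cases hz : z ∈ tsupport χ
    · rw [hreal z (hχU hz), lor_smul_right, (nE z (hχU hz)).lor_normalPart]
      simp
    · rw [hξ0 z hz, image_eq_zero_of_notMem_tsupport hz]
      simp [lor, cplx]
  intro z hz
  have h0 : E z = 0 := by
    refine eq_zero_of_lor_eq_zero fun w => ?_
    have hw : w = cplx (fun i => (w i).re) + Complex.I • cplx (fun i => (w i).im) := by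
      funext i
      simp [cplx, mul_comm Complex.I, Complex.re_add_im]
    rw [hw, lor_add_right, lor_smul_right, key _ z hz, key _ z hz]
    simp
  have h1 : (2 : ℂ) • normalD Complex.I Y (DzbarKappa Y) z = -(conj (schwarzian Y z) • kappa Y z) :=
    eq_neg_of_add_eq_zero_left h0
  have h2 : normalD Complex.I Y (DzbarKappa Y) z =
      (1 / 2 : ℂ) • ((2 : ℂ) • normalD Complex.I Y (DzbarKappa Y) z) := by
    rw [smul_smul]; norm_num
  rw [h2, h1]
  module

end EulerLagrange

/-! ### Canonical lifts -/

section Lifts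

open MeasureTheory

variable {M : Type*} [TopologicalSpace M] {y : M → Q41}
  {e : OpenPartialHomeomorph M ℂ} {U : Set ℂ} {Y : ℂ → Fin 6 → ℝ}

theorem IsLift.contDiffAt (h : IsLift y e U Y) {z : ℂ} (hz : z ∈ U) : ContDiffAt ℝ ∞ Y z :=
  h.smooth.contDiffAt (h.isOpen.mem_nhds hz)

theorem IsLift.lor_self (h : IsLift y e U Y) {z : ℂ} (hz : z ∈ U) : lor (Y z) (Y z) = 0 := by
  obtain ⟨h0, h1⟩ := h.lifts z hz
  refine (y (e.symm z)).2 _ ?_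
  rw [← h1, Projectivization.submodule_mk]
  exact Submodule.mem_span_singleton_self _

theorem lor_Yz_Yz_eq {z : ℂ} (hY : ContDiffAt ℝ ∞ Y z) :
    lor (Yz Y z) (Yz Y z) = (1 / 4) * ((lor (pd 0 Y z) (pd 0 Y z) - lor (pd 1 Y z) (pd 1 Y z) : ℝ) -
      2 * Complex.I * (lor (pd 0 Y z) (pd 1 Y z) : ℝ)) := by
  have e0 := cplx_pd_zero hY
  have e1 := cplx_pd_one hY
  rw [← Yz_eq, ← Yzbar_eq] at e0 e1
  push_cast
  simp only [← lor_cplx, e0, e1, lor_add_left, lor_add_right, lor_sub_left, lor_sub_right,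
    lor_smul_left, lor_smul_right, lor_comm (Yzbar Y z) (Yz Y z)]
  linear_combination ((3 / 4) * lor (Yz Y z) (Yz Y z) - (1 / 4) * lor (Yzbar Y z) (Yzbar Y z) -
    (1 / 2) * lor (Yz Y z) (Yzbar Y z)) * Complex.I_mul_I

theorem lor_Yz_Yzbar_eq {z : ℂ} (hY : ContDiffAt ℝ ∞ Y z) :
    lor (Yz Y z) (Yzbar Y z) =
      (((lor (pd 0 Y z) (pd 0 Y z) + lor (pd 1 Y z) (pd 1 Y z)) / 4 : ℝ) : ℂ) := by
  have e0 := cplx_pd_zero hY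
  have e1 := cplx_pd_one hY
  rw [← Yz_eq, ← Yzbar_eq] at e0 e1
  push_cast
  simp only [← lor_cplx, e0, e1, lor_add_left, lor_add_right, lor_sub_left, lor_sub_right,
    lor_smul_left, lor_smul_right, lor_comm (Yzbar Y z) (Yz Y z)]
  linear_combination (-(1 / 4) * lor (Yz Y z) (Yz Y z) - (1 / 4) * lor (Yzbar Y z) (Yzbar Y z) +
    (1 / 2) * lor (Yz Y z) (Yzbar Y z)) * Complex.I_mul_I

theorem IsCanonicalLift.isIsothermal (h : IsCanonicalLift y e U Y) : IsIsothermal U Y := by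
  have hs : ∀ z ∈ U, ContDiffAt ℝ ∞ Y z := fun z hz => h.toIsLift.contDiffAt hz
  have k0 : ∀ z ∈ U, lor (pd 0 Y z) (pd 0 Y z) = 1 := fun z hz => by
    have := h.metric z hz 1
    simpa [pd] using this
  have k1 : ∀ z ∈ U, lor (pd 1 Y z) (pd 1 Y z) = 1 := fun z hz => by
    have := h.metric z hz Complex.I
    simpa [pd] using this
  -- Polarization: the direction 1 + i detects ⟨Y_u, Y_v⟩.
  have k2 : ∀ z ∈ U, lor (pd 0 Y z) (pd 1 Y z) = 0 := fun z hz => by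
    have h2 := h.metric z hz (1 + Complex.I)
    have h3 : ‖(1 + Complex.I : ℂ)‖ ^ 2 = 2 := by
      rw [← Complex.normSq_eq_norm_sq]; simp [Complex.normSq_apply]; norm_num
    have a0 := k0 z hz
    have a1 := k1 z hz
    have p0 : fderiv ℝ Y z 1 = pd 0 Y z := rfl
    have p1 : fderiv ℝ Y z Complex.I = pd 1 Y z := rfl
    rw [h3, map_add, p0, p1, lor_add_left, lor_add_right, lor_add_right,
      lor_comm (pd 1 Y z) (pd 0 Y z)] at h2
    linarith
  refine ⟨h.isOpen, hs, fun z hz => ?_, fun z hz => ?_, fun z hz => ?_⟩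
  · rw [lor_cplx, h.toIsLift.lor_self hz, Complex.ofReal_zero]
  · rw [lor_Yz_Yz_eq (hs z hz), k0 z hz, k1 z hz, k2 z hz]; simp
  · rw [lor_Yz_Yzbar_eq (hs z hz), k0 z hz, k1 z hz]; norm_num

variable [ChartedSpace ℂ M]

/-- Every compactly supported normal field is the velocity of an admissible variation. Criticality
and differentiation under the integral compute the same derivative. -/
theorem IsWillmore.integral_densityVariation_eq_zero (hy : IsWillmore y)
    (he : e ∈ IsManifold.maximalAtlas 𝓘(ℂ) ω M) (hc : IsCanonicalLift y e U Y) {K : Set ℂ}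
    {ξ : ℂ → Fin 6 → ℝ} (hK : IsCompact K) (hKU : K ⊆ U) (hξ : ∀ w ∈ U, ContDiffAt ℝ ∞ ξ w)
    (h0 : ∀ w, w ∉ K → ξ w = 0) (n : ∀ w ∈ U, IsNormal Y w (cplx (ξ w))) :
    ∫ z, densityVariation Y ξ z = 0 := by
  have H := hc.isIsothermal
  let N : ℂ → Fin 6 → ℝ := fun w i => (frameN Y w i).re
  have hN : ∀ w ∈ U, cplx (N w) = frameN Y w := fun w hw =>
    exists_cplx_of_conjVec_eq (H.conjVec_frameN hw)
  have sN : ∀ w ∈ U, ContDiffAt ℝ ∞ N w := fun w hw => by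
    have h1 := contDiffAt_frameN (H.smooth w hw)
    rw [contDiffAt_pi] at h1
    exact contDiffAt_pi.2 fun i => (Complex.reCLM.contDiff.contDiffAt (n := ∞)).comp w (h1 i)
  have r : ∀ a b : ℝ, (a : ℂ) = b → a = b := fun a b h => Complex.ofReal_injective h
  have yy : ∀ w ∈ U, lor (Y w) (Y w) = 0 := fun w hw => hc.toIsLift.lor_self hw
  have yn : ∀ w ∈ U, lor (Y w) (N w) = -1 := fun w hw => r _ _ (by
    rw [← lor_cplx, hN w hw, lor_comm, H.lor_frameN_Y hw]; simp)
  have nn : ∀ w ∈ U, lor (N w) (N w) = 0 := fun w hw => r _ _ (by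
    rw [← lor_cplx, hN w hw, H.lor_frameN_frameN hw]; simp)
  have xy : ∀ w ∈ U, lor (ξ w) (Y w) = 0 := fun w hw => r _ _ (by
    rw [← lor_cplx, (n w hw).lor_Y]; simp)
  have xn : ∀ w ∈ U, lor (ξ w) (N w) = 0 := fun w hw => r _ _ (by
    rw [← lor_cplx, hN w hw, (n w hw).lor_N]; simp)
  -- The second-order correction that keeps the variation null: since ⟨Y,N⟩ = −1, it cancels
  -- t²⟨ξ,ξ⟩, and no higher terms arise because N is null and orthogonal to ξ.
  let η : ℂ → Fin 6 → ℝ := fun w => (1 / 2 * lor (ξ w) (ξ w)) • N w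
  have hη : ∀ w ∈ U, ContDiffAt ℝ ∞ η w := fun w hw =>
    (contDiffAt_const.mul (contDiffAt_lor_real (hξ w hw) (hξ w hw))).smul (sN w hw)
  let F : ℝ → ℂ → Fin 6 → ℝ := fun t w => Y w + t • ξ w + t ^ 2 • η w
  have hF0 : F 0 = Y := by funext w; simp [F]
  have hη0 : ∀ w, w ∉ K → η w = 0 := fun w hw => by simp [η, h0 w hw, lor_zero_left]
  have hlift : ∀ {G : ℂ → Fin 6 → ℝ}, (∀ w ∈ U, ContDiffAt ℝ ∞ G w) → ∀ x : ℝ × ℂ, x.2 ∈ U →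
      ContDiffAt ℝ ∞ (fun x : ℝ × ℂ => G x.2) x := fun hG x hx =>
    ContDiffAt.comp (g := _) x (hG x.2 hx) contDiffAt_snd
  have hcomb : ∀ {A B C : ℂ → Fin 6 → ℝ}, (∀ w ∈ U, ContDiffAt ℝ ∞ A w) →
      (∀ w ∈ U, ContDiffAt ℝ ∞ B w) → (∀ w ∈ U, ContDiffAt ℝ ∞ C w) → ∀ x : ℝ × ℂ, x.2 ∈ U →
      ContDiffAt ℝ ∞ (fun x : ℝ × ℂ => A x.2 + x.1 • B x.2 + x.1 ^ 2 • C x.2) x :=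
    fun hA hB hC x hx => ((hlift hA x hx).add (contDiffAt_fst.smul (hlift hB x hx))).add
      ((contDiffAt_fst.pow 2).smul (hlift hC x hx))
  have hvar : IsVariation y e U K 1 F := by
    refine ⟨one_pos, hK, hKU, hF0 ▸ hc.toIsLift, ?_, ?_, ?_⟩
    · rintro x ⟨-, hx⟩
      exact (hcomb H.smooth hξ hη x hx).contDiffWithinAt
    · intro t _ z hz
      constructor
      · intro h
        -- The product with N remains −1, so the varied lift never vanishes.
        have : lor (F t z) (N z) = -1 := by
          simp only [F, η, lor_add_left, lor_smul_left, yn z hz, xn z hz, nn z hz]; ring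
        rw [h, lor_zero_left] at this
        norm_num at this
      · simp only [F, η, lor_add_left, lor_add_right, lor_smul_left, lor_smul_right, yy z hz, yn z hz,
          nn z hz, xy z hz, xn z hz, lor_comm (Y z) (ξ z), lor_comm (N z) (Y z),
          lor_comm (N z) (ξ z)]
        ring
    · rintro t - z ⟨-, hz⟩
      simp [F, h0 z hz, hη0 z hz]
  have hder := hy.critical e he U K 1 F hvar
  let G : ℝ × ℂ → ℝ := fun x => jetDensity (variationJet Y ξ η x) (variationJetTwo Y ξ η x)
  have hG : ∀ t, ∫ z in K, willmoreDensity (F t) z = ∫ z in K, G (t, z) := fun t =>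
    setIntegral_congr_fun hK.measurableSet fun z hz =>
      willmoreDensity_variation H.isOpen H.smooth hξ hη (hKU hz) t
  simp only [hG] at hder
  have sp : ∀ x : ℝ × ℂ, x.2 ∈ U → ∀ i, ContDiffAt ℝ ∞ (fun x => variationJet Y ξ η x i) x :=
    fun x hx i => hcomb (fun w hw => contDiffAt_pd i (H.smooth w hw))
      (fun w hw => contDiffAt_pd i (hξ w hw)) (fun w hw => contDiffAt_pd i (hη w hw)) x hx
  have sq : ∀ x : ℝ × ℂ, x.2 ∈ U → ∀ i j, ContDiffAt ℝ ∞ (fun x => variationJetTwo Y ξ η x i j) x :=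
    fun x hx i j => hcomb (fun w hw => contDiffAt_pd i (contDiffAt_pd j (H.smooth w hw)))
      (fun w hw => contDiffAt_pd i (contDiffAt_pd j (hξ w hw)))
      (fun w hw => contDiffAt_pd i (contDiffAt_pd j (hη w hw))) x hx
  have hpre : IsOpen {x : ℝ × ℂ | x.2 ∈ U} := H.isOpen.preimage continuous_snd
  -- A varied surface may have a degenerate metric for larger t, so smoothness of the density is
  -- used only on this open set, which contains {0} × K.
  have hWopen : IsOpen ({x : ℝ × ℂ | x.2 ∈ U} ∩
      (fun x => (jetMetric (variationJet Y ξ η x)).det) ⁻¹' {0}ᶜ) :=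
    ContinuousOn.isOpen_inter_preimage (fun x hx =>
      (contDiffAt_jetMetric_det (sp x hx)).continuousAt.continuousWithinAt) hpre
      isOpen_compl_singleton
  have hjet : ∀ z, variationJet Y ξ η (0, z) = fun i => pd i Y z := fun z => by
    funext i; simp [variationJet]
  choose! D hD1 hD2 using fun z (hz : z ∈ U) => H.hasDerivAt_density (η := η) hξ n hz
  have hint := hasDerivAt_setIntegral_of_contDiffAt (G := G) hK hWopen (fun z hz => by
      refine ⟨hKU hz, ?_⟩
      simp only [Set.mem_preimage, Set.mem_compl_iff, Set.mem_singleton_iff]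
      rw [hjet, H.jetMetric_eq (hKU hz), Matrix.det_one]
      exact one_ne_zero)
    (fun x hx => contDiffAt_jetDensity (sp x hx.1) (sq x hx.1) hx.2)
    (D := D) (fun z hz => hD2 z (hKU hz))
  have hzero : ∫ z in K, D z = 0 := hint.unique hder
  have hout : ∀ z, z ∉ K → densityVariation Y ξ z = 0 := by
    intro z hz
    have c0 : ∀ w, w ∉ K → cplx (ξ w) = 0 := fun w hw => by rw [h0 w hw]; funext i; simp [cplx]
    have z0 : ∀ c : ℂ, wirt c (wirt c fun x => cplx (ξ x)) z = 0 := fun c =>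
      wirt_eq_zero_of_support hK.isClosed (wirt_eq_zero_of_support hK.isClosed c0) z hz
    rw [densityVariation, Yzbarzbar_eq ξ, Yzbar_eq, Yzz_eq ξ, Yz_eq, z0, z0, c0 z hz]
    simp only [lor_zero_right]
    ring
  rw [← setIntegral_eq_integral_of_forall_compl_eq_zero hout,
    ← setIntegral_congr_fun hK.measurableSet fun z hz => hD1 z (hKU hz)]
  rw [integral_complex_ofReal, hzero, Complex.ofReal_zero]

/-- The Euler–Lagrange equation of a Willmore surface. -/
theorem IsWillmore.willmoreEq (hy : IsWillmore y) (he : e ∈ IsManifold.maximalAtlas 𝓘(ℂ) ω M)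
    (hc : IsCanonicalLift y e U Y) : WillmoreEq U Y :=
  hc.isIsothermal.willmoreEq_of_integral_eq_zero fun _ _ hK hKU hξ h0 n =>
    hy.integral_densityVariation_eq_zero he hc hK hKU hξ h0 n

end Lifts

/-! ### Existence of canonical lifts, transitions between them, and the forms they define. -/

section Forms

variable {M : Type*} [TopologicalSpace M] {y : M → Q41}
  {e f : OpenPartialHomeomorph M ℂ} {U U' : Set ℂ} {Y Y' : ℂ → Fin 6 → ℝ} {z : ℂ}

/-- The term dr·Y is invisible to the metric, because Y is null and orthogonal to dY. -/
theorem lor_fderiv_smul (hU : IsOpen U) (hY : ∀ w ∈ U, ContDiffAt ℝ ∞ Y w)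
    (h0 : ∀ w ∈ U, lor (Y w) (Y w) = 0) {r : ℂ → ℝ} (hz : z ∈ U) (hr : ContDiffAt ℝ ∞ r z) (v : ℂ) :
    lor (fderiv ℝ (fun w => r w • Y w) z v) (fderiv ℝ (fun w => r w • Y w) z v) =
      r z ^ 2 * lor (fderiv ℝ Y z v) (fderiv ℝ Y z v) := by
  have hYd := diffAt (hY z hz)
  have hrd : DifferentiableAt ℝ r z := diffAt hr
  have e1 : fderiv ℝ (fun w => r w • Y w) z v = r z • fderiv ℝ Y z v + (fderiv ℝ r z v) • Y z := by
    rw [fderiv_fun_smul hrd hYd]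
    simp
  have e2 : lor (fderiv ℝ Y z v) (Y z) = 0 := by
    have hp : ∀ i, HasFDerivAt (fun w => Y w i)
        ((ContinuousLinearMap.proj i : (Fin 6 → ℝ) →L[ℝ] ℝ).comp (fderiv ℝ Y z)) z := fun i =>
      (hasFDerivAt_pi'.1 hYd.hasFDerivAt) i
    have hq : HasFDerivAt (fun w => lor (Y w) (Y w)) _ z :=
      ((((((hp 0).mul (hp 0)).add ((hp 1).mul (hp 1))).add ((hp 2).mul (hp 2))).add
        ((hp 3).mul (hp 3))).sub ((hp 4).mul (hp 4))).sub ((hp 5).mul (hp 5))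
    have hc : HasFDerivAt (fun w => lor (Y w) (Y w)) (0 : ℂ →L[ℝ] ℝ) z :=
      (hasFDerivAt_const (0 : ℝ) z).congr_of_eventuallyEq
        (Filter.eventuallyEq_of_mem (hU.mem_nhds hz) h0)
    have h3 := DFunLike.congr_fun (hq.unique hc) v
    simp at h3
    simp only [lor]
    linarith
  rw [e1]
  simp only [lor_add_left, lor_add_right, lor_smul_left, lor_smul_right, e2, h0 z hz,
    lor_comm (Y z) (fderiv ℝ Y z v)]
  ring

theorem fderiv_eq_pd (v : ℂ) : fderiv ℝ Y z v = v.re • pd 0 Y z + v.im • pd 1 Y z := by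
  have hv : v = v.re • (1 : ℂ) + v.im • Complex.I := by
    simp [Complex.re_add_im]
  conv_lhs => rw [hv, map_add, map_smul, map_smul]
  rfl

theorem IsConformalSpacelike.exists_canonicalLift [ChartedSpace ℂ M] (hy : IsConformalSpacelike y)
    (he : e ∈ IsManifold.maximalAtlas 𝓘(ℂ) ω M) (hz : z ∈ e.target) :
    ∃ (U : Set ℂ) (Y : ℂ → Fin 6 → ℝ), z ∈ U ∧ IsCanonicalLift y e U Y := by
  obtain ⟨U, Y, hzU, hY⟩ := hy.exists_lift e he z hz
  have hconf := hy.conformal e he U Y hY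
  have hs : ∀ w ∈ U, ContDiffAt ℝ ∞ Y w := fun w hw => hY.contDiffAt hw
  -- Conformality makes ⟨Y_u,Y_u⟩ and ⟨Y_v,Y_v⟩ equal; their mean g is the conformal factor,
  -- positive because it is 2⟨Y_z,Y_z̄⟩. Dividing Y by √g normalizes the metric.
  let g : ℂ → ℝ := fun w => (lor (pd 0 Y w) (pd 0 Y w) + lor (pd 1 Y w) (pd 1 Y w)) / 2
  have hg : ∀ w ∈ U, 0 < g w := fun w hw => by
    have := (hconf w hw).2
    rw [lor_Yz_Yzbar_eq (hs w hw), Complex.ofReal_re] at this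
    simp only [g]
    linarith
  have hgs : ∀ w ∈ U, ContDiffAt ℝ ∞ g w := fun w hw =>
    ((contDiffAt_lor_real (contDiffAt_pd 0 (hs w hw)) (contDiffAt_pd 0 (hs w hw))).add
      (contDiffAt_lor_real (contDiffAt_pd 1 (hs w hw)) (contDiffAt_pd 1 (hs w hw)))).div_const 2
  let r : ℂ → ℝ := fun w => (√(g w))⁻¹
  have hr : ∀ w ∈ U, 0 < r w := fun w hw => inv_pos.2 (Real.sqrt_pos.2 (hg w hw))
  have hrs : ∀ w ∈ U, ContDiffAt ℝ ∞ r w := fun w hw =>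
    ((hgs w hw).sqrt (hg w hw).ne').inv (Real.sqrt_pos.2 (hg w hw)).ne'
  refine ⟨U, fun w => r w • Y w, hzU, ⟨hY.isOpen, hY.subset, fun w hw =>
    ((hrs w hw).smul (hs w hw)).contDiffWithinAt, fun w hw => ?_⟩, fun w hw v => ?_⟩
  · obtain ⟨h0, h1⟩ := hY.lifts w hw
    refine ⟨smul_ne_zero (hr w hw).ne' h0, ?_⟩
    rw [← h1, Projectivization.mk_eq_mk_iff']
    exact ⟨r w, rfl⟩
  · rw [lor_fderiv_smul hY.isOpen hs (fun x hx => hY.lor_self hx) hw (hrs w hw), fderiv_eq_pd v]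
    have h1 := (hconf w hw).1
    rw [lor_Yz_Yz_eq (hs w hw)] at h1
    have h2 := congrArg Complex.re h1
    have h3 := congrArg Complex.im h1
    simp at h2 h3
    have hr2 : r w ^ 2 * g w = 1 := by
      simp only [r]
      rw [inv_pow, Real.sq_sqrt (hg w hw).le, inv_mul_cancel₀ (hg w hw).ne']
    have e0 : lor (pd 0 Y w) (pd 0 Y w) = g w := by simp only [g]; linarith
    have e1 : lor (pd 1 Y w) (pd 1 Y w) = g w := by simp only [g]; linarith
    simp only [lor_add_left, lor_add_right, lor_smul_left, lor_smul_right,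
      lor_comm (pd 1 Y w) (pd 0 Y w), e0, e1, h3]
    rw [← Complex.normSq_eq_norm_sq, Complex.normSq_apply]
    linear_combination (v.re * v.re + v.im * v.im) * hr2

theorem IsIsothermal.mono (H : IsIsothermal U Y) {W : Set ℂ} (hW : IsOpen W) (h : W ⊆ U) :
    IsIsothermal W Y :=
  ⟨hW, fun z hz => H.smooth z (h hz), fun z hz => H.null z (h hz), fun z hz => H.null_z z (h hz),
    fun z hz => H.metric z (h hz)⟩

theorem differentiableOn_transition [ChartedSpace ℂ M]
    (he : e ∈ IsManifold.maximalAtlas 𝓘(ℂ) ω M) (hf : f ∈ IsManifold.maximalAtlas 𝓘(ℂ) ω M) :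
    DifferentiableOn ℂ (f ∘ e.symm) (e.symm.trans f).source :=
  (contMDiffOn_iff_contDiffOn.1 (contMDiffOn_of_mem_contDiffGroupoid
    (IsManifold.compatible_of_mem_maximalAtlas he hf))).differentiableOn (by simp)

theorem deriv_transition_ne_zero [ChartedSpace ℂ M]
    (he : e ∈ IsManifold.maximalAtlas 𝓘(ℂ) ω M) (hf : f ∈ IsManifold.maximalAtlas 𝓘(ℂ) ω M)
    (hz : z ∈ (e.symm.trans f).source) : deriv (f ∘ e.symm) z ≠ 0 := by
  have hz' : z ∈ e.target ∧ e.symm z ∈ f.source := by simpa using hz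
  have h1 := ((differentiableOn_transition he hf).differentiableAt
    ((e.symm.trans f).open_source.mem_nhds hz)).hasDerivAt
  have hw : (f ∘ e.symm) z ∈ (f.symm.trans e).source := by
    simp [f.map_source hz'.2, f.left_inv hz'.2, e.map_target hz'.1]
  have h2 := ((differentiableOn_transition hf he).differentiableAt
    ((f.symm.trans e).open_source.mem_nhds hw)).hasDerivAt
  have h3 := h2.comp z h1
  have h4 : HasDerivAt ((e ∘ f.symm) ∘ (f ∘ e.symm)) 1 z := by
    refine (hasDerivAt_id z).congr_of_eventuallyEq
      (Filter.eventuallyEq_of_mem ((e.symm.trans f).open_source.mem_nhds hz) fun w hw => ?_)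
    have hw' : w ∈ e.target ∧ e.symm w ∈ f.source := by simpa using hw
    simp [f.left_inv hw'.2, e.right_inv hw'.1]
  intro h0
  rw [h0, mul_zero] at h3
  exact zero_ne_one (h3.unique h4)

/-- Two canonical lifts, in two coordinates, are related by a change of coordinates. -/
theorem IsCanonicalLift.exists_isCoordChange [ChartedSpace ℂ M]
    (he : e ∈ IsManifold.maximalAtlas 𝓘(ℂ) ω M) (hf : f ∈ IsManifold.maximalAtlas 𝓘(ℂ) ω M)
    (hY : IsCanonicalLift y e U Y) (hY' : IsCanonicalLift y f U' Y') (hz : z ∈ U)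
    (hzf : e.symm z ∈ f.source) (hz' : f (e.symm z) ∈ U') :
    ∃ (W : Set ℂ) (r : ℂ → ℝ), z ∈ W ∧ IsCoordChange W Y U' Y' (f ∘ e.symm) r := by
  let W : Set ℂ := U ∩ ((e.symm.trans f).source ∩ (e.symm.trans f) ⁻¹' U')
  have hWo : IsOpen W :=
    hY.isOpen.inter ((e.symm.trans f).isOpen_inter_preimage hY'.isOpen)
  have hWf : ∀ w ∈ W, w ∈ (e.symm.trans f).source := fun w hw => hw.2.1
  have hWs : ∀ w ∈ W, e.symm w ∈ f.source := fun w hw => by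
    have : w ∈ e.target ∧ e.symm w ∈ f.source := by simpa using hw.2.1
    exact this.2
  have hWU' : ∀ w ∈ W, (f ∘ e.symm) w ∈ U' := fun w hw => hw.2.2
  have H := hY.isIsothermal.mono hWo (Set.inter_subset_left)
  have hhol : DifferentiableOn ℂ (f ∘ e.symm) W := (differentiableOn_transition he hf).mono hWf
  let N : ℂ → Fin 6 → ℝ := fun w i => (frameN Y w i).re
  have hN : ∀ w ∈ W, lor (Y w) (N w) = -1 := fun w hw => by
    apply Complex.ofReal_injective
    rw [← lor_cplx, exists_cplx_of_conjVec_eq (H.conjVec_frameN hw), lor_comm, H.lor_frameN_Y hw]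
    simp
  have sN : ∀ w ∈ W, ContDiffAt ℝ ∞ N w := fun w hw => by
    have h1 := contDiffAt_frameN (H.smooth w hw)
    rw [contDiffAt_pi] at h1
    exact contDiffAt_pi.2 fun i => (Complex.reCLM.contDiff.contDiffAt (n := ∞)).comp w (h1 i)
  -- Projective equality gives the ratio of the lifts only pointwise; pairing with N, where ⟨Y,N⟩ =
  -- −1, recovers it as a smooth function.
  let r : ℂ → ℝ := fun w => -lor (Y' ((f ∘ e.symm) w)) (N w)
  have hr : ∀ w ∈ W, Y' ((f ∘ e.symm) w) = r w • Y w := by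
    intro w hw
    obtain ⟨h0, h1⟩ := hY.lifts w hw.1
    obtain ⟨h0', h1'⟩ := hY'.lifts _ (hWU' w hw)
    have hfe : f.symm ((f ∘ e.symm) w) = e.symm w := f.left_inv (hWs w hw)
    rw [hfe, ← h1, Projectivization.mk_eq_mk_iff'] at h1'
    obtain ⟨a, ha⟩ := h1'
    have : r w = a := by
      simp only [r]
      rw [← ha, lor_smul_left, hN w hw]; ring
    rw [this, ha]
  have sY' : ∀ w ∈ W, ContDiffAt ℝ ∞ (fun x => Y' ((f ∘ e.symm) x)) w := fun w hw =>
    (hY'.toIsLift.contDiffAt (hWU' w hw)).comp w (contDiffAt_of_holomorphic hWo hhol hw)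
  have sr : ∀ w ∈ W, ContDiffAt ℝ ∞ r w := fun w hw =>
    (contDiffAt_lor_real (sY' w hw) (sN w hw)).neg
  refine ⟨W, r, ⟨hz, ?_, hz'⟩, H, hY'.isIsothermal, hWU', hhol,
    fun w hw => deriv_transition_ne_zero he hf (hWf w hw), sr, hr, fun w hw => ?_⟩
  · simpa using ⟨hY.subset hz, hzf⟩
  -- Both lifts being canonical, comparing lengths in the direction 1 gives r² = |h'|².
  · have h1 := lor_fderiv_smul hWo H.smooth (fun x hx => hY.toIsLift.lor_self hx.1) hw (sr w hw) 1
    rw [hY.metric w hw.1] at h1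
    have h2 : fderiv ℝ (fun x => r x • Y x) w 1 =
        fderiv ℝ Y' ((f ∘ e.symm) w) (deriv (f ∘ e.symm) w) := by
      have hd := (hhol.differentiableAt (hWo.mem_nhds hw)).hasDerivAt.hasFDerivAt.restrictScalars ℝ
      have hc := (diffAt (hY'.toIsLift.contDiffAt (hWU' w hw))).hasFDerivAt.comp w hd
      have hcc : HasFDerivAt (fun x => r x • Y x) _ w := hc.congr_of_eventuallyEq
        (Filter.eventuallyEq_of_mem (hWo.mem_nhds hw) fun x hx => (hr x hx).symm)
      rw [hcc.fderiv]
      simp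
    rw [h2, hY'.metric _ (hWU' w hw)] at h1
    rw [Complex.mul_conj, Complex.normSq_eq_norm_sq, h1]
    push_cast
    simp

/-- The function `T Y` of a canonical lift `Y`, as a function of the coordinate. -/
def liftForm (y : M → Q41) (T : (ℂ → Fin 6 → ℝ) → ℂ → ℂ) (e : OpenPartialHomeomorph M ℂ) (z : ℂ) :
    ℂ :=
  open Classical in
  if h : ∃ P : Set ℂ × (ℂ → Fin 6 → ℝ), z ∈ P.1 ∧ IsCanonicalLift y e P.1 P.2 then T h.choose.2 z
  else 0

variable [ChartedSpace ℂ M] {T : (ℂ → Fin 6 → ℝ) → ℂ → ℂ} {k : ℕ}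

/-- Independence of the chosen lift is the transformation law for the identity change of coordinate,
where h' = 1. This includes the ambiguity of sign of a canonical lift. -/
theorem liftForm_eq (hT : ∀ (U U' : Set ℂ) (Y Y' : ℂ → Fin 6 → ℝ) (h : ℂ → ℂ) (r : ℂ → ℝ),
      IsCoordChange U Y U' Y' h r → ∀ z ∈ U, T Y z = T Y' (h z) * deriv h z ^ k)
    (he : e ∈ IsManifold.maximalAtlas 𝓘(ℂ) ω M) (hY : IsCanonicalLift y e U Y) (hz : z ∈ U) :
    liftForm y T e z = T Y z := by
  have h : ∃ P : Set ℂ × (ℂ → Fin 6 → ℝ), z ∈ P.1 ∧ IsCanonicalLift y e P.1 P.2 := ⟨(U, Y), hz, hY⟩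
  rw [liftForm, dif_pos h]
  obtain ⟨h1, h2⟩ := h.choose_spec
  have ht := hY.subset hz
  obtain ⟨W, r, hzW, C⟩ := h2.exists_isCoordChange he he hY h1 (e.map_target ht)
    (by rwa [e.right_inv ht])
  have hd : deriv (e ∘ e.symm) z = 1 := by
    refine ((hasDerivAt_id z).congr_of_eventuallyEq ?_).deriv
    exact Filter.eventuallyEq_of_mem (e.open_target.mem_nhds ht) fun w hw => e.right_inv hw
  rw [hT _ _ _ _ _ _ C z hzW, hd, one_pow, mul_one, Function.comp_apply, e.right_inv ht]

theorem isHolomorphicForm_liftForm (hy : IsConformalSpacelike y)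
    (hT : ∀ (U U' : Set ℂ) (Y Y' : ℂ → Fin 6 → ℝ) (h : ℂ → ℂ) (r : ℂ → ℝ),
      IsCoordChange U Y U' Y' h r → ∀ z ∈ U, T Y z = T Y' (h z) * deriv h z ^ k)
    (hd : ∀ e ∈ IsManifold.maximalAtlas 𝓘(ℂ) ω M, ∀ (U : Set ℂ) (Y : ℂ → Fin 6 → ℝ),
      IsCanonicalLift y e U Y → ∀ z ∈ U, DifferentiableAt ℂ (T Y) z) :
    IsHolomorphicForm M k (liftForm y T) := by
  refine ⟨fun e he z hz => ?_, fun e he f hf p hp => ?_⟩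
  · obtain ⟨U, Y, hzU, hY⟩ := hy.exists_canonicalLift he hz
    exact ((hd e he U Y hY z hzU).congr_of_eventuallyEq (Filter.eventuallyEq_of_mem
      (hY.isOpen.mem_nhds hzU) fun w hw => liftForm_eq hT he hY hw)).differentiableWithinAt
  · obtain ⟨U, Y, hzU, hY⟩ := hy.exists_canonicalLift he (e.map_source hp.1)
    obtain ⟨U', Y', hzU', hY'⟩ := hy.exists_canonicalLift hf (f.map_source hp.2)
    obtain ⟨W, r, hzW, C⟩ := hY.exists_isCoordChange he hf hY' hzU
      (by rw [e.left_inv hp.1]; exact hp.2) (by rwa [e.left_inv hp.1])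
    rw [liftForm_eq hT he hY hzU, liftForm_eq hT hf hY' hzU', hT _ _ _ _ _ _ C _ hzW,
      Function.comp_apply, e.left_inv hp.1]

end Forms

/-! ### Holomorphic forms of positive weight on the sphere. -/

section Sphere

variable {M : Type*} [TopologicalSpace M] [ChartedSpace ℂ M] [IsManifold 𝓘(ℂ) ω M]

/-- The pullback of a complex coordinate under a biholomorphic map. -/
def pullbackChart (Φ : M ≃ₘ^ω⟮𝓘(ℂ), 𝓘(ℂ)⟯ (OnePoint ℂ)) (e : OpenPartialHomeomorph (OnePoint ℂ) ℂ) :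
    OpenPartialHomeomorph M ℂ :=
  Φ.toHomeomorph.toOpenPartialHomeomorph.trans e

theorem pullbackChart_mem_maximalAtlas (Φ : M ≃ₘ^ω⟮𝓘(ℂ), 𝓘(ℂ)⟯ (OnePoint ℂ))
    {e : OpenPartialHomeomorph (OnePoint ℂ) ℂ}
    (he : e ∈ IsManifold.maximalAtlas 𝓘(ℂ) ω (OnePoint ℂ)) :
    pullbackChart Φ e ∈ IsManifold.maximalAtlas 𝓘(ℂ) ω M := by
  refine OpenPartialHomeomorph.mem_maximalAtlas_of_contMDiffOn _ ?_ ?_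
  · exact (contMDiffOn_of_mem_maximalAtlas he).comp Φ.contMDiff.contMDiffOn
      (fun p hp => by simpa [pullbackChart] using hp)
  · exact Φ.symm.contMDiff.comp_contMDiffOn ((contMDiffOn_symm_of_mem_maximalAtlas he).mono
      (fun p hp => by simpa [pullbackChart] using hp))

/-- In the affine coordinate w the form is θ(1/w)(−w⁻²)^k with θ entire, so for k > 0 it is an
entire function tending to 0 at infinity, and Liouville's theorem applies. -/
theorem IsHolomorphicForm.eq_zero_of_sphere {k : ℕ} (hk : k ≠ 0)
    {θ : OpenPartialHomeomorph M ℂ → ℂ → ℂ} (hθ : IsHolomorphicForm M k θ)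
    (Φ : M ≃ₘ^ω⟮𝓘(ℂ), 𝓘(ℂ)⟯ (OnePoint ℂ)) {e : OpenPartialHomeomorph M ℂ}
    (he : e ∈ IsManifold.maximalAtlas 𝓘(ℂ) ω M) {z : ℂ} (hz : z ∈ e.target) : θ e z = 0 := by
  let a := pullbackChart Φ sphereChart
  let b := pullbackChart Φ sphereChartInv
  have ha : a ∈ IsManifold.maximalAtlas 𝓘(ℂ) ω M := pullbackChart_mem_maximalAtlas Φ
    (IsManifold.subset_maximalAtlas (Or.inl rfl))
  have hb : b ∈ IsManifold.maximalAtlas 𝓘(ℂ) ω M := pullbackChart_mem_maximalAtlas Φ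
    (IsManifold.subset_maximalAtlas (Or.inr rfl))
  have has : ∀ p, p ∈ a.source ↔ Φ p ≠ OnePoint.infty := fun p => by
    simp [a, pullbackChart, sphereChart_source]
  have hbs : ∀ p, p ∈ b.source ↔ Φ p ≠ ((0 : ℂ) : OnePoint ℂ) := fun p => by
    simp [b, pullbackChart, sphereChartInv_source]
  have hav : ∀ w : ℂ, a (Φ.symm (w : OnePoint ℂ)) = w := fun w => by
    change sphereChart (Φ (Φ.symm (w : OnePoint ℂ))) = w
    rw [Φ.apply_symm_apply, sphereChart_coe]
  have hbv : ∀ w : ℂ, b (Φ.symm (sphereInv (w : OnePoint ℂ))) = w := fun w => by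
    change sphereChart (sphereInv (Φ (Φ.symm (sphereInv (w : OnePoint ℂ))))) = w
    rw [Φ.apply_symm_apply, sphereInv_sphereInv, sphereChart_coe]
  have hat : ∀ w, w ∈ a.target := fun w => by
    have h := a.map_source ((has (Φ.symm (w : OnePoint ℂ))).2 (by simp))
    rwa [hav] at h
  have hbt : ∀ w, w ∈ b.target := fun w => by
    have h := b.map_source ((hbs (Φ.symm (sphereInv (w : OnePoint ℂ)))).2 (by
      rw [Φ.apply_symm_apply]
      intro h
      have h2 := congrArg sphereInv h
      rw [sphereInv_sphereInv, sphereInv_zero] at h2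
      exact OnePoint.coe_ne_infty _ h2))
    rwa [hbv] at h
  have hab : ∀ w : ℂ, w ≠ 0 → (b ∘ a.symm) w = w⁻¹ := fun w hw => by
    change sphereChart (sphereInv (Φ (Φ.symm (w : OnePoint ℂ)))) = w⁻¹
    rw [Φ.apply_symm_apply, sphereInv_coe hw, sphereChart_coe]
  have hder : ∀ w : ℂ, w ≠ 0 → deriv (b ∘ a.symm) w = -(w ^ 2)⁻¹ := fun w hw =>
    ((hasDerivAt_inv hw).congr_of_eventuallyEq
      (Filter.eventuallyEq_of_mem (isOpen_ne.mem_nhds hw) hab)).deriv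
  have htr : ∀ w : ℂ, w ≠ 0 → θ a w = θ b w⁻¹ * (-(w ^ 2)⁻¹) ^ k := by
    intro w hw
    have hsymm : a.symm w = Φ.symm (w : OnePoint ℂ) := rfl
    have h := hθ.transform a ha b hb (Φ.symm (w : OnePoint ℂ))
      ⟨(has _).2 (by simp), (hbs _).2 (by simpa using hw)⟩
    rw [hav, hder w hw, ← hsymm] at h
    rw [h, ← hab w hw]
    rfl
  have hdiff : ∀ c ∈ IsManifold.maximalAtlas 𝓘(ℂ) ω M, (∀ w, w ∈ c.target) →
      Differentiable ℂ (θ c) := fun c hc ht w =>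
    (hθ.holomorphic c hc).differentiableAt (c.open_target.mem_nhds (ht w))
  have za : ∀ w, θ a w = 0 := by
    intro w
    refine (hdiff a ha hat).apply_eq_of_tendsto_cocompact w ?_
    have hinv : Filter.Tendsto (fun w : ℂ => w⁻¹) (Filter.cocompact ℂ) (nhds 0) := by
      rw [← Metric.cobounded_eq_cocompact]
      exact Filter.tendsto_inv₀_cobounded
    have h1 := (((hdiff b hb hbt).continuous.tendsto 0).comp hinv).mul
      (((hinv.pow 2).neg).pow k)
    have h2 : θ b 0 * (-(0 : ℂ) ^ 2) ^ k = 0 := by simp [hk]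
    rw [h2] at h1
    refine h1.congr' ?_
    filter_upwards [(isCompact_singleton (x := (0 : ℂ))).compl_mem_cocompact] with x hx
    rw [htr x hx, Function.comp_apply, inv_pow]
  -- In the other coordinate the form vanishes away from 0 by the transition law, and at 0 by
  -- continuity.
  have zb : ∀ w, θ b w = 0 := by
    have hdense : Dense ({0}ᶜ : Set ℂ) := dense_compl_singleton 0
    have := Continuous.ext_on hdense (hdiff b hb hbt).continuous continuous_const
      (g := fun _ => (0 : ℂ)) fun w hw => by
        have hw0 : w ≠ 0 := hw
        have h := htr w⁻¹ (inv_ne_zero hw0)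
        rw [za, inv_inv] at h
        exact (mul_eq_zero.1 h.symm).resolve_right (pow_ne_zero _ (by simpa using hw0))
    exact fun w => congrFun this w
  have hp := e.map_target hz
  rw [← e.right_inv hz]
  by_cases hinf : Φ (e.symm z) = OnePoint.infty
  · rw [hθ.transform e he b hb _ ⟨hp, (hbs _).2 (by rw [hinf]; exact OnePoint.infty_ne_coe _)⟩, zb,
      zero_mul]
  · rw [hθ.transform e he a ha _ ⟨hp, (has _).2 hinf⟩, za, zero_mul]

end Sphere

end Willmore
end

/-! ### The main theorem. -/

theorem lemma6p1 {M : Type*} [TopologicalSpace M] [ChartedSpace ℂ M] [IsManifold 𝓘(ℂ) ω M]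
    (y : M → Q41) (hy : IsWillmore y) :
    -- canonical lifts exist locally, in every complex coordinate
    (∀ e ∈ IsManifold.maximalAtlas 𝓘(ℂ) ω M, ∀ z ∈ e.target,
      ∃ (U : Set ℂ) (Y : ℂ → Fin 6 → ℝ), z ∈ U ∧ IsCanonicalLift y e U Y) ∧
    -- (i) `Θ (dz)^6` is a globally defined holomorphic 6-form
    (∃ θ : OpenPartialHomeomorph M ℂ → ℂ → ℂ, IsHolomorphicForm M 6 θ ∧
      ∀ e ∈ IsManifold.maximalAtlas 𝓘(ℂ) ω M, ∀ (U : Set ℂ) (Y : ℂ → Fin 6 → ℝ),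
        IsCanonicalLift y e U Y → ∀ z ∈ U, θ e z = Theta Y z) ∧
    -- (ii) `M` is the Riemann sphere
    (Nonempty (M ≃ₘ^ω⟮𝓘(ℂ), 𝓘(ℂ)⟯ (OnePoint ℂ)) →
      (∀ e ∈ IsManifold.maximalAtlas 𝓘(ℂ) ω M, ∀ (U : Set ℂ) (Y : ℂ → Fin 6 → ℝ),
        IsCanonicalLift y e U Y → ∀ z ∈ U, Theta Y z = 0) ∧
      IsSWillmore y ∧
      -- off the umbilic points the normalized lift of the dual surface exists
      (∀ e ∈ IsManifold.maximalAtlas 𝓘(ℂ) ω M, ∀ (U : Set ℂ) (Y : ℂ → Fin 6 → ℝ),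
        IsCanonicalLift y e U Y → (∀ z ∈ U, kappa Y z ≠ 0) →
        ∃ (μ : ℂ → ℂ) (Yh : ℂ → Fin 6 → ℝ),
          ContDiffOn ℝ ∞ Yh U ∧ IsMu Y U μ ∧ IsDualLift Y U μ Yh) ∧
      -- `Ω (dz)^8` extends to a holomorphic 8-form on the sphere, and this form vanishes
      ∃ η : OpenPartialHomeomorph M ℂ → ℂ → ℂ, IsHolomorphicForm M 8 η ∧
        (∀ e ∈ IsManifold.maximalAtlas 𝓘(ℂ) ω M, ∀ (U : Set ℂ) (Y : ℂ → Fin 6 → ℝ),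
          IsCanonicalLift y e U Y → (∀ z ∈ U, kappa Y z ≠ 0) →
          ∀ μ : ℂ → ℂ, IsMu Y U μ → ∀ Yh : ℂ → Fin 6 → ℝ, IsDualLift Y U μ Yh →
          ∀ z ∈ U, η e z = Omega Y Yh z ∧
            ∀ (L R : Fin 6 → ℝ) (l₁ l₂ : ℂ), IsNullFrame Y z L R →
              kappa Y z = l₁ • cplx L + l₂ • cplx R →
              Omega Y Yh z = 4 * (rho Y μ z * l₁ * l₂) ^ 2) ∧
        ∀ e ∈ IsManifold.maximalAtlas 𝓘(ℂ) ω M, ∀ z ∈ e.target, η e z = 0) := by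
  have hcs := hy.conformalSpacelike
  have tΘ : ∀ (U U' : Set ℂ) (Y Y' : ℂ → Fin 6 → ℝ) (h : ℂ → ℂ) (r : ℂ → ℝ),
      IsCoordChange U Y U' Y' h r → ∀ z ∈ U, Theta Y z = Theta Y' (h z) * deriv h z ^ 6 :=
    fun _ _ _ _ _ _ C _ hz => C.Theta_eq hz
  have fΘ : IsHolomorphicForm M 6 (liftForm y Theta) :=
    isHolomorphicForm_liftForm hcs tΘ fun e he U Y hY z hz =>
      differentiableAt_of_dzbar (diffAt (contDiffAt_Theta (hY.toIsLift.contDiffAt hz)))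
        (hY.isIsothermal.dzbar_Theta (hy.willmoreEq he hY) hz)
  refine ⟨fun e he z hz => hcs.exists_canonicalLift he hz,
    ⟨liftForm y Theta, fΘ, fun e he U Y hY z hz => liftForm_eq tΘ he hY hz⟩, ?_⟩
  rintro ⟨Φ⟩
  have zΘ : ∀ e ∈ IsManifold.maximalAtlas 𝓘(ℂ) ω M, ∀ (U : Set ℂ) (Y : ℂ → Fin 6 → ℝ),
      IsCanonicalLift y e U Y → ∀ z ∈ U, Theta Y z = 0 := fun e he U Y hY z hz => by
    rw [← liftForm_eq tΘ he hY hz]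
    exact fΘ.eq_zero_of_sphere (by norm_num) Φ he (hY.subset hz)
  -- `quartic` defines a form of weight 4; its square is the extension of Ω across the umbilic
  -- points.
  have tq : ∀ (U U' : Set ℂ) (Y Y' : ℂ → Fin 6 → ℝ) (h : ℂ → ℂ) (r : ℂ → ℝ),
      IsCoordChange U Y U' Y' h r → ∀ z ∈ U,
        quartic Y z ^ 2 = quartic Y' (h z) ^ 2 * deriv h z ^ 8 :=
    fun _ _ _ _ _ _ C _ hz => by rw [C.quartic_eq hz]; ring
  have fq : IsHolomorphicForm M 8 (liftForm y fun Y z => quartic Y z ^ 2) :=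
    isHolomorphicForm_liftForm hcs tq fun e he U Y hY z hz =>
      (differentiableAt_of_dzbar (diffAt (contDiffAt_quartic (hY.toIsLift.contDiffAt hz)))
        (hY.isIsothermal.dzbar_quartic (hy.willmoreEq he hY) hz (zΘ e he U Y hY z hz))).pow 2
  refine ⟨zΘ, ⟨hy, fun e he U Y hY z hz hk => ?_⟩,
    fun e he U Y hY hk => hY.isIsothermal.exists_dualLift (zΘ e he U Y hY) hk,
    liftForm y fun Y z => quartic Y z ^ 2, fq, fun e he U Y hY hk μ hμ Yh hd z hz => ?_,
    fun e he z hz => fq.eq_zero_of_sphere (by norm_num) Φ he hz⟩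
  · obtain ⟨c, hc⟩ := hY.isIsothermal.exists_DzbarKappa_eq hz (zΘ e he U Y hY z hz) hk
    refine ⟨conj (-2 * c), ?_⟩
    rw [hc, Complex.conj_conj]
    congr 1
    ring
  · have hO := hY.isIsothermal.Omega_eq (hy.willmoreEq he hY) hk hμ hd hz
    refine ⟨?_, fun L R l₁ l₂ hLR hκ => ?_⟩
    · rw [liftForm_eq tq he hY hz, hO, hY.isIsothermal.quartic_eq hk hμ hz]
    · rw [hO, IsIsothermal.lor_kappa_of_nullFrame hLR hκ]
      ring
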